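/- Let $\mathbb{k}$ be a field of characteristic $0$ (for instance $\mathbb{Q}$). Let $x_1,x_2,\dots$ and $y_1,y_2,\dots$ be commuting variables and $\theta_1,\theta_2,\dots,\phi_1,\phi_2,\dots$ variables that anticommute with one another (with squares $0$) and commute with all $x_i,y_j$. Let $\mathscr{P}^{S_\infty}$ be the space of formal series over $\mathbb{k}$ of bounded degree in $(x,\theta)$ that are invariant under simultaneous permutations of the $x_i$ and the $\theta_i$. Write $\overleftarrow{f}$ for the image of $f$ under the linear involution $\theta_{j_1}\cdots\theta_{j_m}\mapsto\theta_{j_m}\cdots\theta_{j_1}$ that reverses the order of the anticommuting variables and fixes the commuting ones. A superpartition $\Lambda=(\Lambda_1,\dots,\Lambda_m;\Lambda_{m+1},\dots,\Lambda_\ell)$ consists of integers $\Lambda_1>\dots>\Lambda_m\ge 0$ and $\Lambda_{m+1}\ge\dots\ge\Lambda_\ell>0$ (either list may be empty); $\Lambda\vdash(n|m)$ means that it has $m$ entries before the semicolon and that its entries sum to $n$; $\mathrm{SPar}$ is the set of all superpartitions. Put $z_\Lambda=\prod_{k\ge1}k^{n_k}\,n_k!$, where $n_k$ is the number of entries after the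 semicolon equal to $k$. Let - $m_\Lambda(x,\theta)$ be the sum of the distinct terms $\theta_{\sigma(1)}\cdots\theta_{\sigma(m)}\,x_{\sigma(1)}^{\Lambda_1}\cdots x_{\sigma(\ell)}^{\Lambda_\ell}$, over permutations $\sigma$ of the indices; - $h_n=\sum_{\Lambda\vdash(n|0)}m_\Lambda$, $\tilde h_n=\sum_{\Lambda\vdash(n|1)}(\Lambda_1+1)\,m_\Lambda$ and $h_\Lambda=\tilde h_{\Lambda_1}\cdots\tilde h_{\Lambda_m}\,h_{\Lambda_{m+1}}\cdots h_{\Lambda_\ell}$; - $p_n=\sum_i x_i^n$ $(n\ge1)$, $\tilde p_n=\sum_i\theta_i x_i^n$ $(n\ge0)$ and $p_\Lambda=\tilde p_{\Lambda_1}\cdots\tilde p_{\Lambda_m}\,p_{\Lambda_{m+1}}\cdots p_{\Lambda_\ell}$. Then the formal infinite product $K=\prod_{i,j\ge1}\dfrac{1}{1-x_iy_j-\theta_i\phi_j}$ is well defined and $$K=\sum_{\Lambda\in\mathrm{SPar}}\overleftarrow{m_\Lambda(x,\theta)}\;h_\Lambda(y,\phi).$$ Moreover, all $m_\Lambda$,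 $h_\Lambda$, $p_\Lambda$ lie in $\mathscr{P}^{S_\infty}$, which is stable under $f\mapsto\overleftarrow{f}$; there is exactly one bilinear form $\langle\!\langle\,\cdot\,|\,\cdot\,\rangle\!\rangle$ on $\mathscr{P}^{S_\infty}$ with $\langle\!\langle\overleftarrow{p_\Lambda}\,|\,p_\Omega\rangle\!\rangle=z_\Lambda\,\delta_{\Lambda,\Omega}$ for all superpartitions $\Lambda,\Omega$; and for this form the complete functions and the monomial functions are dual: $\langle\!\langle\overleftarrow{h_\Lambda}\,|\,m_\Omega\rangle\!\rangle=\delta_{\Lambda,\Omega}$ for all $\Lambda,\Omega$. -/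

import Mathlib

/-!
Formal superseries in commuting variables `x i` and anticommuting variables `θ i`, superpartitions,
and the monomial, complete and power-sum symmetric functions in superspace.
-/

namespace SuperSym

/-! ### The completed Grassmann algebra -/

/-- Formal (possibly infinite) sums `∑ c_A θ_A` over finite sets `A = {j₁ < ⋯ < j_m}` of indices,
where `θ_A = θ_{j₁} ⋯ θ_{j_m}`; such a sum is recorded by its coefficients `A ↦ c_A`. -/
def Grassmann (σ R : Type*) : Type _ := Finset σ → R

namespace Grassmann

variable {σ R : Type*}

instance [AddCommGroup R] : AddCommGroup (Grassmann σ R) :=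
  inferInstanceAs (AddCommGroup (Finset σ → R))

instance [CommRing R] : Module R (Grassmann σ R) :=
  inferInstanceAs (Module R (Finset σ → R))

@[ext] theorem ext {f g : Grassmann σ R} (h : ∀ A, f A = g A) : f = g := funext h

theorem add_apply [AddCommGroup R] (f g : Grassmann σ R) (A : Finset σ) : (f + g) A = f A + g A := rfl

theorem zero_apply [AddCommGroup R] (A : Finset σ) : (0 : Grassmann σ R) A = 0 := rfl

variable [LinearOrder σ] [CommRing R]

/-- The number of pairs `(b, c) ∈ B × C` with `c < b`: the number of transpositions needed to sort
`θ_B θ_C` into increasing order. -/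
def inversions (B C : Finset σ) : ℕ := ((B ×ˢ C).filter fun p => p.2 < p.1).card

/-- `θ_B θ_C = (-1) ^ inversions B C • θ_{B ∪ C}` if `B` and `C` are disjoint, and `0` otherwise. -/
instance : Mul (Grassmann σ R) :=
  ⟨fun f g A => ∑ B ∈ A.powerset, (-1) ^ inversions B (A \ B) * f B * g (A \ B)⟩

instance : One (Grassmann σ R) := ⟨fun A => if A = ∅ then 1 else 0⟩

theorem mul_apply (f g : Grassmann σ R) (A : Finset σ) :
    (f * g) A = ∑ B ∈ A.powerset, (-1) ^ inversions B (A \ B) * f B * g (A \ B) := rfl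

theorem one_apply (A : Finset σ) : (1 : Grassmann σ R) A = if A = ∅ then 1 else 0 := rfl

theorem inversions_union_left {B C : Finset σ} (D : Finset σ) (h : Disjoint B C) :
    inversions (B ∪ C) D = inversions B D + inversions C D := by
  unfold inversions
  rw [Finset.union_product, Finset.filter_union, Finset.card_union_of_disjoint]
  refine Finset.disjoint_filter_filter ?_
  rw [Finset.disjoint_product]
  exact Or.inl h

theorem inversions_union_right (B : Finset σ) {C D : Finset σ} (h : Disjoint C D) :
    inversions B (C ∪ D) = inversions B C + inversions B D := by
  unfold inversions
  rw [Finset.product_union, Finset.filter_union, Finset.card_union_of_disjoint]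
  refine Finset.disjoint_filter_filter ?_
  rw [Finset.disjoint_product]
  exact Or.inr h

theorem mul_assoc' (f g h : Grassmann σ R) : f * g * h = f * (g * h) := by
  ext A
  simp only [mul_apply, Finset.mul_sum, Finset.sum_mul]
  rw [Finset.sum_sigma', Finset.sum_sigma']
  refine Finset.sum_nbij' (fun p => ⟨p.2, p.1 \ p.2⟩) (fun p => ⟨p.1 ∪ p.2, p.1⟩) ?_ ?_ ?_ ?_ ?_
  · rintro ⟨B, C⟩ hp
    simp only [Finset.mem_sigma, Finset.mem_powerset] at hp ⊢
    exact ⟨hp.2.trans hp.1, Finset.sdiff_subset_sdiff hp.1 subset_rfl⟩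
  · rintro ⟨C, D⟩ hp
    simp only [Finset.mem_sigma, Finset.mem_powerset] at hp ⊢
    exact ⟨Finset.union_subset hp.1 (hp.2.trans Finset.sdiff_subset), Finset.subset_union_left⟩
  · rintro ⟨B, C⟩ hp
    simp only [Finset.mem_sigma, Finset.mem_powerset] at hp
    simp [Finset.union_sdiff_of_subset hp.2]
  · rintro ⟨C, D⟩ hp
    simp only [Finset.mem_sigma, Finset.mem_powerset] at hp
    have : Disjoint D C := Finset.disjoint_of_subset_left hp.2 Finset.sdiff_disjoint
    simp [Finset.union_sdiff_cancel_left this.symm]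
  · rintro ⟨B, C⟩ hp
    simp only [Finset.mem_sigma, Finset.mem_powerset] at hp
    obtain ⟨hBA, hCB⟩ := hp
    have e1 : (A \ C) \ (B \ C) = A \ B := by
      ext a
      have := @hCB a
      simp only [Finset.mem_sdiff]
      tauto
    have e2 : A \ C = (B \ C) ∪ (A \ B) := by
      ext a
      have := @hCB a
      have := @hBA a
      simp only [Finset.mem_sdiff, Finset.mem_union]
      tauto
    have e3 : inversions B (A \ B) = inversions C (A \ B) + inversions (B \ C) (A \ B) := by
      rw [← inversions_union_left _ Finset.disjoint_sdiff, Finset.union_sdiff_of_subset hCB]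
    have d : Disjoint (B \ C) (A \ B) :=
      Finset.disjoint_of_subset_left Finset.sdiff_subset Finset.disjoint_sdiff
    have e4 : inversions C (A \ C) = inversions C (B \ C) + inversions C (A \ B) := by
      rw [e2, inversions_union_right _ d]
    simp only [e1, e3, e4, pow_add]
    ring

theorem one_mul' (f : Grassmann σ R) : 1 * f = f := by
  ext A
  rw [mul_apply, Finset.sum_eq_single ∅]
  · simp [one_apply, inversions]
  · intro B _ hB
    simp [one_apply, hB]
  · simp

theorem mul_one' (f : Grassmann σ R) : f * 1 = f := by
  ext A
  rw [mul_apply, Finset.sum_eq_single A]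
  · simp [one_apply, inversions]
  · intro B hB hBA
    have : A \ B ≠ ∅ := fun h =>
      hBA (subset_antisymm (Finset.mem_powerset.1 hB) (Finset.sdiff_eq_empty_iff_subset.1 h))
    simp [one_apply, this]
  · simp

instance : Ring (Grassmann σ R) :=
  { (inferInstance : AddCommGroup (Grassmann σ R)),
    (inferInstance : Mul (Grassmann σ R)),
    (inferInstance : One (Grassmann σ R)) with
    mul_assoc := mul_assoc'
    one_mul := one_mul'
    mul_one := mul_one'
    left_distrib := fun f g h => by
      ext A
      simp only [mul_apply, add_apply, mul_add, Finset.sum_add_distrib]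
    right_distrib := fun f g h => by
      ext A
      simp only [mul_apply, add_apply, mul_add, add_mul, Finset.sum_add_distrib]
    zero_mul := fun f => by
      ext A
      simp [mul_apply, zero_apply]
    mul_zero := fun f => by
      ext A
      simp [mul_apply, zero_apply] }

/-- The anticommuting variable `θ_i`. -/
def theta (R : Type*) [CommRing R] (i : σ) : Grassmann σ R := fun A => if A = {i} then 1 else 0

/-- The product `θ_{j₁} θ_{j₂} ⋯ θ_{j_m}`, in the order of the list. -/
def thetaProd (R : Type*) [CommRing R] (l : List σ) : Grassmann σ R := (l.map (theta R)).prod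

/-- The involution `θ_{j₁} ⋯ θ_{j_m} ↦ θ_{j_m} ⋯ θ_{j₁}`, extended linearly. For
`A = {j₁ < ⋯ < j_m}` the image of `θ_A` is a multiple of `θ_A`. -/
def rev (f : Grassmann σ R) : Grassmann σ R :=
  fun A => f A * thetaProd R (A.sort (· ≤ ·)).reverse A

/-- The substitution `θ_i ↦ θ_{s i}` for a permutation `s`, extended linearly: for
`B = {j₁ < ⋯ < j_m}` the image `θ_{s j₁} ⋯ θ_{s j_m}` of `θ_B` is a multiple of `θ_{s B}`. -/
def permute (s : Equiv.Perm σ) (f : Grassmann σ R) : Grassmann σ R :=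
  fun A =>
    f (A.map s.symm.toEmbedding) *
      thetaProd R (((A.map s.symm.toEmbedding).sort (· ≤ ·)).map s) A

open Classical in
/-- The substitution `θ_i ↦ θ_{e i}` for an order embedding `e` of alphabets. -/
noncomputable def embed {τ : Type*} [LinearOrder τ] (e : σ ↪o τ) (f : Grassmann σ R) :
    Grassmann τ R :=
  fun A => if (A : Set τ) ⊆ Set.range e then f (A.preimage e e.injective.injOn) else 0

end Grassmann

/-! ### Formal superseries -/

/-- Formal series in commuting variables `x i` and anticommuting variables `θ i`, for `i : σ`.
The `x i` commute with everything. -/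
abbrev SuperSeries (σ R : Type*) : Type _ := MvPowerSeries σ (Grassmann σ R)

section Series

variable {σ : Type*} [LinearOrder σ] {R : Type*} [CommRing R]

/-- The coefficient of `θ_A x^a`. -/
def coef (a : σ →₀ ℕ) (A : Finset σ) (f : SuperSeries σ R) : R := f a A

/-- The commuting variable `x_i`. -/
noncomputable def bosonic (R : Type*) [CommRing R] (i : σ) : SuperSeries σ R := MvPowerSeries.X i

/-- The anticommuting variable `θ_i`. -/
noncomputable def fermionic (R : Type*) [CommRing R] (i : σ) : SuperSeries σ R :=
  MvPowerSeries.C (Grassmann.theta R i)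

/-- The involution that reverses the order of the anticommuting variables. -/
def rev (f : SuperSeries σ R) : SuperSeries σ R := fun a => Grassmann.rev (f a)

/-- The simultaneous substitution `x_i ↦ x_{s i}`, `θ_i ↦ θ_{s i}`. -/
noncomputable def permute (s : Equiv.Perm σ) (f : SuperSeries σ R) : SuperSeries σ R :=
  fun a => Grassmann.permute s (f (a.mapDomain s.symm))

open Classical in
/-- The simultaneous substitution `x_i ↦ x_{e i}`, `θ_i ↦ θ_{e i}` for an order embedding `e` of
alphabets. -/
noncomputable def embed {τ : Type*} [LinearOrder τ] (e : σ ↪o τ) (f : SuperSeries σ R) :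
    SuperSeries τ R :=
  fun a =>
    if (a.support : Set τ) ⊆ Set.range e then
      Grassmann.embed e (f (a.comapDomain e e.injective.injOn))
    else 0

/-- Each monomial occurs in only finitely many members of the family. -/
def FormallySummable {ι : Type*} (f : ι → SuperSeries σ R) : Prop :=
  ∀ a A, {i | coef a A (f i) ≠ 0}.Finite

/-- The sum of a formally summable family. -/
noncomputable def formalSum {ι : Type*} (f : ι → SuperSeries σ R) : SuperSeries σ R :=
  fun a A => ∑ᶠ i, coef a A (f i)

/-- `F` is the product of the family `f`, in any order: for each monomial, every finite product of
distinct members of the family, in whatever order, that contains certain finitely many factors has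
the same coefficient as `F`. -/
def HasFormalProd {ι : Type*} (f : ι → SuperSeries σ R) (F : SuperSeries σ R) : Prop :=
  ∀ a A, ∃ S : Finset ι, ∀ l : List ι, l.Nodup → (∀ i ∈ S, i ∈ l) →
    coef a A (l.map f).prod = coef a A F

open Classical in
/-- The infinite product of a family (`0` if it does not converge). -/
noncomputable def formalProd {ι : Type*} (f : ι → SuperSeries σ R) : SuperSeries σ R :=
  if h : ∃ F, HasFormalProd f F then h.choose else 0

end Series

/-- The symmetric functions in superspace in infinitely many variables: formal superseries of
bounded degree that are invariant under the diagonal action of the symmetric group on the commuting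
and the anticommuting variables. -/
def IsSymmetric {R : Type*} [CommRing R] (f : SuperSeries ℕ R) : Prop :=
  (∃ d : ℕ, ∀ a A, coef a A f ≠ 0 → a.degree ≤ d ∧ A.card ≤ d) ∧
    ∀ i : ℕ, permute (Equiv.swap i (i + 1)) f = f

/-- The module of symmetric functions in superspace. -/
def symmetricSuperfunctions (R : Type*) [CommRing R] : Submodule R (SuperSeries ℕ R) where
  carrier := {f | IsSymmetric f}
  zero_mem' := by
    refine ⟨⟨0, fun a A h => (h rfl).elim⟩, fun i => ?_⟩
    funext a
    ext A
    exact zero_mul _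
  add_mem' := by
    rintro f g ⟨⟨d, hd⟩, hf⟩ ⟨⟨e, he⟩, hg⟩
    refine ⟨⟨max d e, fun a A h => ?_⟩, fun i => ?_⟩
    · by_cases h1 : coef a A f = 0
      · have h2 : coef a A g ≠ 0 := by
          intro h2
          apply h
          change coef a A f + coef a A g = 0
          rw [h1, h2, add_zero]
        exact ⟨(he a A h2).1.trans (le_max_right _ _), (he a A h2).2.trans (le_max_right _ _)⟩
      · exact ⟨(hd a A h1).1.trans (le_max_left _ _), (hd a A h1).2.trans (le_max_left _ _)⟩
    · have : permute (Equiv.swap i (i + 1)) (f + g) =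
          permute (Equiv.swap i (i + 1)) f + permute (Equiv.swap i (i + 1)) g := by
        funext a
        ext A
        exact add_mul _ _ _
      rw [this, hf, hg]
  smul_mem' := by
    rintro c f ⟨⟨d, hd⟩, hf⟩
    refine ⟨⟨d, fun a A h => hd a A fun h1 => h ?_⟩, fun i => ?_⟩
    · change c * coef a A f = 0
      rw [h1, mul_zero]
    · have : permute (Equiv.swap i (i + 1)) (c • f) =
          c • permute (Equiv.swap i (i + 1)) f := by
        funext a
        ext A
        exact mul_assoc _ _ _
      rw [this, hf]

/-! ### Superpartitions -/

/-- A superpartition `(Λ₁ > ⋯ > Λ_m ≥ 0 ; Λ_{m+1} ≥ ⋯ ≥ Λ_ℓ > 0)`; zeros at the end of the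
symmetric component are not recorded. -/
@[ext] structure SuperPartition where
  /-- The antisymmetric component. -/
  anti : List ℕ
  /-- The symmetric component. -/
  sym : List ℕ
  anti_decreasing : anti.Pairwise (· > ·)
  sym_decreasing : sym.Pairwise (· ≥ ·)
  sym_pos : ∀ k ∈ sym, 0 < k
deriving DecidableEq

namespace SuperPartition

/-- All the parts: those of the antisymmetric component, then those of the symmetric one. -/
def parts (Λ : SuperPartition) : List ℕ := Λ.anti ++ Λ.sym

/-- The bosonic degree. -/
def degree (Λ : SuperPartition) : ℕ := Λ.parts.sum

/-- The fermionic degree. -/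
def sector (Λ : SuperPartition) : ℕ := Λ.anti.length

/-- `z_Λ = ∏_{k ≥ 1} k ^ n(k) * n(k)!`, with `n(k)` the number of parts `k` in the symmetric
component. -/
def z (Λ : SuperPartition) : ℕ :=
  ∏ k ∈ Λ.sym.toFinset, k ^ Λ.sym.count k * (Λ.sym.count k).factorial

end SuperPartition

/-- The superpartitions of `(n|m)`. -/
def SPar (n m : ℕ) : Set SuperPartition := {Λ | Λ.degree = n ∧ Λ.sector = m}

/-! ### Symmetric functions in superspace -/

section Functions

variable (R : Type*) [CommRing R]

/-- The term `θ_{s 1} ⋯ θ_{s m} x_{s 1}^{Λ₁} x_{s 2}^{Λ₂} ⋯ x_{s ℓ}^{Λ_ℓ}` (with variables numbered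
from `0`). -/
noncomputable def monomialTerm (Λ : SuperPartition) (s : Equiv.Perm ℕ) : SuperSeries ℕ R :=
  MvPowerSeries.monomial
    (∑ i ∈ Finset.range Λ.parts.length, Finsupp.single (s i) (Λ.parts.getD i 0))
    (Grassmann.thetaProd R ((List.range Λ.sector).map s))

/-- The monomial function `m_Λ`: the sum of the distinct terms `monomialTerm R Λ s`. -/
noncomputable def superMonomial (Λ : SuperPartition) : SuperSeries ℕ R :=
  formalSum fun u : Set.range (monomialTerm R Λ) => (u : SuperSeries ℕ R)

/-- The bosonic complete function `h_n = ∑_{λ ⊢ n} m_λ`. -/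
noncomputable def complete (n : ℕ) : SuperSeries ℕ R :=
  ∑ᶠ Λ ∈ SPar n 0, superMonomial R Λ

/-- The fermionic complete function `h̃_n = ∑_{Λ ⊢ (n|1)} (Λ₁ + 1) m_Λ`. -/
noncomputable def completeTilde (n : ℕ) : SuperSeries ℕ R :=
  ∑ᶠ Λ ∈ SPar n 1, (Λ.anti.headD 0 + 1) • superMonomial R Λ

/-- `h_Λ = h̃_{Λ₁} ⋯ h̃_{Λ_m} h_{Λ_{m+1}} ⋯ h_{Λ_ℓ}`, multiplied from left to right. -/
noncomputable def superComplete (Λ : SuperPartition) : SuperSeries ℕ R :=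
  (Λ.anti.map (completeTilde R)).prod * (Λ.sym.map (complete R)).prod

/-- The bosonic power sum `p_n = ∑_i x_i ^ n`, for `n ≥ 1`. -/
noncomputable def powerSum (n : ℕ) : SuperSeries ℕ R :=
  formalSum fun i : ℕ => bosonic R i ^ n

/-- The fermionic power sum `p̃_n = ∑_i θ_i x_i ^ n`. -/
noncomputable def powerSumTilde (n : ℕ) : SuperSeries ℕ R :=
  formalSum fun i : ℕ => fermionic R i * bosonic R i ^ n

/-- `p_Λ = p̃_{Λ₁} ⋯ p̃_{Λ_m} p_{Λ_{m+1}} ⋯ p_{Λ_ℓ}`, multiplied from left to right. -/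
noncomputable def superPowerSum (Λ : SuperPartition) : SuperSeries ℕ R :=
  (Λ.anti.map (powerSumTilde R)).prod * (Λ.sym.map (powerSum R)).prod

/-! ### The kernel -/

/-- The index of `x_i` and `θ_i` in the double alphabet `(x, θ; y, φ)`. -/
def left : ℕ ↪o (ℕ ⊕ₗ ℕ) :=
  OrderEmbedding.ofStrictMono (fun i => toLex (Sum.inl i)) Sum.Lex.inl_strictMono

/-- The index of `y_j` and `φ_j` in the double alphabet `(x, θ; y, φ)`. -/
def right : ℕ ↪o (ℕ ⊕ₗ ℕ) :=
  OrderEmbedding.ofStrictMono (fun j => toLex (Sum.inr j)) Sum.Lex.inr_strictMono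

/-- `1 - x_i y_j - θ_i φ_j`. -/
noncomputable def kernelDenominator (i j : ℕ) : SuperSeries (ℕ ⊕ₗ ℕ) R :=
  1 - bosonic R (left i) * bosonic R (right j) - fermionic R (left i) * fermionic R (right j)

/-- The inverse of `1 - x_i y_j - θ_i φ_j`, for a pair `(i, j)`. -/
noncomputable def kernelFactor (q : ℕ × ℕ) : SuperSeries (ℕ ⊕ₗ ℕ) R :=
  Ring.inverse (kernelDenominator R q.1 q.2)

/-- `K = ∏_{i,j} 1 / (1 - x_i y_j - θ_i φ_j)`. -/
noncomputable def kernel : SuperSeries (ℕ ⊕ₗ ℕ) R := formalProd (kernelFactor R)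

end Functions

end SuperSym

open SuperSym

/-! A product of one odd factor in (x, θ) and one in (y, φ) is even, and even series commute. The
comparison of kernels can therefore be done in the commutative ring `evenSubalgebra`, with the tools
used for ordinary symmetric functions. Give x_i and θ_i weight 1, y_j and φ_j weight 0, and record
the weight by a formal variable X (`grading`). Let E be `kernelSeries`, the sum over Λ of z_Λ⁻¹ ∏
p̃_r(x,θ) p̃_r(y,φ) ∏ p_k(x) p_k(y) in the appropriate powers of X. It is the exponential of ∑
p_k(x) p_k(y) X^k / k + ∑ p̃_r(x,θ) p̃_r(y,φ) X^(r+1). Only its logarithmic derivative is needed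
(`expCoeff_succ`), since in characteristic 0 the logarithmic derivative determines a series with
constant term 1 (`HasLogDeriv.eq`).

Two products share this logarithmic derivative once some variables are set to 0. If finitely many
variables are kept in both alphabets, it is the product of the geometric series of x_i y_j + θ_i
φ_j, because (xy + θφ)^(r+1) = (xy)^(r+1) + (r+1)(xy)^r θφ. Hence E is the kernel K (`kernel_eq`).
If finitely many variables are kept in the left alphabet only, it is the product over i of ∑ (x_i^d
h_d + x_i^(d-1) θ_i h̃_(d-1)) X^d, by the Newton identities `newton_complete` and
`newton_completeTilde`. In this product the coefficient of θ_B x^b is, up to sign, a coefficient of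
m_Λ times h_Λ, where Λ is the type of θ_B x^b. It is 0 when two exponents on B coincide, because
h̃_n² = 0. Separating m factors θ from m factors h̃ costs the sign (-1)^(m choose 2), which is
exactly the effect of reversing m anticommuting variables. This gives the expansion of K.

For the duality, compare the coefficients of the leading monomial of m_Λ in E and in the expansion:
h_Λ = ∑ z_Γ⁻¹ c_Λ(p_Γ) p_Γ, with c_Λ = `canonicalCoef`. So pairing the reversal of h_Λ with p_Ω
gives c_Λ(p_Ω), and the functional it defines is c_Λ (`scalarProduct_rev_superComplete`), which
sends m_Ω to δ. The form exists and is unique because the p_Λ are a basis: the m_Λ are one, and the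
transition matrix is triangular for the number of parts (`of_canonicalCoef_superPowerSum_ne_zero`).
-/

namespace SuperSym

set_option linter.unusedSectionVars false

/-! ### Signs in the Grassmann algebra -/

namespace Grassmann

variable {σ R : Type*} [LinearOrder σ] [CommRing R]

theorem sum_apply {ι : Type*} (s : Finset ι) (f : ι → Grassmann σ R) (A : Finset σ) :
    (∑ i ∈ s, f i) A = ∑ i ∈ s, f i A := by
  classical
  induction s using Finset.induction_on with
  | empty => rfl
  | insert i s hi ih => rw [Finset.sum_insert hi, Finset.sum_insert hi, add_apply, ih]

theorem smul_apply (c : R) (f : Grassmann σ R) (A : Finset σ) : (c • f) A = c * f A := rfl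

/-- For disjoint sets each pair (b, c) is an inversion in exactly one of the two orders. -/
theorem inversions_add_inversions {B C : Finset σ} (h : Disjoint B C) :
    inversions B C + inversions C B = B.card * C.card := by
  have e : inversions C B = ((B ×ˢ C).filter fun p => ¬ p.2 < p.1).card := by
    unfold inversions
    refine Finset.card_nbij' Prod.swap Prod.swap ?_ ?_ (fun _ _ => rfl) (fun _ _ => rfl)
    · rintro ⟨c, b⟩ hp
      simp only [Finset.coe_filter, Finset.mem_product, Set.mem_ofPred_eq, Prod.swap] at hp ⊢
      exact ⟨hp.1.symm, hp.2.le.not_gt⟩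
    · rintro ⟨b, c⟩ hp
      simp only [Finset.coe_filter, Finset.mem_product, Set.mem_ofPred_eq, Prod.swap] at hp ⊢
      refine ⟨hp.1.symm, lt_of_le_of_ne (not_lt.1 hp.2) ?_⟩
      rintro rfl
      exact Finset.disjoint_left.1 h hp.1.1 hp.1.2
  rw [e]
  unfold inversions
  rw [Finset.card_filter_add_card_filter_not, Finset.card_product]

theorem sign_inversions_comm {B C : Finset σ} (h : Disjoint B C) :
    ((-1) ^ inversions B C : R) = (-1) ^ (B.card * C.card) * (-1) ^ inversions C B := by
  rw [← inversions_add_inversions h, pow_add, mul_assoc, ← pow_add, ← two_mul, pow_mul]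
  simp

instance : Algebra R (Grassmann σ R) :=
  Algebra.ofModule
    (fun r f g => by
      ext A
      simp only [mul_apply, smul_apply, Finset.mul_sum]
      exact Finset.sum_congr rfl fun _ _ => by ring)
    (fun r f g => by
      ext A
      simp only [mul_apply, smul_apply, Finset.mul_sum]
      exact Finset.sum_congr rfl fun _ _ => by ring)

theorem theta_apply (i : σ) (A : Finset σ) : theta R i A = if A = {i} then 1 else 0 := rfl

theorem theta_mul_apply (i : σ) (f : Grassmann σ R) (A : Finset σ) :
    (theta R i * f) A =
      if i ∈ A then (-1) ^ inversions {i} (A.erase i) * f (A.erase i) else 0 := by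
  rw [mul_apply]
  split_ifs with h
  · rw [Finset.sum_eq_single {i}]
    · rw [theta_apply, if_pos rfl, mul_one, Finset.erase_eq]
    · intro B _ hB
      rw [theta_apply, if_neg hB, mul_zero, zero_mul]
    · intro h1
      exact (h1 (Finset.mem_powerset.2 (Finset.singleton_subset_iff.2 h))).elim
  · refine Finset.sum_eq_zero fun B hB => ?_
    rw [theta_apply, if_neg, mul_zero, zero_mul]
    rintro rfl
    exact h (Finset.singleton_subset_iff.1 (Finset.mem_powerset.1 hB))

theorem thetaProd_nil : thetaProd R ([] : List σ) = 1 := rfl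

theorem thetaProd_cons (i : σ) (l : List σ) : thetaProd R (i :: l) = theta R i * thetaProd R l := by
  simp [thetaProd]

theorem thetaProd_append (l l' : List σ) :
    thetaProd R (l ++ l') = thetaProd R l * thetaProd R l' := by
  simp [thetaProd]

/-- All terms have degree in the anticommuting variables congruent to `p` modulo `2`. -/
def HasParity (p : ℕ) (f : Grassmann σ R) : Prop := ∀ A, f A ≠ 0 → A.card % 2 = p % 2

/-- Replacing B by its complement in A exchanges the factors. The sign depends only on the parities
of the two cardinalities, so homogeneity modulo 2 suffices. -/
theorem mul_eq_sign_mul {p q : ℕ} {f g : Grassmann σ R} (hf : HasParity p f) (hg : HasParity q g) :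
    f * g = ((-1) ^ (p * q) : R) • (g * f) := by
  ext A
  rw [smul_apply, mul_apply, mul_apply, Finset.mul_sum]
  refine Finset.sum_nbij' (fun B => A \ B) (fun B => A \ B) ?_ ?_ ?_ ?_ ?_
  · intro B _
    simp
  · intro B _
    simp
  · intro B hB
    exact Finset.sdiff_sdiff_eq_self (Finset.mem_powerset.1 hB)
  · intro B hB
    exact Finset.sdiff_sdiff_eq_self (Finset.mem_powerset.1 hB)
  · intro B hB
    rw [Finset.sdiff_sdiff_eq_self (Finset.mem_powerset.1 hB)]
    by_cases h1 : f B = 0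
    · simp [h1]
    by_cases h2 : g (A \ B) = 0
    · simp [h2]
    rw [sign_inversions_comm Finset.disjoint_sdiff, neg_one_pow_eq_pow_mod_two (n := p * q),
      neg_one_pow_eq_pow_mod_two (n := B.card * _), Nat.mul_mod, hf _ h1, hg _ h2, ← Nat.mul_mod]
    ring

theorem hasParity_theta (i : σ) : HasParity 1 (theta R i) := by
  intro A hA
  rw [theta_apply] at hA
  have : A = {i} := by
    by_contra h
    simp [h] at hA
  simp [this]

theorem theta_mul_theta (i j : σ) : theta R i * theta R j = -(theta R j * theta R i) := by
  rw [mul_eq_sign_mul (hasParity_theta i) (hasParity_theta j)]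
  simp

/-- Computed from the product itself, since anticommutation alone would only give 2 θ_i² = 0. -/
theorem theta_mul_self (i : σ) : theta R i * theta R i = 0 := by
  ext A
  have h : A.erase i ≠ {i} := fun h => by
    have := Finset.mem_singleton_self i
    rw [← h] at this
    simp at this
  change _ = (0 : R)
  rw [theta_mul_apply, theta_apply, if_neg h, mul_zero, ite_self]

theorem thetaProd_apply_ne_zero {l : List σ} {A : Finset σ} (h : thetaProd R l A ≠ 0) :
    l.Nodup ∧ A = l.toFinset := by
  induction l generalizing A with
  | nil =>
    rw [thetaProd_nil, one_apply] at h
    refine ⟨List.nodup_nil, ?_⟩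
    by_contra h1
    exact h (if_neg h1)
  | cons i l ih =>
    rw [thetaProd_cons, theta_mul_apply] at h
    have hi : i ∈ A := by
      by_contra h1
      exact h (if_neg h1)
    rw [if_pos hi] at h
    obtain ⟨h1, h2⟩ := ih (right_ne_zero_of_mul h)
    refine ⟨List.nodup_cons.2 ⟨fun h3 => ?_, h1⟩, ?_⟩
    · rw [← List.mem_toFinset, ← h2] at h3
      simp at h3
    · rw [List.toFinset_cons, ← h2, Finset.insert_erase hi]

theorem thetaProd_apply_of_ne {l : List σ} {A : Finset σ} (h : A ≠ l.toFinset) :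
    thetaProd R l A = 0 := by
  by_contra h1
  exact h (thetaProd_apply_ne_zero h1).2

theorem thetaProd_sorted_apply {l : List σ} (h : l.Pairwise (· < ·)) :
    thetaProd R l l.toFinset = 1 := by
  induction l with
  | nil => simp [thetaProd_nil, one_apply]
  | cons i l ih =>
    rw [List.pairwise_cons] at h
    have hi : i ∉ l.toFinset := fun h1 => lt_irrefl _ (h.1 i (List.mem_toFinset.1 h1))
    rw [thetaProd_cons, theta_mul_apply, List.toFinset_cons, if_pos (Finset.mem_insert_self _ _),
      Finset.erase_insert hi, ih h.2, mul_one]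
    have : inversions {i} l.toFinset = 0 := by
      unfold inversions
      rw [Finset.card_eq_zero, Finset.filter_eq_empty_iff]
      rintro ⟨a, b⟩ hab
      simp only [Finset.mem_product, Finset.mem_singleton, List.mem_toFinset] at hab
      obtain ⟨rfl, hb⟩ := hab
      exact (h.1 b hb).not_gt
    rw [this, pow_zero]

theorem thetaProd_sort_apply (A : Finset σ) : thetaProd R (A.sort (· ≤ ·)) A = 1 := by
  have := thetaProd_sorted_apply (R := R) (Finset.sortedLT_sort A).pairwise
  rwa [Finset.sort_toFinset] at this

/-- The exponent is chosen before `f`: the sign of a rearrangement does not depend on which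
variables occupy the positions. This uniformity transports signs along permutations of the indices.
-/
theorem thetaProd_perm {l l' : List σ} (h : l.Perm l') :
    ∃ k : ℕ, ∀ f : σ → σ, thetaProd R (l.map f) = ((-1) ^ k : R) • thetaProd R (l'.map f) := by
  induction h with
  | nil => exact ⟨0, fun f => by simp⟩
  | cons x _ ih =>
    obtain ⟨k, hk⟩ := ih
    exact ⟨k, fun f => by
      rw [List.map_cons, List.map_cons, thetaProd_cons, thetaProd_cons, hk, mul_smul_comm]⟩
  | swap x y l =>
    refine ⟨1, fun f => ?_⟩
    simp only [List.map_cons, thetaProd_cons]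
    rw [← mul_assoc, ← mul_assoc, theta_mul_theta]
    simp
  | trans _ _ ih1 ih2 =>
    obtain ⟨k1, h1⟩ := ih1
    obtain ⟨k2, h2⟩ := ih2
    exact ⟨k1 + k2, fun f => by rw [h1, h2, smul_smul, pow_add]⟩

theorem _root_.List.mul_prod_of_anticomm {A : Type*} [Ring A] (x : A) (l : List A)
    (h : ∀ y ∈ l, x * y = -(y * x)) : x * l.prod = (-1) ^ l.length * (l.prod * x) := by
  induction l with
  | nil => simp
  | cons y l ih =>
    rw [List.prod_cons, ← mul_assoc, h y List.mem_cons_self, neg_mul, mul_assoc,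
      ih fun z hz => h z (List.mem_cons_of_mem _ hz), List.length_cons, pow_succ',
      ((Commute.neg_one_left y).pow_left l.length).symm.left_comm]
    simp only [neg_mul, one_mul, mul_assoc]

theorem _root_.List.prod_reverse_of_anticomm {A : Type*} [Ring A] (l : List A)
    (h : ∀ x ∈ l, ∀ y ∈ l, x * y = -(y * x)) :
    l.reverse.prod = (-1) ^ l.length.choose 2 * l.prod := by
  induction l with
  | nil => simp
  | cons y l ih =>
    have h1 := List.mul_prod_of_anticomm y l fun z hz =>
      h y List.mem_cons_self z (List.mem_cons_of_mem _ hz)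
    rw [List.reverse_cons, List.prod_append, List.prod_singleton,
      ih fun a ha b hb => h a (List.mem_cons_of_mem _ ha) b (List.mem_cons_of_mem _ hb),
      List.prod_cons, h1, List.length_cons, Nat.choose_succ_succ' _ 1, Nat.choose_one_right,
      ← mul_assoc, ← pow_add, mul_assoc]
    congr 1
    rw [show l.length + l.length.choose 2 + l.length = l.length.choose 2 + 2 * l.length by ring,
      pow_add, pow_mul]
    simp

/-- Each `b` passes all later `a`s, one sign per pair of positions. The resulting sign is that of
reversing the list, hence the reversal in the expansion of the kernel. -/
theorem _root_.List.prod_map_mul_of_anticomm {A ι : Type*} [Ring A] (a b : ι → A) (l : List ι)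
    (h : ∀ i ∈ l, ∀ j ∈ l, b i * a j = -(a j * b i)) :
    (l.map fun i => a i * b i).prod =
      (-1) ^ l.length.choose 2 * ((l.map a).prod * (l.map b).prod) := by
  induction l with
  | nil => simp
  | cons i l ih =>
    have h1 : b i * (l.map a).prod = (-1) ^ l.length * ((l.map a).prod * b i) := by
      have := List.mul_prod_of_anticomm (b i) (l.map a) (by
        intro y hy
        obtain ⟨j, hj, rfl⟩ := List.mem_map.1 hy
        exact h i List.mem_cons_self j (List.mem_cons_of_mem _ hj))
      rwa [List.length_map] at this
    have hc : ∀ (k : ℕ) (x : A), x * (-1) ^ k = (-1) ^ k * x := fun k x =>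
      ((Commute.neg_one_left x).pow_left k).symm
    simp only [List.map_cons, List.prod_cons, List.length_cons]
    rw [ih fun a ha b hb => h a (List.mem_cons_of_mem _ ha) b (List.mem_cons_of_mem _ hb),
      Nat.choose_succ_succ' _ 1, Nat.choose_one_right, pow_add, ← mul_assoc, hc, mul_assoc,
      mul_assoc, ← mul_assoc (b i), h1]
    rw [mul_assoc ((-1) ^ l.length) ((-1) ^ _), ← mul_assoc (a i), ← mul_assoc (a i), hc]
    -- Powers of -1 are central; what remains is to collect them on the left.
    rw [(((Commute.neg_one_left ((-1 : A) ^ l.length)).pow_left _).symm).left_comm]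
    simp only [mul_assoc]

theorem thetaProd_reverse (l : List σ) :
    thetaProd R l.reverse = (-1) ^ l.length.choose 2 * thetaProd R l := by
  unfold thetaProd
  rw [List.map_reverse, List.prod_reverse_of_anticomm, List.length_map]
  intro x hx y hy
  obtain ⟨i, -, rfl⟩ := List.mem_map.1 hx
  obtain ⟨j, -, rfl⟩ := List.mem_map.1 hy
  exact theta_mul_theta i j

theorem neg_one_pow_mul_apply (k : ℕ) (f : Grassmann σ R) (A : Finset σ) :
    ((-1) ^ k * f) A = (-1) ^ k * f A := by
  rcases Nat.even_or_odd k with h | h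
  · rw [h.neg_one_pow, h.neg_one_pow, one_mul, one_mul]
  · rw [h.neg_one_pow, h.neg_one_pow, neg_one_mul, neg_one_mul]
    rfl

/-- Reversing m anticommuting factors takes one transposition per pair, so reversal acts on each θ_A
by a scalar depending on the cardinality only. -/
theorem rev_apply (f : Grassmann σ R) (A : Finset σ) :
    rev f A = (-1) ^ A.card.choose 2 * f A := by
  unfold rev
  rw [thetaProd_reverse, neg_one_pow_mul_apply, thetaProd_sort_apply, Finset.length_sort, mul_one,
    mul_comm]

theorem toFinset_map_perm (s : Equiv.Perm σ) (l : List σ) :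
    (l.map s).toFinset = l.toFinset.map s.toEmbedding := by
  ext
  simp only [List.mem_toFinset, List.mem_map, Finset.mem_map, Equiv.coe_toEmbedding]

/-- The sign by which the substitution `θ_i ↦ θ_{s i}` differs from `θ_A ↦ θ_{s A}`. -/
def permSign (R : Type*) [CommRing R] (s : Equiv.Perm σ) (A : Finset σ) : R :=
  thetaProd R ((A.sort (· ≤ ·)).map s) (A.map s.toEmbedding)

theorem permute_apply_map (s : Equiv.Perm σ) (f : Grassmann σ R) (A : Finset σ) :
    permute s f (A.map s.toEmbedding) = f A * permSign R s A := by
  have : (A.map s.toEmbedding).map s.symm.toEmbedding = A := by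
    ext
    simp
  unfold permute permSign
  rw [this]

/-- Sorting `l` and sorting `l` after relabelling involve the same rearrangement of positions, hence
the same sign. -/
theorem thetaProd_map_apply (s : Equiv.Perm σ) {l : List σ} (hl : l.Nodup) :
    thetaProd R (l.map s) (l.toFinset.map s.toEmbedding) =
      thetaProd R l l.toFinset * permSign R s l.toFinset := by
  have hp : l.Perm (l.toFinset.sort (· ≤ ·)) := by
    rw [List.perm_ext_iff_of_nodup hl (Finset.sort_nodup _ _)]
    simp
  obtain ⟨k, hk⟩ := thetaProd_perm (R := R) hp
  have h1 := hk id
  rw [List.map_id, List.map_id] at h1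
  rw [hk, h1, smul_apply, smul_apply, thetaProd_sort_apply, mul_one]
  rfl

theorem mul_apply_union {f g : Grassmann σ R} {B C : Finset σ} (h : Disjoint B C)
    (hf : ∀ D, D ≠ B → f D = 0) :
    (f * g) (B ∪ C) = (-1) ^ inversions B C * f B * g C := by
  rw [mul_apply, Finset.sum_eq_single B, Finset.union_sdiff_cancel_left h]
  · intro D _ hD
    rw [hf D hD, mul_zero, zero_mul]
  · intro h1
    exact (h1 (Finset.mem_powerset.2 Finset.subset_union_left)).elim

/-- Cocycle identity: expand the product over the sorted list of B followed by that of C, before and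
after the substitution. It makes the substitution multiplicative. -/
theorem permSign_union (s : Equiv.Perm σ) {B C : Finset σ} (h : Disjoint B C) :
    (-1) ^ inversions B C * permSign R s (B ∪ C) =
      (-1) ^ inversions (B.map s.toEmbedding) (C.map s.toEmbedding) * permSign R s B *
        permSign R s C := by
  have hl : (B.sort (· ≤ ·) ++ C.sort (· ≤ ·)).Nodup := by
    rw [List.nodup_append']
    refine ⟨Finset.sort_nodup _ _, Finset.sort_nodup _ _, fun x hx hy => ?_⟩
    rw [Finset.mem_sort] at hx hy
    exact Finset.disjoint_left.1 h hx hy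
  have hT : (B.sort (· ≤ ·) ++ C.sort (· ≤ ·)).toFinset = B ∪ C := by simp
  have h1 := thetaProd_map_apply (R := R) s hl
  have hne : ∀ l : List σ, ∀ B : Finset σ, l.toFinset = B → ∀ D, D ≠ B → thetaProd R l D = 0 := by
    rintro l _ rfl D hD
    exact thetaProd_apply_of_ne hD
  rw [hT, List.map_append, thetaProd_append, thetaProd_append, Finset.map_union,
    mul_apply_union ((Finset.disjoint_map _).2 h) (hne _ _ (by
      rw [toFinset_map_perm, Finset.sort_toFinset])),
    mul_apply_union h (hne _ _ (Finset.sort_toFinset _ _)), thetaProd_sort_apply, thetaProd_sort_apply] at h1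
  rw [mul_one, mul_one] at h1
  exact h1.symm

theorem permute_mul (s : Equiv.Perm σ) (f g : Grassmann σ R) :
    permute s (f * g) = permute s f * permute s g := by
  ext A
  obtain ⟨A, rfl⟩ : ∃ B : Finset σ, A = B.map s.toEmbedding :=
    ⟨A.map s.symm.toEmbedding, by ext; simp⟩
  rw [permute_apply_map, mul_apply, mul_apply, Finset.sum_mul]
  refine Finset.sum_nbij' (fun B => B.map s.toEmbedding) (fun B => B.map s.symm.toEmbedding)
    ?_ ?_ ?_ ?_ ?_
  · intro B hB
    rw [Finset.mem_powerset] at hB ⊢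
    exact Finset.map_subset_map.2 hB
  · intro B hB
    rw [Finset.mem_powerset] at hB ⊢
    intro x hx
    obtain ⟨y, hy, rfl⟩ := Finset.mem_map.1 hx
    have := hB hy
    simpa using this
  · intro B _
    ext
    simp
  · intro B _
    ext
    simp
  · intro B hB
    rw [Finset.mem_powerset] at hB
    have e : A.map s.toEmbedding \ B.map s.toEmbedding = (A \ B).map s.toEmbedding := by
      rw [Finset.map_sdiff]
    have h1 := permSign_union (R := R) s (B := B) (C := A \ B) Finset.disjoint_sdiff
    rw [Finset.union_sdiff_of_subset hB] at h1
    rw [e, permute_apply_map, permute_apply_map]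
    linear_combination (f B * g (A \ B)) * h1

theorem permute_permute (s t : Equiv.Perm σ) (f : Grassmann σ R) :
    permute s (permute t f) = permute (s * t) f := by
  ext A
  obtain ⟨A, rfl⟩ : ∃ B : Finset σ, A = (B.map t.toEmbedding).map s.toEmbedding :=
    ⟨(A.map s.symm.toEmbedding).map t.symm.toEmbedding, by ext; simp⟩
  have e : (A.map t.toEmbedding).map s.toEmbedding = A.map (s * t).toEmbedding := by
    rw [Finset.map_map]
    rfl
  rw [permute_apply_map, permute_apply_map, e, permute_apply_map, mul_assoc]
  congr 1
  have h1 := thetaProd_map_apply (R := R) s (l := (A.sort (· ≤ ·)).map t)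
    ((Finset.sort_nodup _ _).map t.injective)
  have e2 : ((A.sort (· ≤ ·)).map t).toFinset = A.map t.toEmbedding := by
    rw [toFinset_map_perm, Finset.sort_toFinset]
  rw [e2, List.map_map, e] at h1
  exact h1.symm

end Grassmann

/-! ### Coefficients of superseries -/

section Series

variable {σ : Type*} [LinearOrder σ] {R : Type*} [CommRing R]

theorem superSeries_ext {f g : SuperSeries σ R} (h : ∀ a A, coef a A f = coef a A g) : f = g :=
  funext fun a => funext fun A => h a A

theorem coef_zero (a : σ →₀ ℕ) (A : Finset σ) : coef a A (0 : SuperSeries σ R) = 0 := rfl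

theorem coef_add (a : σ →₀ ℕ) (A : Finset σ) (f g : SuperSeries σ R) :
    coef a A (f + g) = coef a A f + coef a A g := rfl

theorem coef_neg (a : σ →₀ ℕ) (A : Finset σ) (f : SuperSeries σ R) :
    coef a A (-f) = -coef a A f := rfl

theorem coef_smul (c : R) (a : σ →₀ ℕ) (A : Finset σ) (f : SuperSeries σ R) :
    coef a A (c • f) = c * coef a A f := rfl

/-- The coefficient of `θ_A x^a` as a linear functional. -/
def coefLinear (R : Type*) [CommRing R] (a : σ →₀ ℕ) (A : Finset σ) : SuperSeries σ R →ₗ[R] R where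
  toFun := coef a A
  map_add' _ _ := rfl
  map_smul' _ _ := rfl

theorem coef_sum {ι : Type*} (a : σ →₀ ℕ) (A : Finset σ) (s : Finset ι) (f : ι → SuperSeries σ R) :
    coef a A (∑ i ∈ s, f i) = ∑ i ∈ s, coef a A (f i) :=
  map_sum (coefLinear R a A) f s

theorem coef_nsmul (n : ℕ) (a : σ →₀ ℕ) (A : Finset σ) (f : SuperSeries σ R) :
    coef a A (n • f) = n * coef a A f := by
  rw [← nsmul_eq_mul]
  exact map_nsmul (coefLinear R a A) n f

theorem coef_neg_one_pow_mul (n : ℕ) (a : σ →₀ ℕ) (A : Finset σ) (f : SuperSeries σ R) :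
    coef a A ((-1) ^ n * f) = (-1) ^ n * coef a A f := by
  rcases Nat.even_or_odd n with h | h
  · rw [h.neg_one_pow, h.neg_one_pow, one_mul, one_mul]
  · rw [h.neg_one_pow, h.neg_one_pow, neg_one_mul, neg_one_mul]
    rfl

theorem coef_mul (a : σ →₀ ℕ) (A : Finset σ) (f g : SuperSeries σ R) :
    coef a A (f * g) = ∑ p ∈ Finset.HasAntidiagonal.antidiagonal a,
      ∑ B ∈ A.powerset,
      (-1) ^ Grassmann.inversions B (A \ B) * coef p.1 B f * coef p.2 (A \ B) g := by
  change (f * g) a A = _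
  rw [← MvPowerSeries.coeff_apply (f * g) a, MvPowerSeries.coeff_mul, Grassmann.sum_apply]
  rfl

theorem exists_of_coef_mul_ne_zero {a : σ →₀ ℕ} {A : Finset σ} {f g : SuperSeries σ R}
    (h : coef a A (f * g) ≠ 0) :
    ∃ b c B C, a = b + c ∧ A = B ∪ C ∧ Disjoint B C ∧ coef b B f ≠ 0 ∧ coef c C g ≠ 0 := by
  rw [coef_mul] at h
  obtain ⟨⟨b, c⟩, hp, h⟩ := Finset.exists_ne_zero_of_sum_ne_zero h
  obtain ⟨B, hB, h⟩ := Finset.exists_ne_zero_of_sum_ne_zero h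
  exact ⟨b, c, B, A \ B, (Finset.HasAntidiagonal.mem_antidiagonal.1 hp).symm,
    (Finset.union_sdiff_of_subset (Finset.mem_powerset.1 hB)).symm, Finset.disjoint_sdiff,
    right_ne_zero_of_mul (left_ne_zero_of_mul h), right_ne_zero_of_mul h⟩

/-- All but one term of the convolution vanish. The set `A` is described by membership so that the
result also applies to disjoint unions such as `biSet`. -/
theorem coef_mul_of_unique {a b c : σ →₀ ℕ} {A B C : Finset σ} {f g : SuperSeries σ R}
    (ha : a = b + c) (hA : ∀ k, k ∈ A ↔ k ∈ B ∨ k ∈ C) (hd : Disjoint B C)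
    (h : ∀ b' c' B' C', a = b' + c' → (∀ k, k ∈ A ↔ k ∈ B' ∨ k ∈ C') → coef b' B' f ≠ 0 →
      coef c' C' g ≠ 0 → b' = b ∧ c' = c ∧ B' = B ∧ C' = C) :
    coef a A (f * g) = (-1) ^ Grassmann.inversions B C * coef b B f * coef c C g := by
  have hA' : A = B ∪ C := by
    ext k
    rw [hA, Finset.mem_union]
  subst hA'
  rw [coef_mul, Finset.sum_eq_single (b, c)]
  · rw [Finset.sum_eq_single B, Finset.union_sdiff_cancel_left hd]
    · intro D hD hne
      by_contra h1
      refine hne (h b c D ((B ∪ C) \ D) ha (fun k => ?_)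
        (right_ne_zero_of_mul (left_ne_zero_of_mul h1)) (right_ne_zero_of_mul h1)).2.2.1
      rw [← Finset.mem_union, Finset.union_sdiff_of_subset (Finset.mem_powerset.1 hD)]
    · intro h1
      exact (h1 (Finset.mem_powerset.2 Finset.subset_union_left)).elim
  · rintro ⟨p1, p2⟩ hp hne
    refine Finset.sum_eq_zero fun D hD => ?_
    by_contra h1
    have h2 := h p1 p2 D ((B ∪ C) \ D) (Finset.HasAntidiagonal.mem_antidiagonal.1 hp).symm
      (fun k => by
        rw [← Finset.mem_union, Finset.union_sdiff_of_subset (Finset.mem_powerset.1 hD)])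
      (right_ne_zero_of_mul (left_ne_zero_of_mul h1)) (right_ne_zero_of_mul h1)
    exact hne (by rw [h2.1, h2.2.1])
  · intro h1
    exact (h1 (Finset.HasAntidiagonal.mem_antidiagonal.2 ha.symm)).elim

/-- A coefficient of a product sees only divisors of the monomial, so an infinite sum may be
replaced by a finite one inside a product. -/
theorem coef_mul_congr {a : σ →₀ ℕ} {A : Finset σ} {f g f' g' : SuperSeries σ R}
    (hf : ∀ b B, b ≤ a → B ⊆ A → coef b B f = coef b B f')
    (hg : ∀ b B, b ≤ a → B ⊆ A → coef b B g = coef b B g') :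
    coef a A (f * g) = coef a A (f' * g') := by
  rw [coef_mul, coef_mul]
  refine Finset.sum_congr rfl fun p hp => Finset.sum_congr rfl fun B hB => ?_
  rw [Finset.HasAntidiagonal.mem_antidiagonal] at hp
  rw [hf _ _ (hp ▸ le_self_add) (Finset.mem_powerset.1 hB),
    hg _ _ (hp ▸ le_add_self) Finset.sdiff_subset]

theorem coef_one (a : σ →₀ ℕ) (A : Finset σ) :
    coef a A (1 : SuperSeries σ R) = if a = 0 ∧ A = ∅ then 1 else 0 := by
  classical
  change (1 : SuperSeries σ R) a A = _
  rw [← MvPowerSeries.coeff_apply (1 : SuperSeries σ R) a, MvPowerSeries.coeff_one]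
  split_ifs with h1 h2 h2
  · rw [Grassmann.one_apply, if_pos h2.2]
  · rw [Grassmann.one_apply, if_neg fun h3 => h2 ⟨h1, h3⟩]
  · exact (h1 h2.1).elim
  · rfl

theorem coef_monomial (a b : σ →₀ ℕ) (A : Finset σ) (g : Grassmann σ R) :
    coef a A (MvPowerSeries.monomial b g : SuperSeries σ R) = if a = b then g A else 0 := by
  classical
  change (MvPowerSeries.monomial b g : SuperSeries σ R) a A = _
  rw [← MvPowerSeries.coeff_apply (MvPowerSeries.monomial b g) a, MvPowerSeries.coeff_monomial]
  split_ifs <;> rfl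

theorem coef_monomial_mul (a b : σ →₀ ℕ) (A : Finset σ) (g : Grassmann σ R)
    (f : SuperSeries σ R) :
    coef a A (MvPowerSeries.monomial b g * f) = if b ≤ a then (g * f (a - b)) A else 0 := by
  classical
  change (MvPowerSeries.monomial b g * f) a A = _
  rw [← MvPowerSeries.coeff_apply (MvPowerSeries.monomial b g * f) a,
    MvPowerSeries.coeff_monomial_mul]
  split_ifs <;> rfl

theorem bosonic_pow (i : σ) (n : ℕ) :
    bosonic R i ^ n = MvPowerSeries.monomial (Finsupp.single i n) 1 :=
  MvPowerSeries.X_pow_eq i n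

theorem fermionic_mul_bosonic_pow (i : σ) (n : ℕ) :
    fermionic R i * bosonic R i ^ n =
      MvPowerSeries.monomial (Finsupp.single i n) (Grassmann.theta R i) := by
  rw [bosonic_pow, fermionic, ← MvPowerSeries.monomial_zero_eq_C_apply,
    MvPowerSeries.monomial_mul_monomial, zero_add, mul_one]

theorem coef_bosonic_pow (i : σ) (n : ℕ) (a : σ →₀ ℕ) (A : Finset σ) :
    coef a A (bosonic R i ^ n) = if a = Finsupp.single i n ∧ A = ∅ then 1 else 0 := by
  rw [bosonic_pow, coef_monomial]
  split_ifs with h1 h2 h2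
  · rw [Grassmann.one_apply, if_pos h2.2]
  · rw [Grassmann.one_apply, if_neg fun h3 => h2 ⟨h1, h3⟩]
  · exact (h1 h2.1).elim
  · rfl

theorem coef_bosonic (i : σ) (a : σ →₀ ℕ) (A : Finset σ) :
    coef a A (bosonic R i) = if a = Finsupp.single i 1 ∧ A = ∅ then 1 else 0 := by
  rw [← coef_bosonic_pow, pow_one]

theorem coef_fermionic_mul_bosonic_pow (i : σ) (n : ℕ) (a : σ →₀ ℕ) (A : Finset σ) :
    coef a A (fermionic R i * bosonic R i ^ n) =
      if a = Finsupp.single i n ∧ A = {i} then 1 else 0 := by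
  rw [fermionic_mul_bosonic_pow, coef_monomial]
  split_ifs with h1 h2 h2
  · rw [Grassmann.theta_apply, if_pos h2.2]
  · rw [Grassmann.theta_apply, if_neg fun h3 => h2 ⟨h1, h3⟩]
  · exact (h1 h2.1).elim
  · rfl

theorem coef_fermionic (i : σ) (a : σ →₀ ℕ) (A : Finset σ) :
    coef a A (fermionic R i) = if a = 0 ∧ A = {i} then 1 else 0 := by
  have := coef_fermionic_mul_bosonic_pow (R := R) i 0 a A
  rwa [pow_zero, mul_one, Finsupp.single_zero] at this

theorem coef_bosonic_pow_mul (i : σ) (n : ℕ) (a : σ →₀ ℕ) (A : Finset σ) (f : SuperSeries σ R) :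
    coef a A (bosonic R i ^ n * f) =
      if n ≤ a i then coef (a - Finsupp.single i n) A f else 0 := by
  rw [bosonic_pow, coef_monomial_mul, one_mul]
  simp only [Finsupp.single_le_iff]
  rfl

theorem coef_fermionic_mul_bosonic_pow_mul (i : σ) (n : ℕ) (a : σ →₀ ℕ) (A : Finset σ)
    (f : SuperSeries σ R) :
    coef a A (fermionic R i * bosonic R i ^ n * f) =
      if n ≤ a i ∧ i ∈ A then
        (-1) ^ Grassmann.inversions {i} (A.erase i) * coef (a - Finsupp.single i n) (A.erase i) f
      else 0 := by
  rw [fermionic_mul_bosonic_pow, coef_monomial_mul, Grassmann.theta_mul_apply]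
  simp only [Finsupp.single_le_iff, ite_and]
  rfl

theorem coef_rev (a : σ →₀ ℕ) (A : Finset σ) (f : SuperSeries σ R) :
    coef a A (rev f) = (-1) ^ A.card.choose 2 * coef a A f :=
  Grassmann.rev_apply (f a) A

/-! ### Parity and degree in the anticommuting variables -/

/-- All terms have degree in the anticommuting variables congruent to `p` modulo `2`. -/
def HasParity (p : ℕ) (f : SuperSeries σ R) : Prop := ∀ a A, coef a A f ≠ 0 → A.card % 2 = p % 2

/-- All terms have degree `m` in the anticommuting variables. -/
def HasSector (m : ℕ) (f : SuperSeries σ R) : Prop := ∀ a A, coef a A f ≠ 0 → A.card = m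

theorem HasSector.hasParity {m : ℕ} {f : SuperSeries σ R} (h : HasSector m f) : HasParity m f :=
  fun a A h1 => by rw [h a A h1]

theorem HasSector.mul {m n : ℕ} {f g : SuperSeries σ R} (hf : HasSector m f)
    (hg : HasSector n g) : HasSector (m + n) (f * g) := by
  intro a A h
  obtain ⟨b, c, B, C, -, rfl, hd, h1, h2⟩ := exists_of_coef_mul_ne_zero h
  rw [Finset.card_union_of_disjoint hd, hf _ _ h1, hg _ _ h2]

theorem HasParity.mul {m n : ℕ} {f g : SuperSeries σ R} (hf : HasParity m f)
    (hg : HasParity n g) : HasParity (m + n) (f * g) := by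
  intro a A h
  obtain ⟨b, c, B, C, -, rfl, hd, h1, h2⟩ := exists_of_coef_mul_ne_zero h
  rw [Finset.card_union_of_disjoint hd, Nat.add_mod, hf _ _ h1, hg _ _ h2, ← Nat.add_mod]

theorem hasSector_one : HasSector 0 (1 : SuperSeries σ R) := by
  intro a A h
  rw [coef_one] at h
  have : A = ∅ := by
    by_contra h1
    simp [h1] at h
  simp [this]

theorem hasSector_list_prod (l : List (SuperSeries σ R)) (n : ℕ) (h : ∀ f ∈ l, HasSector n f) :
    HasSector (n * l.length) l.prod := by
  induction l with
  | nil => exact hasSector_one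
  | cons f l ih =>
    rw [List.prod_cons, List.length_cons, mul_add, mul_one, add_comm]
    exact (h f List.mem_cons_self).mul (ih fun g hg => h g (List.mem_cons_of_mem _ hg))

theorem HasSector.rev_eq {m : ℕ} {f : SuperSeries σ R} (h : HasSector m f) :
    rev f = ((-1) ^ m.choose 2 : R) • f := by
  refine superSeries_ext fun a A => ?_
  rw [coef_rev, coef_smul]
  by_cases h1 : coef a A f = 0
  · rw [h1, mul_zero, mul_zero]
  · rw [h a A h1]

theorem mul_eq_sign_mul {p q : ℕ} {f g : SuperSeries σ R} (hf : HasParity p f)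
    (hg : HasParity q g) : f * g = ((-1) ^ (p * q) : R) • (g * f) := by
  refine superSeries_ext fun a A => ?_
  rw [coef_smul]
  change (f * g) a A = _ * (g * f) a A
  rw [← MvPowerSeries.coeff_apply (f * g) a, MvPowerSeries.coeff_mul,
    ← MvPowerSeries.coeff_apply (g * f) a, MvPowerSeries.coeff_mul, ← Grassmann.smul_apply,
    Finset.smul_sum]
  rw [Grassmann.sum_apply, Grassmann.sum_apply]
  conv_lhs => rw [← Finset.HasAntidiagonal.map_swap_antidiagonal, Finset.sum_map]
  refine Finset.sum_congr rfl fun p _ => ?_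
  exact congrFun (Grassmann.mul_eq_sign_mul (f := f p.2) (g := g p.1) (hf p.2) (hg p.1)) A

theorem mul_comm_of_even {p : ℕ} {f g : SuperSeries σ R} (hf : HasParity 0 f)
    (hg : HasParity p g) : f * g = g * f := by
  rw [mul_eq_sign_mul hf hg]
  simp

theorem mul_anticomm_of_odd {f g : SuperSeries σ R} (hf : HasParity 1 f)
    (hg : HasParity 1 g) : f * g = -(g * f) := by
  rw [mul_eq_sign_mul hf hg]
  simp

theorem hasSector_bosonic (i : σ) : HasSector 0 (bosonic R i) := by
  intro a A h
  rw [coef_bosonic] at h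
  have : A = ∅ := by
    by_contra h1
    simp [h1] at h
  simp [this]

theorem hasSector_fermionic (i : σ) : HasSector 1 (fermionic R i) := by
  intro a A h
  rw [coef_fermionic] at h
  have : A = {i} := by
    by_contra h1
    simp [h1] at h
  simp [this]

theorem fermionic_mul_self (i : σ) : fermionic R i * fermionic R i = 0 := by
  rw [fermionic, ← map_mul, Grassmann.theta_mul_self, map_zero]

/-- The subalgebra of series all of whose terms have even degree in the anticommuting variables. -/
def evenSubalgebra (σ R : Type*) [LinearOrder σ] [CommRing R] :
    Subalgebra R (SuperSeries σ R) where
  carrier := {f | HasParity 0 f}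
  mul_mem' hf hg := HasParity.mul hf hg
  add_mem' := by
    intro f g hf hg a A h
    by_cases h1 : coef a A f = 0
    · refine hg a A fun h2 => h ?_
      rw [coef_add, h1, h2, add_zero]
    · exact hf a A h1
  algebraMap_mem' r := by
    intro a A h
    rw [Algebra.algebraMap_eq_smul_one, coef_smul] at h
    rw [hasSector_one a A (right_ne_zero_of_mul h)]

/-- Commutativity allows unordered finite products, power series and derivations over the even
series. -/
noncomputable instance : CommRing (evenSubalgebra σ R) :=
  { (inferInstance : Ring (evenSubalgebra σ R)) with
    mul_comm := fun f g => Subtype.ext (mul_comm_of_even f.2 g.2) }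

end Series

/-! ### Substitution along an embedding of alphabets -/

section Embed

variable {σ τ : Type*} [LinearOrder σ] [LinearOrder τ] {R : Type*} [CommRing R]

theorem Grassmann.inversions_map (e : σ ↪o τ) (B C : Finset σ) :
    inversions (B.map e.toEmbedding) (C.map e.toEmbedding) = inversions B C := by
  unfold inversions
  symm
  refine Finset.card_bij (fun p _ => (e p.1, e p.2)) ?_ ?_ ?_
  · rintro ⟨b, c⟩ h
    simpa using h
  · rintro ⟨b, c⟩ _ ⟨b', c'⟩ _ h
    simpa using h
  · rintro ⟨b, c⟩ h
    simp only [Finset.mem_filter, Finset.mem_product, Finset.mem_map] at h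
    obtain ⟨⟨⟨b, hb, rfl⟩, c, hc, rfl⟩, h⟩ := h
    exact ⟨(b, c), by simpa [hb, hc] using h, rfl⟩

theorem coef_embed_of_subset {e : σ ↪o τ} {a : τ →₀ ℕ} {A : Finset τ}
    (h1 : (a.support : Set τ) ⊆ Set.range e) (h2 : (A : Set τ) ⊆ Set.range e)
    (f : SuperSeries σ R) : coef a A (embed e f) =
      coef (a.comapDomain e e.injective.injOn) (A.preimage e e.injective.injOn) f := by
  have e1 : embed e f a = Grassmann.embed e (f (a.comapDomain e e.injective.injOn)) := if_pos h1
  exact (congrFun e1 A).trans (if_pos h2)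

theorem coef_embed_of_not_subset {e : σ ↪o τ} {a : τ →₀ ℕ} {A : Finset τ}
    (h : ¬ ((a.support : Set τ) ⊆ Set.range e ∧ (A : Set τ) ⊆ Set.range e))
    (f : SuperSeries σ R) : coef a A (embed e f) = 0 := by
  by_cases h1 : (a.support : Set τ) ⊆ Set.range e
  · have e1 : embed e f a = Grassmann.embed e (f (a.comapDomain e e.injective.injOn)) := if_pos h1
    exact (congrFun e1 A).trans (if_neg fun h2 => h ⟨h1, h2⟩)
  · have e1 : embed e f a = 0 := if_neg h1
    exact congrFun e1 A

theorem coef_embed_map (e : σ ↪o τ) (b : σ →₀ ℕ) (B : Finset σ) (f : SuperSeries σ R) :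
    coef (b.embDomain e.toEmbedding) (B.map e.toEmbedding) (embed e f) = coef b B f := by
  rw [coef_embed_of_subset]
  · congr 1
    · ext i
      exact Finsupp.embDomain_apply_self e.toEmbedding b i
    · ext i
      simp
  · rw [Finsupp.support_embDomain, Finset.coe_map]
    exact Set.image_subset_range _ _
  · rw [Finset.coe_map]
    exact Set.image_subset_range _ _

theorem exists_of_coef_embed_ne_zero {e : σ ↪o τ} {a : τ →₀ ℕ} {A : Finset τ}
    {f : SuperSeries σ R} (h : coef a A (embed e f) ≠ 0) :
    ∃ b B, a = Finsupp.embDomain e.toEmbedding b ∧ A = B.map e.toEmbedding ∧ coef b B f ≠ 0 := by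
  obtain ⟨h1, h2⟩ : (a.support : Set τ) ⊆ Set.range e ∧ (A : Set τ) ⊆ Set.range e := by
    by_contra h1
    exact h (coef_embed_of_not_subset h1 f)
  rw [coef_embed_of_subset h1 h2] at h
  refine ⟨_, _, (Finsupp.embDomain_comapDomain h1).symm, ?_, h⟩
  ext i
  simp only [Finset.mem_map, Finset.mem_preimage]
  constructor
  · intro hi
    obtain ⟨j, rfl⟩ := h2 hi
    exact ⟨j, hi, rfl⟩
  · rintro ⟨j, hj, rfl⟩
    exact hj

/-- An order embedding preserves inversions, so no sign appears. -/
theorem embed_mul (e : σ ↪o τ) (f g : SuperSeries σ R) :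
    embed e (f * g) = embed e f * embed e g := by
  refine superSeries_ext fun a A => ?_
  by_cases h : ∃ b B, a = Finsupp.embDomain e.toEmbedding b ∧ A = Finset.map e.toEmbedding B
  · obtain ⟨b, B, rfl, rfl⟩ := h
    rw [coef_embed_map, coef_mul, coef_mul]
    refine Finset.sum_bij
      (fun p _ => (p.1.embDomain e.toEmbedding, p.2.embDomain e.toEmbedding)) ?_ ?_ ?_ ?_
    · intro p hp
      rw [Finset.HasAntidiagonal.mem_antidiagonal] at hp ⊢
      rw [← Finsupp.embDomain_add, hp]
    · rintro ⟨p1, p2⟩ _ ⟨q1, q2⟩ _ hpq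
      rw [Prod.mk.injEq] at hpq ⊢
      exact ⟨Finsupp.embDomain_injective _ hpq.1, Finsupp.embDomain_injective _ hpq.2⟩
    · rintro ⟨c, d⟩ hcd
      rw [Finset.HasAntidiagonal.mem_antidiagonal] at hcd
      simp only at hcd
      have key : ∀ x : τ →₀ ℕ, x ≤ b.embDomain e.toEmbedding →
          Finsupp.embDomain e.toEmbedding (x.comapDomain e e.injective.injOn) = x := by
        intro x hx
        refine Finsupp.embDomain_comapDomain fun i hi => ?_
        have h1 := Finsupp.support_mono hx hi
        rw [Finsupp.support_embDomain, Finset.mem_map] at h1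
        obtain ⟨j, -, rfl⟩ := h1
        exact ⟨j, rfl⟩
      have hc := key c (hcd ▸ le_self_add)
      have hd := key d (hcd ▸ le_add_self)
      refine ⟨(c.comapDomain e e.injective.injOn, d.comapDomain e e.injective.injOn), ?_, ?_⟩
      · rw [Finset.HasAntidiagonal.mem_antidiagonal]
        apply Finsupp.embDomain_injective e.toEmbedding
        rw [Finsupp.embDomain_add, hc, hd, hcd]
      · rw [Prod.mk.injEq]
        exact ⟨hc, hd⟩
    · intro p _
      refine Finset.sum_bij (fun C _ => C.map e.toEmbedding) ?_ ?_ ?_ ?_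
      · intro C hC
        rw [Finset.mem_powerset] at hC ⊢
        exact Finset.map_subset_map.2 hC
      · intro C _ D _ hCD
        exact Finset.map_injective _ hCD
      · intro D hD
        rw [Finset.mem_powerset, Finset.subset_map_iff] at hD
        obtain ⟨C, hC, rfl⟩ := hD
        exact ⟨C, Finset.mem_powerset.2 hC, rfl⟩
      · intro C hC
        rw [← Finset.map_sdiff, Grassmann.inversions_map, coef_embed_map, coef_embed_map]
  -- A monomial involving a variable outside the range has coefficient 0 on both sides.
  · have h1 : coef a A (embed e (f * g)) = 0 := by
      by_contra h2
      obtain ⟨b, B, h3, h4, -⟩ := exists_of_coef_embed_ne_zero h2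
      exact h ⟨b, B, h3, h4⟩
    rw [h1]
    by_contra h2
    obtain ⟨b, c, B, C, h3, h4, -, h5, h6⟩ := exists_of_coef_mul_ne_zero (Ne.symm h2)
    obtain ⟨b, B, rfl, rfl, -⟩ := exists_of_coef_embed_ne_zero h5
    obtain ⟨c, C, rfl, rfl, -⟩ := exists_of_coef_embed_ne_zero h6
    exact h ⟨b + c, B ∪ C, by rw [h3, Finsupp.embDomain_add], by rw [h4, Finset.map_union]⟩

theorem coef_embed_of_forall (e : σ ↪o τ) {f : SuperSeries σ R} {g : SuperSeries τ R}
    (h1 : ∀ b B, coef b B f = coef (Finsupp.embDomain e.toEmbedding b) (B.map e.toEmbedding) g)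
    (h2 : ∀ a A, coef a A g ≠ 0 →
      ∃ b B, a = Finsupp.embDomain e.toEmbedding b ∧ A = Finset.map e.toEmbedding B) :
    embed e f = g := by
  refine superSeries_ext fun a A => ?_
  by_cases h : ∃ b B, a = Finsupp.embDomain e.toEmbedding b ∧ A = Finset.map e.toEmbedding B
  · obtain ⟨b, B, rfl, rfl⟩ := h
    rw [coef_embed_map, h1]
  · have h3 : coef a A g = 0 := by
      by_contra h4
      exact h (h2 a A h4)
    rw [h3]
    by_contra h4
    obtain ⟨b, B, h5, h6, -⟩ := exists_of_coef_embed_ne_zero h4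
    exact h ⟨b, B, h5, h6⟩

theorem embed_add (e : σ ↪o τ) (f g : SuperSeries σ R) :
    embed e (f + g) = embed e f + embed e g := by
  refine coef_embed_of_forall e (fun b B => ?_) (fun a A h => ?_)
  · rw [coef_add, coef_add, coef_embed_map, coef_embed_map]
  · rw [coef_add] at h
    by_cases h1 : coef a A (embed e f) = 0
    · rw [h1, zero_add] at h
      obtain ⟨b, B, h5, h6, -⟩ := exists_of_coef_embed_ne_zero h
      exact ⟨b, B, h5, h6⟩
    · obtain ⟨b, B, h5, h6, -⟩ := exists_of_coef_embed_ne_zero h1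
      exact ⟨b, B, h5, h6⟩

theorem embed_zero (e : σ ↪o τ) : embed e (0 : SuperSeries σ R) = 0 :=
  coef_embed_of_forall e (fun _ _ => rfl) fun _ _ h => (h rfl).elim

theorem embed_one (e : σ ↪o τ) : embed e (1 : SuperSeries σ R) = 1 := by
  refine coef_embed_of_forall e (fun b B => ?_) (fun a A h => ?_)
  · rw [coef_one, coef_one]
    congr 1
    rw [Finset.map_eq_empty, Finsupp.embDomain_eq_zero]
  · rw [coef_one] at h
    have h1 : a = 0 ∧ A = ∅ := by
      by_contra h2
      exact h (if_neg h2)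
    exact ⟨0, ∅, by rw [h1.1, Finsupp.embDomain_zero], by rw [h1.2, Finset.map_empty]⟩

/-- The substitution along an embedding of alphabets, as a ring homomorphism. -/
noncomputable def embedHom (R : Type*) [CommRing R] (e : σ ↪o τ) :
    SuperSeries σ R →+* SuperSeries τ R where
  toFun := embed e
  map_one' := embed_one e
  map_mul' := embed_mul e
  map_zero' := embed_zero e
  map_add' := embed_add e

theorem embedHom_apply (e : σ ↪o τ) (f : SuperSeries σ R) : embedHom R e f = embed e f := rfl

theorem embed_fermionic_mul_bosonic_pow (e : σ ↪o τ) (i : σ) (n : ℕ) :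
    embed e (fermionic R i * bosonic R i ^ n) = fermionic R (e i) * bosonic R (e i) ^ n := by
  have e1 : Finsupp.single (e i) n = Finsupp.embDomain e.toEmbedding (Finsupp.single i n) := by
    rw [Finsupp.embDomain_single]
    rfl
  have e2 : {e i} = Finset.map e.toEmbedding {i} := by
    rw [Finset.map_singleton]
    rfl
  refine coef_embed_of_forall e (fun b B => ?_) (fun a A h => ?_)
  · rw [coef_fermionic_mul_bosonic_pow, coef_fermionic_mul_bosonic_pow, e1, e2]
    congr 1
    rw [(Finsupp.embDomain_injective _).eq_iff, (Finset.map_injective _).eq_iff]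
  · rw [coef_fermionic_mul_bosonic_pow] at h
    have h1 : a = Finsupp.single (e i) n ∧ A = {e i} := by
      by_contra h2
      exact h (if_neg h2)
    exact ⟨_, _, h1.1.trans e1, h1.2.trans e2⟩

theorem embed_fermionic (e : σ ↪o τ) (i : σ) :
    embed e (fermionic R i) = fermionic R (e i) := by
  simpa using embed_fermionic_mul_bosonic_pow (R := R) e i 0

theorem embed_bosonic (e : σ ↪o τ) (i : σ) :
    embed e (bosonic R i) = bosonic R (e i) := by
  have e1 : Finsupp.single (e i) 1 = Finsupp.embDomain e.toEmbedding (Finsupp.single i 1) := by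
    rw [Finsupp.embDomain_single]
    rfl
  refine coef_embed_of_forall e (fun b B => ?_) (fun a A h => ?_)
  · rw [coef_bosonic, coef_bosonic, e1]
    congr 1
    rw [(Finsupp.embDomain_injective _).eq_iff, Finset.map_eq_empty]
  · rw [coef_bosonic] at h
    have h1 : a = Finsupp.single (e i) 1 ∧ A = ∅ := by
      by_contra h2
      exact h (if_neg h2)
    exact ⟨_, ∅, h1.1.trans e1, by rw [h1.2, Finset.map_empty]⟩

theorem HasSector.embed {m : ℕ} {f : SuperSeries σ R} (h : HasSector m f) (e : σ ↪o τ) :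
    HasSector m (embed e f) := by
  intro a A h1
  obtain ⟨b, B, rfl, rfl, h2⟩ := exists_of_coef_embed_ne_zero h1
  rw [Finset.card_map, h b B h2]

end Embed

/-! ### Monomials of the double alphabet -/

section LeftRight

variable {R : Type*} [CommRing R]

theorem left_ne_right (i j : ℕ) : left i ≠ right j := by
  intro h
  have : (Sum.inl i : ℕ ⊕ ℕ) = Sum.inr j := toLex.injective h
  cases this

theorem disjoint_left_right (B C : Finset ℕ) :
    Disjoint (B.map left.toEmbedding) (C.map right.toEmbedding) := by
  rw [Finset.disjoint_left]
  intro k h1 h2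
  obtain ⟨i, -, rfl⟩ := Finset.mem_map.1 h1
  obtain ⟨j, -, h⟩ := Finset.mem_map.1 h2
  exact left_ne_right i j h.symm

/-- The exponent vector `x^b y^c` of the double alphabet. -/
noncomputable def biExp (b c : ℕ →₀ ℕ) : (ℕ ⊕ₗ ℕ) →₀ ℕ :=
  b.embDomain left.toEmbedding + c.embDomain right.toEmbedding

/-- The set of indices of the double alphabet with left part `B` and right part `C`. -/
def biSet (B C : Finset ℕ) : Finset (ℕ ⊕ₗ ℕ) :=
  (B.map left.toEmbedding).disjUnion (C.map right.toEmbedding) (disjoint_left_right B C)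

theorem left_lt_right (i j : ℕ) : left i < right j := Sum.Lex.inl_lt_inr i j

theorem left_or_right (k : ℕ ⊕ₗ ℕ) : (∃ i, k = left i) ∨ ∃ j, k = right j := by
  rcases h : ofLex k with i | j
  · exact Or.inl ⟨i, ofLex.injective h⟩
  · exact Or.inr ⟨j, ofLex.injective h⟩

theorem biExp_left (b c : ℕ →₀ ℕ) (i : ℕ) : biExp b c (left i) = b i := by
  have h1 : Finsupp.embDomain left.toEmbedding b (left i) = b i :=
    Finsupp.embDomain_apply_self left.toEmbedding b i
  have h2 : Finsupp.embDomain right.toEmbedding c (left i) = 0 := by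
    refine Finsupp.embDomain_of_notMem_range _ _ _ ?_
    rintro ⟨j, hj⟩
    exact left_ne_right i j hj.symm
  rw [biExp, Finsupp.add_apply, h1, h2, add_zero]

theorem biExp_right (b c : ℕ →₀ ℕ) (j : ℕ) : biExp b c (right j) = c j := by
  have h1 : Finsupp.embDomain right.toEmbedding c (right j) = c j :=
    Finsupp.embDomain_apply_self right.toEmbedding c j
  have h2 : Finsupp.embDomain left.toEmbedding b (right j) = 0 := by
    refine Finsupp.embDomain_of_notMem_range _ _ _ ?_
    rintro ⟨i, hi⟩
    exact left_ne_right i j hi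
  rw [biExp, Finsupp.add_apply, h1, h2, zero_add]

theorem left_mem_biSet {B C : Finset ℕ} {i : ℕ} : left i ∈ biSet B C ↔ i ∈ B := by
  unfold biSet
  rw [Finset.mem_disjUnion, Finset.mem_map, Finset.mem_map]
  constructor
  · rintro (⟨j, hj, h⟩ | ⟨j, hj, h⟩)
    · rwa [← left.injective h]
    · exact (left_ne_right i j h.symm).elim
  · intro h
    exact Or.inl ⟨i, h, rfl⟩

theorem right_mem_biSet {B C : Finset ℕ} {j : ℕ} : right j ∈ biSet B C ↔ j ∈ C := by
  unfold biSet
  rw [Finset.mem_disjUnion, Finset.mem_map, Finset.mem_map]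
  constructor
  · rintro (⟨i, hi, h⟩ | ⟨i, hi, h⟩)
    · exact (left_ne_right i j h).elim
    · rwa [← right.injective h]
  · intro h
    exact Or.inr ⟨j, h, rfl⟩

theorem biExp_inj {b c b' c' : ℕ →₀ ℕ} : biExp b c = biExp b' c' ↔ b = b' ∧ c = c' := by
  constructor
  · intro h
    constructor
    · ext i
      rw [← biExp_left b c, h, biExp_left]
    · ext i
      rw [← biExp_right b c, h, biExp_right]
  · rintro ⟨rfl, rfl⟩
    rfl

theorem biSet_inj {B C B' C' : Finset ℕ} : biSet B C = biSet B' C' ↔ B = B' ∧ C = C' := by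
  constructor
  · intro h
    constructor
    · ext i
      rw [← left_mem_biSet (C := C), h, left_mem_biSet]
    · ext i
      rw [← right_mem_biSet (B := B), h, right_mem_biSet]
  · rintro ⟨rfl, rfl⟩
    rfl

theorem exists_eq_biExp (a : (ℕ ⊕ₗ ℕ) →₀ ℕ) : ∃ b c, a = biExp b c := by
  refine ⟨a.comapDomain left left.injective.injOn, a.comapDomain right right.injective.injOn, ?_⟩
  ext k
  rcases left_or_right k with ⟨i, rfl⟩ | ⟨i, rfl⟩
  · rw [biExp_left, Finsupp.comapDomain_apply]
  · rw [biExp_right, Finsupp.comapDomain_apply]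

theorem exists_eq_biSet (A : Finset (ℕ ⊕ₗ ℕ)) : ∃ B C, A = biSet B C := by
  refine ⟨A.preimage left left.injective.injOn, A.preimage right right.injective.injOn, ?_⟩
  ext k
  rcases left_or_right k with ⟨i, rfl⟩ | ⟨i, rfl⟩
  · rw [left_mem_biSet, Finset.mem_preimage]
  · rw [right_mem_biSet, Finset.mem_preimage]

/-- A monomial of the double alphabet factors uniquely into a left and a right one. Every left index
precedes every right index, so the sign is trivial. -/
theorem coef_embed_left_mul_embed_right (b c : ℕ →₀ ℕ) (B C : Finset ℕ)
    (f g : SuperSeries ℕ R) :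
    coef (biExp b c) (biSet B C) (embed left f * embed right g) = coef b B f * coef c C g := by
  rw [coef_mul_of_unique (A := biSet B C) (rfl : biExp b c = _)
    (fun k => by rw [biSet, Finset.mem_disjUnion]) (disjoint_left_right B C), coef_embed_map, coef_embed_map]
  · have h2 : Grassmann.inversions (B.map left.toEmbedding) (C.map right.toEmbedding) = 0 := by
      unfold Grassmann.inversions
      rw [Finset.card_eq_zero, Finset.filter_eq_empty_iff]
      rintro ⟨k, l⟩ hkl
      simp only [Finset.mem_product, Finset.mem_map] at hkl
      obtain ⟨⟨i, -, rfl⟩, j, -, rfl⟩ := hkl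
      exact (left_lt_right i j).not_gt
    rw [h2, pow_zero, one_mul]
  · intro b1 c1 B1 C1 h1 h2 h3 h4
    obtain ⟨b', B', rfl, rfl, -⟩ := exists_of_coef_embed_ne_zero h3
    obtain ⟨c', C', rfl, rfl, -⟩ := exists_of_coef_embed_ne_zero h4
    have h5 : biExp b c = biExp b' c' := h1
    have h6 : biSet B C = biSet B' C' := by
      ext k
      rw [h2, biSet, Finset.mem_disjUnion]
    rw [biExp_inj] at h5
    rw [biSet_inj] at h6
    rw [h5.1, h5.2, h6.1, h6.2]
    exact ⟨rfl, rfl, rfl, rfl⟩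

end LeftRight

/-! ### Setting variables to zero -/

section Truncation

variable {σ : Type*} [LinearOrder σ] {R : Type*} [CommRing R]

/-- The monomial `θ_A x^a` only involves variables with index in `V`. -/
def Involves (V : Set σ) (a : σ →₀ ℕ) (A : Finset σ) : Prop :=
  (∀ i ∈ a.support, i ∈ V) ∧ ∀ i ∈ A, i ∈ V

open Classical in
/-- The substitution of `0` for the variables with index outside of `V`. -/
noncomputable def trunc (R : Type*) [CommRing R] (V : Set σ) :
    SuperSeries σ R →+* SuperSeries σ R where
  toFun f := fun a A => if Involves V a A then coef a A f else 0
  map_one' := by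
    refine superSeries_ext fun a A => ?_
    change (if _ then _ else _) = _
    split_ifs with h
    · rfl
    · rw [coef_one, if_neg]
      rintro ⟨rfl, rfl⟩
      exact h ⟨by simp, by simp⟩
  map_zero' := by
    refine superSeries_ext fun a A => ?_
    change (if _ then _ else _) = _
    split_ifs <;> rfl
  map_add' f g := by
    refine superSeries_ext fun a A => ?_
    change (if Involves V a A then coef a A (f + g) else 0) =
      (if Involves V a A then coef a A f else 0) + (if Involves V a A then coef a A g else 0)
    split_ifs
    · rfl
    · rw [add_zero]
  map_mul' f g := by
    refine superSeries_ext fun a A => ?_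
    change (if Involves V a A then coef a A (f * g) else 0) = _
    split_ifs with h
    · refine coef_mul_congr (fun b B hb hB => ?_) fun b B hb hB => ?_
      · exact (if_pos ⟨fun i hi => h.1 i (Finsupp.support_mono hb hi),
          fun i hi => h.2 i (hB hi)⟩).symm
      · exact (if_pos ⟨fun i hi => h.1 i (Finsupp.support_mono hb hi),
          fun i hi => h.2 i (hB hi)⟩).symm
    -- If both factors of a monomial involve only variables from V, so does their product.
    · by_contra h1
      obtain ⟨b, c, B, C, rfl, rfl, -, h2, h3⟩ := exists_of_coef_mul_ne_zero (Ne.symm h1)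
      have hb : Involves V b B := by
        by_contra h4
        exact h2 (if_neg h4)
      have hc : Involves V c C := by
        by_contra h4
        exact h3 (if_neg h4)
      refine h ⟨fun i hi => ?_, fun i hi => ?_⟩
      · rcases Finset.mem_union.1 (Finsupp.support_add hi) with h4 | h4
        · exact hb.1 i h4
        · exact hc.1 i h4
      · rcases Finset.mem_union.1 hi with h4 | h4
        · exact hb.2 i h4
        · exact hc.2 i h4

theorem coef_trunc {V : Set σ} {a : σ →₀ ℕ} {A : Finset σ} (h : Involves V a A)
    (f : SuperSeries σ R) : coef a A (trunc R V f) = coef a A f :=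
  if_pos h

theorem coef_trunc_eq_zero {V : Set σ} {a : σ →₀ ℕ} {A : Finset σ} (h : ¬ Involves V a A)
    (f : SuperSeries σ R) : coef a A (trunc R V f) = 0 :=
  if_neg h

theorem trunc_eq_of_forall {V : Set σ} {f g : SuperSeries σ R}
    (h1 : ∀ a A, Involves V a A → coef a A f = coef a A g)
    (h2 : ∀ a A, coef a A g ≠ 0 → Involves V a A) : trunc R V f = g := by
  refine superSeries_ext fun a A => ?_
  by_cases h : Involves V a A
  · rw [coef_trunc h, h1 a A h]
  · rw [coef_trunc_eq_zero h]
    by_contra h3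
    exact h (h2 a A (Ne.symm h3))

theorem trunc_fermionic_of_notMem {V : Set σ} {i : σ} (h : i ∉ V) :
    trunc R V (fermionic R i) = 0 := by
  refine trunc_eq_of_forall (fun a A h1 => ?_) fun a A h1 => (h1 rfl).elim
  rw [coef_fermionic, if_neg]
  · rfl
  · rintro ⟨rfl, rfl⟩
    exact h (h1.2 i (Finset.mem_singleton_self i))

theorem trunc_bosonic_of_notMem {V : Set σ} {i : σ} (h : i ∉ V) :
    trunc R V (bosonic R i) = 0 := by
  refine trunc_eq_of_forall (fun a A h1 => ?_) fun a A h1 => (h1 rfl).elim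
  rw [coef_bosonic, if_neg]
  · rfl
  · rintro ⟨rfl, rfl⟩
    exact h (h1.1 i (by simp))

/-- Truncation as an endomorphism of the even subalgebra. -/
noncomputable def evenTrunc (R : Type*) [CommRing R] (V : Set σ) :
    evenSubalgebra σ R →+* evenSubalgebra σ R :=
  ((trunc R V).comp (evenSubalgebra σ R).val.toRingHom).codRestrict (evenSubalgebra σ R) (by
    intro f a A h
    by_cases h1 : Involves V a A
    · refine f.2 a A ?_
      rw [← coef_trunc h1]
      exact h
    · exact (h (coef_trunc_eq_zero h1 _)).elim)

end Truncation

/-! ### Grading by weight -/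

section Grading

variable {σ : Type*} [LinearOrder σ] {R : Type*} [CommRing R]

/-- The weight of the monomial `θ_A x^a`, where `x_i` and `θ_i` have weight `w i`. -/
def weight (w : σ → ℕ) (a : σ →₀ ℕ) (A : Finset σ) : ℕ :=
  a.sum (fun i n => n * w i) + ∑ i ∈ A, w i

theorem weight_add (w : σ → ℕ) (a b : σ →₀ ℕ) {A B : Finset σ} (h : Disjoint A B) :
    weight w (a + b) (A ∪ B) = weight w a A + weight w b B := by
  unfold weight
  rw [Finsupp.sum_add_index' (fun i => zero_mul _) (fun i m n => add_mul _ _ _),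
    Finset.sum_union h]
  ring

/-- The homogeneous component of weight `d`. -/
def component (w : σ → ℕ) (d : ℕ) (f : SuperSeries σ R) : SuperSeries σ R :=
  fun a A => if weight w a A = d then coef a A f else 0

theorem coef_component (w : σ → ℕ) (d : ℕ) (f : SuperSeries σ R) (a : σ →₀ ℕ) (A : Finset σ) :
    coef a A (component w d f) = if weight w a A = d then coef a A f else 0 := rfl

/-- The decomposition of a series into its homogeneous components. -/
def grading (R : Type*) [CommRing R] (w : σ → ℕ) :
    SuperSeries σ R →+* PowerSeries (SuperSeries σ R) where
  toFun f := PowerSeries.mk fun d => component w d f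
  map_one' := by
    ext d : 1
    rw [PowerSeries.coeff_mk, PowerSeries.coeff_one]
    refine superSeries_ext fun a A => ?_
    rw [coef_component, coef_one]
    by_cases h : a = 0 ∧ A = ∅
    · obtain ⟨rfl, rfl⟩ := h
      by_cases hd : d = 0
      · subst hd
        simp [weight, coef_one]
      · have : ¬ (0 = d) := fun h => hd h.symm
        simp [weight, hd, this, coef_zero]
    · rw [if_neg h, ite_self]
      split_ifs
      · rw [coef_one, if_neg h]
      · rfl
  map_zero' := by
    ext d : 1
    rw [PowerSeries.coeff_mk]
    refine superSeries_ext fun a A => ?_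
    rw [coef_component, coef_zero, ite_self]
    rfl
  map_add' f g := by
    ext d : 1
    rw [map_add, PowerSeries.coeff_mk, PowerSeries.coeff_mk, PowerSeries.coeff_mk]
    refine superSeries_ext fun a A => ?_
    rw [coef_add]
    simp only [coef_component]
    split_ifs
    · rfl
    · rw [add_zero]
  map_mul' f g := by
    ext d : 1
    rw [PowerSeries.coeff_mul, PowerSeries.coeff_mk]
    simp only [PowerSeries.coeff_mk]
    refine superSeries_ext fun a A => ?_
    -- For a fixed splitting of the monomial, only one pair of weights contributes.
    have key : ∀ p ∈ Finset.HasAntidiagonal.antidiagonal a, ∀ B ∈ A.powerset,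
        ∑ x ∈ Finset.HasAntidiagonal.antidiagonal d,
          (-1) ^ Grassmann.inversions B (A \ B) * coef p.1 B (component w x.1 f) *
            coef p.2 (A \ B) (component w x.2 g) =
        if weight w a A = d then
          (-1) ^ Grassmann.inversions B (A \ B) * coef p.1 B f * coef p.2 (A \ B) g else 0 := by
      intro p hp B hB
      rw [Finset.HasAntidiagonal.mem_antidiagonal] at hp
      have hw : weight w a A = weight w p.1 B + weight w p.2 (A \ B) := by
        rw [← weight_add w _ _ Finset.disjoint_sdiff, hp,
          Finset.union_sdiff_of_subset (Finset.mem_powerset.1 hB)]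
      split_ifs with h
      · rw [Finset.sum_eq_single (weight w p.1 B, weight w p.2 (A \ B))]
        · rw [coef_component, coef_component, if_pos rfl, if_pos rfl]
        · rintro ⟨x, y⟩ _ hne
          rw [coef_component, coef_component]
          by_cases h1 : weight w p.1 B = x
          · by_cases h2 : weight w p.2 (A \ B) = y
            · exact (hne (by rw [h1, h2])).elim
            · simp only [if_neg h2, mul_zero]
          · simp only [if_neg h1, mul_zero, zero_mul]
        · intro h1
          exact (h1 (Finset.HasAntidiagonal.mem_antidiagonal.2 (hw.symm.trans h))).elim
      · refine Finset.sum_eq_zero ?_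
        rintro ⟨x, y⟩ hxy
        rw [Finset.HasAntidiagonal.mem_antidiagonal] at hxy
        rw [coef_component, coef_component]
        by_cases h1 : weight w p.1 B = x
        · by_cases h2 : weight w p.2 (A \ B) = y
          · exact (h (by rw [hw, h1, h2]; exact hxy)).elim
          · simp only [if_neg h2, mul_zero]
        · simp only [if_neg h1, mul_zero, zero_mul]
    rw [coef_sum, coef_component]
    simp only [coef_mul]
    symm
    rw [Finset.sum_comm]
    trans ∑ p ∈ Finset.HasAntidiagonal.antidiagonal a, ∑ B ∈ A.powerset,
      if weight w a A = d then
        (-1) ^ Grassmann.inversions B (A \ B) * coef p.1 B f * coef p.2 (A \ B) g else 0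
    · refine Finset.sum_congr rfl fun p hp => ?_
      rw [Finset.sum_comm]
      exact Finset.sum_congr rfl fun B hB => key p hp B hB
    · split_ifs
      · rfl
      · simp

theorem coeff_grading (w : σ → ℕ) (d : ℕ) (f : SuperSeries σ R) :
    PowerSeries.coeff d (grading R w f) = component w d f :=
  PowerSeries.coeff_mk d fun d => component w d f

theorem coef_coeff_grading (w : σ → ℕ) (f : SuperSeries σ R) (a : σ →₀ ℕ) (A : Finset σ) :
    coef a A (PowerSeries.coeff (weight w a A) (grading R w f)) = coef a A f := by
  rw [coeff_grading, coef_component, if_pos rfl]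

/-- Identities of series may thus be checked after the formal variable recording the weight has been
introduced. -/
theorem grading_injective (w : σ → ℕ) : Function.Injective (grading (σ := σ) R w) := by
  intro f g h
  refine superSeries_ext fun a A => ?_
  rw [← coef_coeff_grading w f, h, coef_coeff_grading]

end Grading

/-! ### Permutations of the variables -/

section Permute

variable {σ : Type*} [LinearOrder σ] {R : Type*} [CommRing R]

/-- Indexing by the preimage of the monomial keeps inverse permutations out of later computations;
every monomial is such an image. -/
theorem coef_permute (s : Equiv.Perm σ) (f : SuperSeries σ R) (a : σ →₀ ℕ) (A : Finset σ) :
    coef (a.mapDomain s) (A.map s.toEmbedding) (permute s f) =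
      coef a A f * Grassmann.permSign R s A := by
  have : (a.mapDomain s).mapDomain s.symm = a := by
    rw [← Finsupp.mapDomain_comp]
    simp
  unfold coef permute
  rw [this, Grassmann.permute_apply_map]

theorem exists_eq_mapDomain (s : Equiv.Perm σ) (a : σ →₀ ℕ) :
    ∃ b : σ →₀ ℕ, a = b.mapDomain s :=
  ⟨a.mapDomain s.symm, by
    rw [← Finsupp.mapDomain_comp]
    simp⟩

theorem exists_eq_map (s : Equiv.Perm σ) (A : Finset σ) :
    ∃ B : Finset σ, A = B.map s.toEmbedding :=
  ⟨A.map s.symm.toEmbedding, by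
    ext
    simp⟩

theorem permute_mul (s : Equiv.Perm σ) (f g : SuperSeries σ R) :
    permute s (f * g) = permute s f * permute s g := by
  refine superSeries_ext fun a A => ?_
  have hadd : ∀ f g : Grassmann σ R,
      Grassmann.permute s (f + g) = Grassmann.permute s f + Grassmann.permute s g :=
    fun f g => funext fun A => add_mul _ _ _
  let P : Grassmann σ R →+ Grassmann σ R := AddMonoidHom.mk' (Grassmann.permute s) hadd
  have h1 : permute s (f * g) a = P (MvPowerSeries.coeff (a.mapDomain s.symm) (f * g)) := rfl
  have h2 : (permute s f * permute s g) a =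
      MvPowerSeries.coeff a (permute s f * permute s g) := rfl
  change permute s (f * g) a A = (permute s f * permute s g) a A
  rw [h1, h2, MvPowerSeries.coeff_mul, MvPowerSeries.coeff_mul, map_sum]
  refine congrFun (Finset.sum_bij (fun p _ => (p.1.mapDomain s, p.2.mapDomain s)) ?_ ?_ ?_ ?_) A
  · intro p hp
    rw [Finset.HasAntidiagonal.mem_antidiagonal] at hp ⊢
    rw [← Finsupp.mapDomain_add, hp, ← Finsupp.mapDomain_comp]
    simp
  · rintro ⟨p1, p2⟩ _ ⟨q1, q2⟩ _ hpq
    rw [Prod.mk.injEq] at hpq ⊢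
    exact ⟨Finsupp.mapDomain_injective s.injective hpq.1,
      Finsupp.mapDomain_injective s.injective hpq.2⟩
  · rintro ⟨c, d⟩ hcd
    rw [Finset.HasAntidiagonal.mem_antidiagonal] at hcd
    refine ⟨(c.mapDomain s.symm, d.mapDomain s.symm), ?_, ?_⟩
    · rw [Finset.HasAntidiagonal.mem_antidiagonal, ← Finsupp.mapDomain_add, hcd]
    · rw [← Finsupp.mapDomain_comp, ← Finsupp.mapDomain_comp]
      simp
  · rintro ⟨c, d⟩ _
    have e : ∀ (f : SuperSeries σ R) (c : σ →₀ ℕ),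
        MvPowerSeries.coeff (c.mapDomain s) (permute s f) = Grassmann.permute s (f c) := by
      intro f c
      have : (c.mapDomain s).mapDomain s.symm = c := by
        rw [← Finsupp.mapDomain_comp]
        simp
      change Grassmann.permute s (f _) = _
      rw [this]
    rw [e, e]
    exact Grassmann.permute_mul s (f c) (g d)

theorem permute_permute (s t : Equiv.Perm σ) (f : SuperSeries σ R) :
    permute s (permute t f) = permute (s * t) f := by
  funext a
  unfold permute
  rw [Grassmann.permute_permute, ← Finsupp.mapDomain_comp]
  rfl

theorem permute_one_series (s : Equiv.Perm σ) : permute s (1 : SuperSeries σ R) = 1 := by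
  refine superSeries_ext fun a A => ?_
  obtain ⟨a, rfl⟩ := exists_eq_mapDomain s a
  obtain ⟨A, rfl⟩ := exists_eq_map s A
  rw [coef_permute, coef_one, coef_one]
  have h : a.mapDomain s = 0 ↔ a = 0 := by
    refine ⟨fun h => Finsupp.mapDomain_injective s.injective ?_, fun h => ?_⟩
    · rw [h, Finsupp.mapDomain_zero]
    · rw [h, Finsupp.mapDomain_zero]
  simp only [h, Finset.map_eq_empty]
  split_ifs with h1
  · obtain ⟨-, rfl⟩ := h1
    simp [Grassmann.permSign, Grassmann.thetaProd_nil, Grassmann.one_apply]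
  · rw [zero_mul]

end Permute

/-! ### Finitary permutations of `ℕ` -/

/-- The group of permutations of `ℕ` generated by the adjacent transpositions. -/
def finitaryPerm : Subgroup (Equiv.Perm ℕ) :=
  Subgroup.closure (Set.range fun i : ℕ => Equiv.swap i (i + 1))

/-- Induction on the distance, conjugating (i, i+k) by the adjacent transposition (i+k, i+k+1). -/
theorem swap_mem_finitaryPerm (i j : ℕ) : Equiv.swap i j ∈ finitaryPerm := by
  have key : ∀ k i : ℕ, Equiv.swap i (i + k) ∈ finitaryPerm := by
    intro k
    induction k with
    | zero =>
      intro i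
      rw [add_zero, Equiv.swap_self]
      exact finitaryPerm.one_mem
    | succ k ih =>
      intro i
      have h1 : Equiv.swap (i + k) (i + k + 1) ∈ finitaryPerm :=
        Subgroup.subset_closure ⟨i + k, rfl⟩
      rcases Nat.eq_zero_or_pos k with rfl | hk
      · exact h1
      · have h2 : Equiv.swap (i + k) (i + k + 1) * Equiv.swap i (i + k) *
            Equiv.swap (i + k) (i + k + 1) = Equiv.swap (i + k + 1) i :=
          Equiv.swap_mul_swap_mul_swap (by omega) (by omega)
        rw [← add_assoc, Equiv.swap_comm, ← h2]
        exact finitaryPerm.mul_mem (finitaryPerm.mul_mem h1 (ih i)) h1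
  rcases le_total i j with h | h
  · obtain ⟨k, rfl⟩ := Nat.exists_eq_add_of_le h
    exact key k i
  · obtain ⟨k, rfl⟩ := Nat.exists_eq_add_of_le h
    rw [Equiv.swap_comm]
    exact key k j

/-- Symmetry is only assumed for adjacent transpositions, so the permutation moving a given list to
the front positions must be finitary. -/
theorem exists_finitaryPerm_extending (l : List ℕ) (hl : l.Nodup) :
    ∃ s ∈ finitaryPerm, (List.range l.length).map s = l := by
  induction l using List.reverseRecOn with
  | nil => exact ⟨1, finitaryPerm.one_mem, rfl⟩
  | append_singleton l x ih =>
    obtain ⟨s, hs, hl'⟩ := ih (List.Nodup.of_append_left hl)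
    -- The transposition sends the next image to x and fixes the earlier ones, which differ from
    -- both entries.
    refine ⟨Equiv.swap (s l.length) x * s,
      finitaryPerm.mul_mem (swap_mem_finitaryPerm _ _) hs, ?_⟩
    rw [List.length_append, List.length_singleton, List.range_succ, List.map_append]
    congr 1
    · conv_rhs => rw [← hl']
      refine List.map_congr_left fun k hk => ?_
      rw [List.mem_range] at hk
      rw [Equiv.Perm.mul_apply, Equiv.swap_apply_of_ne_of_ne]
      · intro h
        exact hk.ne (s.injective h)
      · intro h
        have : x ∈ l := by
          rw [← hl', List.mem_map]
          exact ⟨k, List.mem_range.2 hk, h⟩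
        exact (List.nodup_append'.1 hl).2.2 this (List.mem_singleton_self x)
    · simp

theorem IsSymmetric.permute_eq {R : Type*} [CommRing R] {f : SuperSeries ℕ R} (hf : IsSymmetric f)
    {s : Equiv.Perm ℕ} (hs : s ∈ finitaryPerm) : permute s f = f := by
  -- Since f is itself the image of a substitution, the identity acts trivially on it by
  -- composition, with no sign to compute.
  have h1 : permute (1 : Equiv.Perm ℕ) f = f := by
    have h := hf.2 0
    rw [← h, permute_permute, one_mul]
  induction hs using Subgroup.closure_induction with
  | mem x hx =>
    obtain ⟨i, rfl⟩ := hx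
    exact hf.2 i
  | one => exact h1
  | mul x y _ _ hx hy => rw [← permute_permute, hy, hx]
  | inv x _ hx =>
    conv_lhs => rw [← hx]
    rw [permute_permute, inv_mul_cancel, h1]

/-! ### The type of a monomial -/

theorem _root_.Multiset.exists_list_map_eq {α β : Type*} (f : α → β) (m : Multiset α) (l : List β)
    (h : m.map f = (l : Multiset β)) : ∃ l' : List α, (l' : Multiset α) = m ∧ l'.map f = l := by
  induction l generalizing m with
  | nil =>
    rw [Multiset.coe_nil, Multiset.map_eq_zero] at h
    exact ⟨[], by rw [h]; rfl, rfl⟩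
  | cons x l ih =>
    have hx : x ∈ m.map f := by
      rw [h]
      simp
    obtain ⟨y, hy, rfl⟩ := Multiset.mem_map.1 hx
    obtain ⟨m, rfl⟩ := Multiset.exists_cons_of_mem hy
    rw [Multiset.map_cons, ← Multiset.cons_coe, Multiset.cons_inj_right] at h
    obtain ⟨l', rfl, h2⟩ := ih m h
    exact ⟨y :: l', rfl, by rw [List.map_cons, h2]⟩

namespace SuperPartition

/-- The monomial `θ_A x^a` is, up to sign, a term of `m_Λ`. -/
def IsType (Λ : SuperPartition) (a : ℕ →₀ ℕ) (A : Finset ℕ) : Prop :=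
  A.val.map a = (Λ.anti : Multiset ℕ) ∧ (a.support \ A).val.map a = (Λ.sym : Multiset ℕ)

theorem anti_nodup (Λ : SuperPartition) : Λ.anti.Nodup :=
  Λ.anti_decreasing.imp fun h => h.ne'

theorem eq_of_coe_eq {Λ Ω : SuperPartition} (h1 : (Λ.anti : Multiset ℕ) = Ω.anti)
    (h2 : (Λ.sym : Multiset ℕ) = Ω.sym) : Λ = Ω := by
  refine SuperPartition.ext ?_ ?_
  · exact (Multiset.coe_eq_coe.1 h1).eq_of_pairwise (fun a b _ _ h h' => absurd h h'.not_gt)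
      Λ.anti_decreasing Ω.anti_decreasing
  · exact (Multiset.coe_eq_coe.1 h2).eq_of_pairwise (fun a b _ _ h h' => le_antisymm h' h)
      Λ.sym_decreasing Ω.sym_decreasing

theorem IsType.unique {Λ Ω : SuperPartition} {a : ℕ →₀ ℕ} {A : Finset ℕ} (h1 : Λ.IsType a A)
    (h2 : Ω.IsType a A) : Λ = Ω :=
  eq_of_coe_eq (h1.1.symm.trans h2.1) (h1.2.symm.trans h2.2)

/-- Entries of the antisymmetric component are distinct. By `exists_isType` this is the only
obstruction to having a type. -/
theorem IsType.injOn {Λ : SuperPartition} {a : ℕ →₀ ℕ} {A : Finset ℕ} (h : Λ.IsType a A) :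
    Set.InjOn a A := by
  have h1 : (A.val.map a).Nodup := by
    rw [h.1, Multiset.coe_nodup]
    exact Λ.anti_nodup
  intro i hi j hj hij
  exact Multiset.inj_on_of_nodup_map h1 i hi j hj hij

/-- The superpartition with the given entries. -/
noncomputable def ofMultiset (m₁ m₂ : Multiset ℕ) (h₁ : m₁.Nodup) (h₂ : ∀ k ∈ m₂, 0 < k) :
    SuperPartition where
  anti := m₁.sort (· ≥ ·)
  sym := m₂.sort (· ≥ ·)
  anti_decreasing := by
    have h := Multiset.pairwise_sort m₁ (· ≥ ·)
    have h' : (m₁.sort (· ≥ ·)).Nodup := by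
      rw [← Multiset.coe_nodup, Multiset.sort_eq]
      exact h₁
    exact (h.and h').imp fun hab => lt_of_le_of_ne hab.1 hab.2.symm
  sym_decreasing := Multiset.pairwise_sort m₂ (· ≥ ·)
  sym_pos k hk := h₂ k (by simpa using hk)

theorem exists_isType {a : ℕ →₀ ℕ} {A : Finset ℕ} (h : Set.InjOn a A) :
    ∃ Λ : SuperPartition, Λ.IsType a A :=
  ⟨ofMultiset (A.val.map a) ((a.support \ A).val.map a)
      (A.nodup.map_on fun _ hi _ hj hij => h hi hj hij) (by
        intro k hk
        obtain ⟨i, hi, rfl⟩ := Multiset.mem_map.1 hk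
        have := (Finset.mem_sdiff.1 hi).1
        exact Nat.pos_of_ne_zero (Finsupp.mem_support_iff.1 this)),
    (Multiset.sort_eq _ _).symm, (Multiset.sort_eq _ _).symm⟩

/-- The variables of the monomial, listed in the order of the parts of Λ. -/
theorem IsType.exists_lists {Λ : SuperPartition} {a : ℕ →₀ ℕ} {A : Finset ℕ}
    (h : Λ.IsType a A) : ∃ l₁ l₂ : List ℕ, (l₁ ++ l₂).Nodup ∧ l₁.toFinset = A ∧
      l₂.toFinset = a.support \ A ∧ l₁.map a = Λ.anti ∧ l₂.map a = Λ.sym := by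
  obtain ⟨l₁, h1, h2⟩ := Multiset.exists_list_map_eq a A.val Λ.anti h.1
  obtain ⟨l₂, h3, h4⟩ := Multiset.exists_list_map_eq a (a.support \ A).val Λ.sym h.2
  have e1 : l₁.toFinset = A := by
    ext i
    rw [List.mem_toFinset, ← Multiset.mem_coe, h1, Finset.mem_val]
  have e2 : l₂.toFinset = a.support \ A := by
    ext i
    rw [List.mem_toFinset, ← Multiset.mem_coe, h3, Finset.mem_val]
  refine ⟨l₁, l₂, ?_, e1, e2, h2, h4⟩
  rw [List.nodup_append']
  refine ⟨?_, ?_, fun x hx hy => ?_⟩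
  · rw [← Multiset.coe_nodup, h1]
    exact A.nodup
  · rw [← Multiset.coe_nodup, h3]
    exact Finset.nodup _
  · rw [← List.mem_toFinset, e1] at hx
    rw [← List.mem_toFinset, e2, Finset.mem_sdiff] at hy
    exact hy.2 hx

theorem isType_of_lists {Λ : SuperPartition} {a : ℕ →₀ ℕ} {l₁ l₂ : List ℕ}
    (h : (l₁ ++ l₂).Nodup) (h1 : l₁.map a = Λ.anti) (h2 : l₂.map a = Λ.sym)
    (h3 : ∀ i ∈ a.support, i ∈ l₁ ∨ i ∈ l₂) : Λ.IsType a l₁.toFinset := by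
  rw [List.nodup_append'] at h
  have e : a.support \ l₁.toFinset = l₂.toFinset := by
    ext i
    rw [Finset.mem_sdiff, List.mem_toFinset, List.mem_toFinset]
    constructor
    · rintro ⟨hi, hi'⟩
      exact (h3 i hi).resolve_left hi'
    · intro hi
      refine ⟨?_, fun hi' => h.2.2 hi' hi⟩
      rw [Finsupp.mem_support_iff]
      have : a i ∈ Λ.sym := by
        rw [← h2]
        exact List.mem_map_of_mem hi
      exact (Λ.sym_pos _ this).ne'
  constructor
  · rw [List.toFinset_val, h.1.dedup, Multiset.map_coe, h1]
  · rw [e, List.toFinset_val, h.2.1.dedup, Multiset.map_coe, h2]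

/-- The exponents of the term of `m_Λ` given by `s`. -/
noncomputable def exponent (Λ : SuperPartition) (s : Equiv.Perm ℕ) : ℕ →₀ ℕ :=
  ∑ i ∈ Finset.range Λ.parts.length, Finsupp.single (s i) (Λ.parts.getD i 0)

theorem exponent_apply (Λ : SuperPartition) (s : Equiv.Perm ℕ) (i : ℕ) :
    Λ.exponent s (s i) = Λ.parts.getD i 0 := by
  unfold exponent
  rw [Finsupp.finsetSum_apply]
  by_cases h : i < Λ.parts.length
  · rw [Finset.sum_eq_single i]
    · rw [Finsupp.single_eq_same]
    · intro j _ hj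
      exact Finsupp.single_eq_of_ne fun h => hj (s.injective h).symm
    · intro h'
      exact (h' (Finset.mem_range.2 h)).elim
  · rw [List.getD_eq_default _ _ (not_lt.1 h)]
    refine Finset.sum_eq_zero fun j hj => Finsupp.single_eq_of_ne fun h' => ?_
    rw [s.injective h'] at h
    exact h (Finset.mem_range.1 hj)

theorem exponent_isType (Λ : SuperPartition) (s : Equiv.Perm ℕ) :
    Λ.IsType (Λ.exponent s) ((List.range Λ.sector).map s).toFinset := by
  have hlen : Λ.parts.length = Λ.sector + Λ.sym.length := List.length_append
  refine isType_of_lists (l₂ := (List.range Λ.sym.length).map fun i => s (Λ.sector + i)) ?_ ?_ ?_ ?_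
  · have : (List.range Λ.sector).map s ++ ((List.range Λ.sym.length).map fun i =>
        s (Λ.sector + i)) = (List.range Λ.parts.length).map s := by
      rw [hlen, List.range_add, List.map_append, List.map_map]
      rfl
    rw [this]
    exact List.nodup_range.map s.injective
  · rw [List.map_map]
    refine List.ext_getElem (by simp [sector]) fun i h1 h2 => ?_
    simp only [List.getElem_map, List.getElem_range, Function.comp]
    rw [exponent_apply, parts, List.getD_append _ _ _ _ h2, List.getD_eq_getElem _ _ h2]
  · rw [List.map_map]
    refine List.ext_getElem (by simp) fun i h1 h2 => ?_
    simp only [List.getElem_map, List.getElem_range, Function.comp]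
    rw [exponent_apply, parts, List.getD_append_right _ _ _ _ (by simp [sector])]
    simp [sector, h2]
  · intro i hi
    obtain ⟨k, rfl⟩ := s.surjective i
    rw [Finsupp.mem_support_iff, exponent_apply] at hi
    have hk : k < Λ.parts.length := by
      by_contra h
      exact hi (List.getD_eq_default _ _ (not_lt.1 h))
    by_cases h : k < Λ.sector
    · exact Or.inl (List.mem_map_of_mem (List.mem_range.2 h))
    · refine Or.inr (List.mem_map.2 ⟨k - Λ.sector, List.mem_range.2 (by omega), ?_⟩)
      congr 1
      omega

/-- A permutation listing the variables in the order of the parts realises the monomial as a term of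
m_Λ. -/
theorem exponent_eq_of_map_eq {Λ : SuperPartition} {a : ℕ →₀ ℕ} {l₁ l₂ : List ℕ}
    {s : Equiv.Perm ℕ} (hs : (List.range (l₁ ++ l₂).length).map s = l₁ ++ l₂)
    (h1 : l₁.map a = Λ.anti) (h2 : l₂.map a = Λ.sym)
    (h3 : ∀ i ∈ a.support, i ∈ l₁ ∨ i ∈ l₂) :
    Λ.exponent s = a ∧ (List.range Λ.sector).map s = l₁ := by
  have hp : Λ.parts = (l₁ ++ l₂).map a := by rw [parts, List.map_append, h1, h2]
  constructor
  · ext j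
    obtain ⟨k, rfl⟩ := s.surjective j
    rw [exponent_apply, hp]
    by_cases hk : k < (l₁ ++ l₂).length
    · have e : (l₁ ++ l₂)[k] = s k := by
        have : (l₁ ++ l₂)[k]? = ((List.range (l₁ ++ l₂).length).map s)[k]? := by rw [hs]
        rw [List.getElem?_eq_getElem hk, List.getElem?_eq_getElem (by simpa using hk)] at this
        simpa using this
      rw [List.getD_eq_getElem _ _ (by simpa using hk), List.getElem_map, e]
    · rw [List.getD_eq_default _ _ (by simpa using hk)]
      by_contra h
      have h4 := h3 (s k) (Finsupp.mem_support_iff.2 (Ne.symm h))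
      rw [← List.mem_append, ← hs, List.mem_map] at h4
      obtain ⟨j, hj, hjk⟩ := h4
      rw [s.injective hjk, List.mem_range] at hj
      exact hk hj
  · have hl : Λ.sector = l₁.length := by rw [sector, ← h1, List.length_map]
    rw [List.length_append, List.range_add, List.map_append] at hs
    rw [hl]
    exact (List.append_inj hs (by simp)).1

end SuperPartition

/-! ### Monomial symmetric functions -/

section Monomial

variable {R : Type*} [CommRing R]

theorem coef_monomialTerm (Λ : SuperPartition) (s : Equiv.Perm ℕ) (a : ℕ →₀ ℕ) (A : Finset ℕ) :
    coef a A (monomialTerm R Λ s) =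
      if a = Λ.exponent s then Grassmann.thetaProd R ((List.range Λ.sector).map s) A else 0 :=
  coef_monomial _ _ _ _

/-- Strictly decreasing exponents leave only one possible order of the indices, which fixes the
order of the θ's in a term of m_Λ. -/
theorem list_eq_of_map_decreasing {a : ℕ → ℕ} {l l' : List ℕ} (h : l.toFinset = l'.toFinset)
    (h1 : (l.map a).Pairwise (· > ·)) (h2 : (l'.map a).Pairwise (· > ·)) : l = l' := by
  rw [List.pairwise_map] at h1 h2
  have n1 : l.Nodup := h1.imp fun {x y} hxy hne => by
    rw [hne] at hxy
    exact lt_irrefl _ hxy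
  have n2 : l'.Nodup := h2.imp fun {x y} hxy hne => by
    rw [hne] at hxy
    exact lt_irrefl _ hxy
  have hp : l.Perm l' := by
    rw [List.perm_ext_iff_of_nodup n1 n2]
    intro i
    rw [← List.mem_toFinset, h, List.mem_toFinset]
  exact hp.eq_of_pairwise (fun x y _ _ h h' => absurd h h'.not_gt) h1 h2

/-- Permutations contributing to this coefficient give the same exponents and, by strict decrease,
the same ordered list of θ's. They give one distinct term, counted once. -/
theorem coef_superMonomial_of_isType {Λ : SuperPartition} {a : ℕ →₀ ℕ} {l : List ℕ}
    (h : Λ.IsType a l.toFinset) (hl : l.map a = Λ.anti) :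
    coef a l.toFinset (superMonomial R Λ) = Grassmann.thetaProd R l l.toFinset := by
  obtain ⟨l₁, l₂, h1, h2, h3, h4, h5⟩ := h.exists_lists
  have hdec : (l.map a).Pairwise (· > ·) := by
    rw [hl]
    exact Λ.anti_decreasing
  have hl1 : l₁ = l := list_eq_of_map_decreasing h2 (by
    rw [h4]
    exact Λ.anti_decreasing) hdec
  subst hl1
  obtain ⟨s, -, hs⟩ := exists_finitaryPerm_extending _ h1
  obtain ⟨e1, e2⟩ := SuperPartition.exponent_eq_of_map_eq hs h4 h5 (by
    intro i hi
    rw [← List.mem_toFinset, ← List.mem_toFinset, h3, Finset.mem_sdiff]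
    tauto)
  have h6 : coef a l₁.toFinset (monomialTerm R Λ s) = Grassmann.thetaProd R l₁ l₁.toFinset := by
    rw [coef_monomialTerm, if_pos e1.symm, e2]
  rw [← h6]
  refine finsum_eq_single _ (⟨monomialTerm R Λ s, s, rfl⟩ : Set.range (monomialTerm R Λ)) ?_
  rintro ⟨_, t, rfl⟩ hne
  by_contra h7
  change coef a l₁.toFinset (monomialTerm R Λ t) ≠ 0 at h7
  rw [coef_monomialTerm] at h7
  have h8 : a = Λ.exponent t := by
    by_contra h9
    exact h7 (if_neg h9)
  rw [if_pos h8] at h7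
  have h9 := (Grassmann.thetaProd_apply_ne_zero h7).2
  have h10 : l₁ = (List.range Λ.sector).map t := by
    refine list_eq_of_map_decreasing h9 hdec ?_
    rw [h8, List.map_map]
    have : (List.range Λ.sector).map (Λ.exponent t ∘ t) = Λ.anti := by
      refine List.ext_getElem (by simp [SuperPartition.sector]) fun i h1 h2 => ?_
      simp only [List.getElem_map, List.getElem_range, Function.comp]
      rw [SuperPartition.exponent_apply, SuperPartition.parts, List.getD_append _ _ _ _ h2,
        List.getD_eq_getElem _ _ h2]
    rw [this]
    exact Λ.anti_decreasing
  apply hne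
  apply Subtype.ext
  change monomialTerm R Λ t = monomialTerm R Λ s
  have e3 : ∀ u : Equiv.Perm ℕ, monomialTerm R Λ u = MvPowerSeries.monomial (Λ.exponent u)
    (Grassmann.thetaProd R ((List.range Λ.sector).map u)) := fun u => rfl
  rw [e3, e3, ← h8, ← h10, e1, e2]

theorem isType_of_coef_superMonomial_ne_zero {Λ : SuperPartition} {a : ℕ →₀ ℕ} {A : Finset ℕ}
    (h : coef a A (superMonomial R Λ) ≠ 0) : Λ.IsType a A := by
  have h1 : (∑ᶠ u : Set.range (monomialTerm R Λ), coef a A (u : SuperSeries ℕ R)) ≠ 0 := h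
  obtain ⟨⟨_, s, rfl⟩, h2⟩ : ∃ u : Set.range (monomialTerm R Λ),
      coef a A (u : SuperSeries ℕ R) ≠ 0 := by
    by_contra! h2
    exact h1 (finsum_eq_zero_of_forall_eq_zero h2)
  rw [coef_monomialTerm] at h2
  have h8 : a = Λ.exponent s := by
    by_contra h9
    exact h2 (if_neg h9)
  rw [if_pos h8] at h2
  rw [(Grassmann.thetaProd_apply_ne_zero h2).2, h8]
  exact Λ.exponent_isType s

theorem coef_superMonomial_eq_zero {Λ : SuperPartition} {a : ℕ →₀ ℕ} {A : Finset ℕ}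
    (h : ¬ Λ.IsType a A) : coef a A (superMonomial R Λ) = 0 := by
  by_contra h1
  exact h (isType_of_coef_superMonomial_ne_zero h1)

theorem SuperPartition.IsType.sum_eq {Λ : SuperPartition} {a : ℕ →₀ ℕ} {A : Finset ℕ}
    (h : Λ.IsType a A) : a.degree = Λ.degree := by
  rw [SuperPartition.degree, SuperPartition.parts, List.sum_append, ← Multiset.sum_coe,
    ← Multiset.sum_coe, ← h.1, ← h.2, Finsupp.degree_apply]
  change _ = ∑ i ∈ A, a i + ∑ i ∈ a.support \ A, a i
  rw [← Finset.sum_union Finset.disjoint_sdiff]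
  refine Finset.sum_subset (fun i hi => ?_) fun i _ hi => Finsupp.notMem_support_iff.1 hi
  rw [Finset.mem_union, Finset.mem_sdiff]
  tauto

theorem SuperPartition.IsType.card_eq {Λ : SuperPartition} {a : ℕ →₀ ℕ} {A : Finset ℕ}
    (h : Λ.IsType a A) : A.card = Λ.sector := by
  have := congrArg Multiset.card h.1
  rwa [Multiset.card_map, Multiset.coe_card] at this

theorem hasSector_superMonomial (Λ : SuperPartition) :
    HasSector Λ.sector (superMonomial R Λ) :=
  fun _ _ h => (isType_of_coef_superMonomial_ne_zero h).card_eq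

/-! ### Symmetric functions -/

theorem SuperPartition.IsType.permute {Λ : SuperPartition} {a : ℕ →₀ ℕ} {A : Finset ℕ}
    (h : Λ.IsType a A) (s : Equiv.Perm ℕ) :
    Λ.IsType (a.mapDomain s) (A.map s.toEmbedding) := by
  have e : (a.mapDomain s).support \ A.map s.toEmbedding = (a.support \ A).map s.toEmbedding := by
    rw [Finset.map_sdiff, Finsupp.mapDomain_support_of_injective s.injective, Finset.map_eq_image,
      Finset.map_eq_image]
    rfl
  have e2 : (a.mapDomain s) ∘ s.toEmbedding = a :=
    funext fun i => Finsupp.mapDomain_apply s.injective a i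
  constructor
  · rw [Finset.map_val, Multiset.map_map, e2, h.1]
  · rw [e, Finset.map_val, Multiset.map_map, e2, h.2]

theorem SuperPartition.isType_permute_iff {Λ : SuperPartition} {a : ℕ →₀ ℕ} {A : Finset ℕ}
    (s : Equiv.Perm ℕ) : Λ.IsType (a.mapDomain s) (A.map s.toEmbedding) ↔ Λ.IsType a A := by
  refine ⟨fun h => ?_, fun h => h.permute s⟩
  have := h.permute s.symm
  rw [← Finsupp.mapDomain_comp, Finset.map_map] at this
  have e1 : (s.symm : ℕ → ℕ) ∘ s = id := by
    ext
    simp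
  have e2 : s.toEmbedding.trans s.symm.toEmbedding = Function.Embedding.refl ℕ := by
    ext
    simp
  rwa [e1, e2, Finsupp.mapDomain_id, Finset.map_refl] at this

/-- The exponent sequence along the list of θ's is unchanged by relabelling, so the sign of m_Λ
transforms by the same factor as θ_A. -/
theorem permute_superMonomial (Λ : SuperPartition) (s : Equiv.Perm ℕ) :
    permute s (superMonomial R Λ) = superMonomial R Λ := by
  refine superSeries_ext fun a A => ?_
  obtain ⟨a, rfl⟩ := exists_eq_mapDomain s a
  obtain ⟨A, rfl⟩ := exists_eq_map s A
  rw [coef_permute]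
  by_cases h : Λ.IsType a A
  · obtain ⟨l, l₂, h1, rfl, -, h4, -⟩ := h.exists_lists
    have h5 := h.permute s
    rw [← Grassmann.toFinset_map_perm] at h5 ⊢
    rw [coef_superMonomial_of_isType h h4, coef_superMonomial_of_isType h5, ←
      Grassmann.thetaProd_map_apply s (List.nodup_append'.1 h1).1, Grassmann.toFinset_map_perm]
    rw [List.map_map, ← h4]
    exact List.map_congr_left fun i _ => Finsupp.mapDomain_apply s.injective a i
  · rw [coef_superMonomial_eq_zero h, zero_mul,
      coef_superMonomial_eq_zero ((SuperPartition.isType_permute_iff s).not.2 h)]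

theorem superMonomial_mem (Λ : SuperPartition) : superMonomial R Λ ∈ symmetricSuperfunctions R := by
  refine ⟨⟨Λ.degree + Λ.sector, fun a A h => ?_⟩, fun i => permute_superMonomial Λ _⟩
  have h1 := isType_of_coef_superMonomial_ne_zero h
  rw [h1.sum_eq, h1.card_eq]
  omega

theorem mul_mem_symmetricSuperfunctions {f g : SuperSeries ℕ R}
    (hf : f ∈ symmetricSuperfunctions R) (hg : g ∈ symmetricSuperfunctions R) :
    f * g ∈ symmetricSuperfunctions R := by
  obtain ⟨⟨d, hd⟩, hf⟩ := hf
  obtain ⟨⟨e, he⟩, hg⟩ := hg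
  refine ⟨⟨d + e, fun a A h => ?_⟩, fun i => by rw [permute_mul, hf, hg]⟩
  obtain ⟨b, c, B, C, rfl, rfl, hBC, h1, h2⟩ := exists_of_coef_mul_ne_zero h
  rw [Finset.card_union_of_disjoint hBC, map_add]
  have := hd _ _ h1
  have := he _ _ h2
  omega

theorem one_mem_symmetricSuperfunctions : (1 : SuperSeries ℕ R) ∈ symmetricSuperfunctions R := by
  refine ⟨⟨0, fun a A h => ?_⟩, fun i => permute_one_series _⟩
  rw [coef_one] at h
  obtain ⟨rfl, rfl⟩ : a = 0 ∧ A = ∅ := by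
    by_contra h1
    exact h (if_neg h1)
  simp

theorem list_prod_mem_symmetricSuperfunctions {l : List (SuperSeries ℕ R)}
    (h : ∀ f ∈ l, f ∈ symmetricSuperfunctions R) : l.prod ∈ symmetricSuperfunctions R := by
  induction l with
  | nil => exact one_mem_symmetricSuperfunctions
  | cons f l ih =>
    rw [List.prod_cons]
    exact mul_mem_symmetricSuperfunctions (h f List.mem_cons_self)
      (ih fun g hg => h g (List.mem_cons_of_mem _ hg))

theorem complete_mem (n : ℕ) : complete R n ∈ symmetricSuperfunctions R :=
  finsum_mem_induction (fun f => f ∈ symmetricSuperfunctions R)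
    (Submodule.zero_mem _) (fun _ _ hf hg => Submodule.add_mem _ hf hg)
    fun Λ _ => superMonomial_mem Λ

theorem completeTilde_mem (n : ℕ) : completeTilde R n ∈ symmetricSuperfunctions R :=
  finsum_mem_induction (fun f => f ∈ symmetricSuperfunctions R)
    (Submodule.zero_mem _) (fun _ _ hf hg => Submodule.add_mem _ hf hg)
    fun Λ _ => Submodule.smul_of_tower_mem _ _ (superMonomial_mem Λ)

theorem superComplete_mem (Λ : SuperPartition) :
    superComplete R Λ ∈ symmetricSuperfunctions R := by
  refine mul_mem_symmetricSuperfunctions (list_prod_mem_symmetricSuperfunctions fun f hf => ?_)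
    (list_prod_mem_symmetricSuperfunctions fun f hf => ?_)
  · obtain ⟨n, -, rfl⟩ := List.mem_map.1 hf
    exact completeTilde_mem n
  · obtain ⟨n, -, rfl⟩ := List.mem_map.1 hf
    exact complete_mem n

theorem permute_rev (s : Equiv.Perm ℕ) (f : SuperSeries ℕ R) :
    permute s (rev f) = rev (permute s f) := by
  refine superSeries_ext fun a A => ?_
  obtain ⟨a, rfl⟩ := exists_eq_mapDomain s a
  obtain ⟨A, rfl⟩ := exists_eq_map s A
  rw [coef_permute, coef_rev, coef_rev, coef_permute, Finset.card_map, mul_assoc]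

theorem rev_mem {f : SuperSeries ℕ R} (hf : f ∈ symmetricSuperfunctions R) :
    rev f ∈ symmetricSuperfunctions R := by
  obtain ⟨⟨d, hd⟩, hf⟩ := hf
  refine ⟨⟨d, fun a A h => hd a A ?_⟩, fun i => by rw [permute_rev, hf]⟩
  rw [coef_rev] at h
  exact right_ne_zero_of_mul h

end Monomial

/-! ### Power sums -/

section PowerSum

variable {R : Type*} [CommRing R]

/-- Positivity of n matters: for n = 0 every index would contribute to the constant term. In the
fermionic case θ_i identifies the index even when n = 0. -/
theorem coef_powerSum_eq_sum {n : ℕ} (hn : 0 < n) {a : ℕ →₀ ℕ} {s : Finset ℕ}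
    (hs : a.support ⊆ s) (A : Finset ℕ) :
    coef a A (powerSum R n) = coef a A (∑ i ∈ s, bosonic R i ^ n) := by
  rw [coef_sum]
  refine finsum_eq_sum_of_support_subset _ fun i hi => ?_
  rw [Function.mem_support, coef_bosonic_pow] at hi
  have h1 : a = Finsupp.single i n ∧ A = ∅ := by
    by_contra h
    exact hi (if_neg h)
  apply hs
  rw [h1.1, Finsupp.support_single i hn.ne']
  exact Finset.mem_singleton_self i

theorem coef_powerSumTilde_eq_sum (n : ℕ) (a : ℕ →₀ ℕ) {A s : Finset ℕ} (hs : A ⊆ s) :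
    coef a A (powerSumTilde R n) = coef a A (∑ i ∈ s, fermionic R i * bosonic R i ^ n) := by
  rw [coef_sum]
  refine finsum_eq_sum_of_support_subset _ fun i hi => ?_
  rw [Function.mem_support, coef_fermionic_mul_bosonic_pow] at hi
  have h1 : a = Finsupp.single i n ∧ A = {i} := by
    by_contra h
    exact hi (if_neg h)
  apply hs
  rw [h1.2]
  exact Finset.mem_singleton_self i

theorem exists_of_coef_powerSum_ne_zero {n : ℕ} {a : ℕ →₀ ℕ} {A : Finset ℕ}
    (h : coef a A (powerSum R n) ≠ 0) : ∃ i, a = Finsupp.single i n ∧ A = ∅ := by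
  have h1 : (∑ᶠ i : ℕ, coef a A (bosonic R i ^ n)) ≠ 0 := h
  by_contra h2
  refine h1 (finsum_eq_zero_of_forall_eq_zero fun i => ?_)
  rw [coef_bosonic_pow, if_neg fun h3 => h2 ⟨i, h3⟩]

theorem exists_of_coef_powerSumTilde_ne_zero {n : ℕ} {a : ℕ →₀ ℕ} {A : Finset ℕ}
    (h : coef a A (powerSumTilde R n) ≠ 0) : ∃ i, a = Finsupp.single i n ∧ A = {i} := by
  have h1 : (∑ᶠ i : ℕ, coef a A (fermionic R i * bosonic R i ^ n)) ≠ 0 := h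
  by_contra h2
  refine h1 (finsum_eq_zero_of_forall_eq_zero fun i => ?_)
  rw [coef_fermionic_mul_bosonic_pow, if_neg fun h3 => h2 ⟨i, h3⟩]

theorem coef_powerSum_single {n : ℕ} (hn : 0 < n) (i : ℕ) :
    coef (Finsupp.single i n) ∅ (powerSum R n) = 1 := by
  rw [coef_powerSum_eq_sum hn Finsupp.support_single_subset, Finset.sum_singleton,
    coef_bosonic_pow, if_pos ⟨rfl, rfl⟩]

theorem coef_powerSumTilde_single (n i : ℕ) :
    coef (Finsupp.single i n) {i} (powerSumTilde R n) = 1 := by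
  rw [coef_powerSumTilde_eq_sum n _ subset_rfl, Finset.sum_singleton,
    coef_fermionic_mul_bosonic_pow, if_pos ⟨rfl, rfl⟩]

theorem hasSector_powerSum (n : ℕ) : HasSector 0 (powerSum R n) := by
  intro a A h
  obtain ⟨i, -, rfl⟩ := exists_of_coef_powerSum_ne_zero h
  rfl

theorem hasSector_powerSumTilde (n : ℕ) : HasSector 1 (powerSumTilde R n) := by
  intro a A h
  obtain ⟨i, -, rfl⟩ := exists_of_coef_powerSumTilde_ne_zero h
  rfl

theorem permSign_empty (s : Equiv.Perm ℕ) : Grassmann.permSign R s ∅ = 1 := by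
  simp [Grassmann.permSign, Grassmann.thetaProd_nil, Grassmann.one_apply]

theorem permSign_singleton (s : Equiv.Perm ℕ) (i : ℕ) : Grassmann.permSign R s {i} = 1 := by
  simp [Grassmann.permSign, Grassmann.thetaProd, Grassmann.theta_apply]

theorem permute_powerSum {n : ℕ} (hn : 0 < n) (s : Equiv.Perm ℕ) :
    permute s (powerSum R n) = powerSum R n := by
  refine superSeries_ext fun a A => ?_
  obtain ⟨a, rfl⟩ := exists_eq_mapDomain s a
  obtain ⟨A, rfl⟩ := exists_eq_map s A
  rw [coef_permute]
  by_cases h : coef (a.mapDomain s) (A.map s.toEmbedding) (powerSum R n) = 0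
  · by_cases h1 : coef a A (powerSum R n) = 0
    · rw [h, h1, zero_mul]
    · obtain ⟨i, rfl, rfl⟩ := exists_of_coef_powerSum_ne_zero h1
      rw [Finsupp.mapDomain_single, Finset.map_empty, coef_powerSum_single hn] at h
      rw [coef_powerSum_single hn, Finsupp.mapDomain_single, Finset.map_empty,
        coef_powerSum_single hn, permSign_empty, mul_one]
  · obtain ⟨i, h1, h2⟩ := exists_of_coef_powerSum_ne_zero h
    obtain ⟨j, rfl⟩ := s.surjective i
    rw [← Finsupp.mapDomain_single (f := s)] at h1
    rw [Finset.map_eq_empty] at h2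
    rw [Finsupp.mapDomain_injective s.injective h1, h2, Finsupp.mapDomain_single, Finset.map_empty,
      coef_powerSum_single hn, coef_powerSum_single hn, permSign_empty, mul_one]

theorem permute_powerSumTilde (n : ℕ) (s : Equiv.Perm ℕ) :
    permute s (powerSumTilde R n) = powerSumTilde R n := by
  refine superSeries_ext fun a A => ?_
  obtain ⟨a, rfl⟩ := exists_eq_mapDomain s a
  obtain ⟨A, rfl⟩ := exists_eq_map s A
  rw [coef_permute]
  have e : ∀ i, Finset.map s.toEmbedding {i} = {s i} := fun i => Finset.map_singleton _ _
  by_cases h : coef (a.mapDomain s) (A.map s.toEmbedding) (powerSumTilde R n) = 0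
  · by_cases h1 : coef a A (powerSumTilde R n) = 0
    · rw [h, h1, zero_mul]
    · obtain ⟨i, rfl, rfl⟩ := exists_of_coef_powerSumTilde_ne_zero h1
      rw [Finsupp.mapDomain_single, e, coef_powerSumTilde_single,
        coef_powerSumTilde_single, permSign_singleton, mul_one]
  · obtain ⟨i, h1, h2⟩ := exists_of_coef_powerSumTilde_ne_zero h
    obtain ⟨j, rfl⟩ := s.surjective i
    rw [← Finsupp.mapDomain_single (f := s)] at h1
    rw [← e] at h2
    rw [Finsupp.mapDomain_injective s.injective h1, Finset.map_injective _ h2,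
      Finsupp.mapDomain_single, e, coef_powerSumTilde_single, coef_powerSumTilde_single,
      permSign_singleton, mul_one]

theorem powerSum_mem {n : ℕ} (hn : 0 < n) : powerSum R n ∈ symmetricSuperfunctions R := by
  refine ⟨⟨n, fun a A h => ?_⟩, fun i => permute_powerSum hn _⟩
  obtain ⟨i, rfl, rfl⟩ := exists_of_coef_powerSum_ne_zero h
  simp

theorem powerSumTilde_mem (n : ℕ) : powerSumTilde R n ∈ symmetricSuperfunctions R := by
  refine ⟨⟨n + 1, fun a A h => ?_⟩, fun i => permute_powerSumTilde n _⟩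
  obtain ⟨i, rfl, rfl⟩ := exists_of_coef_powerSumTilde_ne_zero h
  simp

theorem superPowerSum_mem (Λ : SuperPartition) :
    superPowerSum R Λ ∈ symmetricSuperfunctions R := by
  refine mul_mem_symmetricSuperfunctions (list_prod_mem_symmetricSuperfunctions fun f hf => ?_)
    (list_prod_mem_symmetricSuperfunctions fun f hf => ?_)
  · obtain ⟨n, -, rfl⟩ := List.mem_map.1 hf
    exact powerSumTilde_mem n
  · obtain ⟨n, hn, rfl⟩ := List.mem_map.1 hf
    exact powerSum_mem (Λ.sym_pos n hn)

theorem hasSector_superPowerSum (Λ : SuperPartition) :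
    HasSector Λ.sector (superPowerSum R Λ) := by
  have h1 := hasSector_list_prod (Λ.anti.map (powerSumTilde R)) 1 (by
    intro f hf
    obtain ⟨n, -, rfl⟩ := List.mem_map.1 hf
    exact hasSector_powerSumTilde n)
  have h2 := hasSector_list_prod (Λ.sym.map (powerSum R)) 0 (by
    intro f hf
    obtain ⟨n, -, rfl⟩ := List.mem_map.1 hf
    exact hasSector_powerSum n)
  have := h1.mul h2
  rwa [one_mul, zero_mul, add_zero, List.length_map] at this

/-! ### The coefficients of the complete functions -/

/-- The parts and both lengths are bounded by d: a zero part can only be antisymmetric, where the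
sector counts it, and symmetric parts are at least 1. -/
theorem finite_setOf_degree_add_sector_le (d : ℕ) :
    {Λ : SuperPartition | Λ.degree + Λ.sector ≤ d}.Finite := by
  have h1 : {l : List ℕ | l.length ≤ d ∧ ∀ x ∈ l, x ≤ d}.Finite := by
    refine ((List.finite_length_le (Fin (d + 1)) d).image (List.map Fin.val)).subset ?_
    rintro l ⟨h1, h2⟩
    refine ⟨l.pmap (fun x hx => ⟨x, Nat.lt_succ_of_le hx⟩) h2, ?_, ?_⟩
    · simpa using h1
    · rw [List.map_pmap]
      simp
  refine Set.Finite.of_finite_image (f := fun Λ => (Λ.anti, Λ.sym)) ((h1.prod h1).subset ?_) ?_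
  · rintro _ ⟨Λ, hΛ, rfl⟩
    have hΛ' : Λ.anti.sum + Λ.sym.sum + Λ.anti.length ≤ d := by
      have : Λ.degree = Λ.anti.sum + Λ.sym.sum := List.sum_append
      rw [← this]
      exact hΛ
    have hlen : Λ.sym.length ≤ Λ.sym.sum := List.length_le_sum_of_one_le _ Λ.sym_pos
    have h2 : ∀ x ∈ Λ.anti, x ≤ d := fun x hx => by
      have := List.single_le_sum (fun _ _ => Nat.zero_le _) x hx
      omega
    have h3 : ∀ x ∈ Λ.sym, x ≤ d := fun x hx => by
      have := List.single_le_sum (fun _ _ => Nat.zero_le _) x hx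
      omega
    have h4 : Λ.anti.length ≤ d := by omega
    have h5 : Λ.sym.length ≤ d := by omega
    exact ⟨⟨h4, h2⟩, ⟨h5, h3⟩⟩
  · intro Λ _ Ω _ h
    exact SuperPartition.ext (congrArg Prod.fst h) (congrArg Prod.snd h)

theorem finite_SPar (n m : ℕ) : (SPar n m).Finite :=
  (finite_setOf_degree_add_sector_le (n + m)).subset fun _ h =>
    (Nat.add_le_add h.1.le h.2.le : _ ≤ n + m)

theorem coef_finsum_mem {s : Set SuperPartition} (hs : s.Finite) (f : SuperPartition → SuperSeries ℕ R)
    (a : ℕ →₀ ℕ) (A : Finset ℕ) :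
    coef a A (∑ᶠ Λ ∈ s, f Λ) = ∑ Λ ∈ hs.toFinset, coef a A (f Λ) := by
  rw [finsum_mem_eq_finite_toFinset_sum _ hs, coef_sum]

/-- Each bosonic monomial of degree n has exactly one type, and occurs with coefficient 1. -/
theorem coef_complete (n : ℕ) (a : ℕ →₀ ℕ) (A : Finset ℕ) :
    coef a A (complete R n) = if a.degree = n ∧ A = ∅ then 1 else 0 := by
  rw [complete, coef_finsum_mem (finite_SPar n 0)]
  split_ifs with h
  · obtain ⟨h1, rfl⟩ := h
    obtain ⟨Λ, hΛ⟩ := SuperPartition.exists_isType (a := a) (A := ∅) (by simp)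
    rw [Finset.sum_eq_single Λ]
    · have h2 : Λ.anti = [] := by
        have := hΛ.1
        simpa using this.symm
      have := coef_superMonomial_of_isType (R := R) (l := []) hΛ (by rw [h2]; rfl)
      rw [List.toFinset_nil] at this
      rw [this, Grassmann.thetaProd_nil, Grassmann.one_apply, if_pos rfl]
    · intro Ω _ hne
      exact coef_superMonomial_eq_zero fun h2 => hne (h2.unique hΛ)
    · intro h2
      refine (h2 ((finite_SPar n 0).mem_toFinset.2 ⟨?_, ?_⟩)).elim
      · rw [← hΛ.sum_eq, h1]
      · rw [← hΛ.card_eq, Finset.card_empty]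
  · refine Finset.sum_eq_zero fun Λ hΛ => coef_superMonomial_eq_zero fun h1 => h ?_
    rw [Set.Finite.mem_toFinset] at hΛ
    exact ⟨h1.sum_eq.trans hΛ.1, Finset.card_eq_zero.1 (h1.card_eq.trans hΛ.2)⟩

theorem hasSector_complete (n : ℕ) : HasSector 0 (complete R n) := by
  intro a A h
  rw [coef_complete] at h
  have : A = ∅ := by
    by_contra h1
    exact h (if_neg fun h2 => h1 h2.2)
  rw [this, Finset.card_empty]

theorem hasSector_completeTilde (n : ℕ) : HasSector 1 (completeTilde R n) := by
  intro a A h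
  rw [completeTilde, coef_finsum_mem (finite_SPar n 1)] at h
  obtain ⟨Λ, hΛ, h1⟩ := Finset.exists_ne_zero_of_sum_ne_zero h
  rw [coef_nsmul] at h1
  rw [Set.Finite.mem_toFinset] at hΛ
  rw [(isType_of_coef_superMonomial_ne_zero (right_ne_zero_of_mul h1)).card_eq]
  exact hΛ.2

/-- The factor Λ₁ + 1 becomes the exponent of the variable carrying θ, plus one. -/
theorem coef_completeTilde (n : ℕ) (a : ℕ →₀ ℕ) (j : ℕ) :
    coef a {j} (completeTilde R n) = if a.degree = n then (a j + 1 : R) else 0 := by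
  rw [completeTilde, coef_finsum_mem (finite_SPar n 1)]
  split_ifs with h
  · obtain ⟨Λ, hΛ⟩ := SuperPartition.exists_isType (a := a) (A := {j}) (by simp)
    rw [Finset.sum_eq_single Λ]
    · have h2 : Λ.anti = [a j] := by
        have := hΛ.1
        rw [Finset.singleton_val, Multiset.map_singleton, eq_comm,
          Multiset.coe_eq_singleton] at this
        exact this
      have := coef_superMonomial_of_isType (R := R) (l := [j]) hΛ (by rw [h2]; rfl)
      rw [List.toFinset_cons, List.toFinset_nil, insert_empty_eq] at this
      rw [coef_nsmul, this, h2]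
      simp [Grassmann.thetaProd, Grassmann.theta_apply]
    · intro Ω _ hne
      rw [coef_nsmul, coef_superMonomial_eq_zero fun h2 => hne (h2.unique hΛ), mul_zero]
    · intro h2
      refine (h2 ((finite_SPar n 1).mem_toFinset.2 ⟨?_, ?_⟩)).elim
      · rw [← hΛ.sum_eq, h]
      · rw [← hΛ.card_eq, Finset.card_singleton]
  · refine Finset.sum_eq_zero fun Λ hΛ => ?_
    rw [coef_nsmul, coef_superMonomial_eq_zero, mul_zero]
    intro h1
    rw [Set.Finite.mem_toFinset] at hΛ
    exact h (h1.sum_eq.trans hΛ.1)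

theorem complete_zero : complete R 0 = 1 := by
  refine superSeries_ext fun a A => ?_
  rw [coef_complete, coef_one]
  simp only [Finsupp.degree_eq_zero_iff]

/-! ### Newton identities -/

theorem coef_powerSum_mul {n : ℕ} (hn : 0 < n) (f : SuperSeries ℕ R) (a : ℕ →₀ ℕ) (A : Finset ℕ) :
    coef a A (powerSum R n * f) =
      ∑ i ∈ a.support, if n ≤ a i then coef (a - Finsupp.single i n) A f else 0 := by
  rw [coef_mul_congr (f' := ∑ i ∈ a.support, bosonic R i ^ n) (g' := f)
    (fun b B hb _ => coef_powerSum_eq_sum hn (Finsupp.support_mono hb) B) fun _ _ _ _ => rfl,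
    Finset.sum_mul, coef_sum]
  exact Finset.sum_congr rfl fun i _ => coef_bosonic_pow_mul i n a A f

theorem coef_powerSumTilde_mul (n : ℕ) (f : SuperSeries ℕ R) (a : ℕ →₀ ℕ) (A : Finset ℕ) :
    coef a A (powerSumTilde R n * f) = ∑ i ∈ A, if n ≤ a i then
      (-1) ^ Grassmann.inversions {i} (A.erase i) * coef (a - Finsupp.single i n) (A.erase i) f
      else 0 := by
  rw [coef_mul_congr (f' := ∑ i ∈ A, fermionic R i * bosonic R i ^ n) (g' := f)
    (fun b B _ hB => coef_powerSumTilde_eq_sum n b hB) fun _ _ _ _ => rfl,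
    Finset.sum_mul, coef_sum]
  refine Finset.sum_congr rfl fun i hi => ?_
  rw [coef_fermionic_mul_bosonic_pow_mul]
  simp only [hi, and_true]

theorem degree_sub_single {a : ℕ →₀ ℕ} {i n : ℕ} (h : n ≤ a i) :
    (a - Finsupp.single i n).degree = a.degree - n := by
  have h1 : a - Finsupp.single i n + Finsupp.single i n = a :=
    tsub_add_cancel_of_le (Finsupp.single_le_iff.2 h)
  have h2 := congrArg Finsupp.degree h1
  rw [map_add, Finsupp.degree_single] at h2
  omega

theorem le_degree (a : ℕ →₀ ℕ) (i : ℕ) : a i ≤ a.degree := by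
  by_cases h : i ∈ a.support
  · rw [Finsupp.degree_apply]
    exact Finset.single_le_sum (f := fun i => a i) (fun _ _ => Nat.zero_le _) h
  · rw [Finsupp.notMem_support_iff.1 h]
    exact Nat.zero_le _

theorem sum_range_ite_succ_le {M : Type*} [AddCommMonoid M] (g : ℕ → M) {c N : ℕ} (h : c ≤ N) :
    (∑ r ∈ Finset.range N, if r + 1 ≤ c then g r else 0) = ∑ r ∈ Finset.range c, g r := by
  rw [← Finset.sum_filter]
  congr 1
  ext r
  simp only [Finset.mem_filter, Finset.mem_range]
  omega

/-- For x^a of degree n + 1, the right side counts the pairs (i, r) with r + 1 ≤ a_i, of which there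
are ∑ a_i = n + 1. -/
theorem newton_complete (n : ℕ) : (n + 1) • complete R (n + 1) =
    ∑ p ∈ Finset.HasAntidiagonal.antidiagonal n, powerSum R (p.1 + 1) * complete R p.2 := by
  refine superSeries_ext fun a A => ?_
  rw [coef_nsmul, coef_complete, coef_sum, Finset.Nat.sum_antidiagonal_eq_sum_range_succ_mk]
  simp only [coef_powerSum_mul (Nat.succ_pos _), coef_complete]
  rw [Finset.sum_comm]
  by_cases h : a.degree = n + 1 ∧ A = ∅
  · have key : ∀ i ∈ a.support, (∑ r ∈ Finset.range n.succ, if r + 1 ≤ a i then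
        (if (a - Finsupp.single i (r + 1)).degree = n - r ∧ A = ∅ then (1 : R) else 0) else 0) =
          a i := by
      intro i _
      trans ∑ r ∈ Finset.range n.succ, if r + 1 ≤ a i then (1 : R) else 0
      · refine Finset.sum_congr rfl fun r hr => ?_
        by_cases hri : r + 1 ≤ a i
        · have h1 : (a - Finsupp.single i (r + 1)).degree = n - r := by
            rw [degree_sub_single hri, h.1, Nat.add_sub_add_right]
          rw [if_pos hri, if_pos hri, if_pos ⟨h1, h.2⟩]
        · rw [if_neg hri, if_neg hri]
      · rw [sum_range_ite_succ_le _ ((le_degree a i).trans h.1.le)]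
        simp
    rw [Finset.sum_congr rfl key, if_pos h, mul_one, ← Nat.cast_sum, ← Finsupp.degree_apply, h.1]
  · rw [if_neg h, mul_zero]
    refine (Finset.sum_eq_zero fun i _ => Finset.sum_eq_zero fun r hr => ?_).symm
    by_cases hri : r + 1 ≤ a i
    · rw [if_pos hri, if_neg]
      rintro ⟨h1, h2⟩
      rw [degree_sub_single hri] at h1
      rw [Finset.mem_range] at hr
      have := le_degree a i
      exact h ⟨by omega, h2⟩
    · rw [if_neg hri]

variable (R) in
/-- The functions `h̃_{n-1}`, with the convention `h̃_{-1} = 0`. -/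
noncomputable def completeTildePred : ℕ → SuperSeries ℕ R
  | 0 => 0
  | n + 1 => completeTilde R n

theorem hasSector_completeTildePred (n : ℕ) : HasSector 1 (completeTildePred R n) := by
  cases n with
  | zero => exact fun _ _ h => (h rfl).elim
  | succ n => exact hasSector_completeTilde n

theorem coef_completeTildePred (n : ℕ) (a : ℕ →₀ ℕ) (j : ℕ) :
    coef a {j} (completeTildePred R n) = if a.degree + 1 = n then (a j + 1 : R) else 0 := by
  cases n with
  | zero => rfl
  | succ n =>
    rw [completeTildePred, coef_completeTilde]
    simp only [Nat.add_right_cancel_iff]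

theorem HasSector.nsmul {m : ℕ} {f : SuperSeries ℕ R} (h : HasSector m f) (n : ℕ) :
    HasSector m (n • f) := by
  intro a A h1
  rw [coef_nsmul] at h1
  exact h a A (right_ne_zero_of_mul h1)

theorem HasSector.add {m : ℕ} {f g : SuperSeries ℕ R} (hf : HasSector m f) (hg : HasSector m g) :
    HasSector m (f + g) := by
  intro a A h
  by_cases h1 : coef a A f = 0
  · refine hg a A fun h2 => h ?_
    rw [coef_add, h1, h2, add_zero]
  · exact hf a A h1

theorem HasSector.sum {ι : Type*} {m : ℕ} {f : ι → SuperSeries ℕ R} (s : Finset ι)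
    (h : ∀ i ∈ s, HasSector m (f i)) : HasSector m (∑ i ∈ s, f i) := by
  intro a A h1
  rw [coef_sum] at h1
  obtain ⟨i, hi, h2⟩ := Finset.exists_ne_zero_of_sum_ne_zero h1
  exact h i hi a A h2

/-- Compare the coefficients of θ_j x^a with |a| = d. The fermionic terms give ∑_{r ≤ a_j} (r + 1).
The bosonic ones give a_i (a_j + 1) for i ≠ j, and for i = j the same minus ∑_{r < a_j} (r + 1),
because dividing by x_j^(r+1) lowers the exponent that weights h̃. The total is (d + 1)(a_j + 1). -/
theorem newton_completeTilde (d : ℕ) : (d + 1) • completeTilde R d =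
    ∑ p ∈ Finset.HasAntidiagonal.antidiagonal d, ((p.1 + 1) • (powerSumTilde R p.1 * complete R p.2) +
      powerSum R (p.1 + 1) * completeTildePred R p.2) := by
  have hs1 : HasSector 1 ((d + 1) • completeTilde R d) := (hasSector_completeTilde d).nsmul _
  have hs2 : HasSector 1 (∑ p ∈ Finset.HasAntidiagonal.antidiagonal d,
      ((p.1 + 1) • (powerSumTilde R p.1 * complete R p.2) +
        powerSum R (p.1 + 1) * completeTildePred R p.2)) := by
    refine HasSector.sum _ fun p _ => HasSector.add (HasSector.nsmul ?_ _) ?_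
    · exact (hasSector_powerSumTilde _).mul (hasSector_complete _)
    · have := (hasSector_powerSum (R := R) (p.1 + 1)).mul (hasSector_completeTildePred p.2)
      rwa [zero_add] at this
  refine superSeries_ext fun a A => ?_
  by_cases hA : A.card = 1
  swap
  · have h1 : coef a A ((d + 1) • completeTilde R d) = 0 := by
      by_contra h
      exact hA (hs1 a A h)
    rw [h1]
    by_contra h
    exact hA (hs2 a A (Ne.symm h))
  obtain ⟨j, rfl⟩ := Finset.card_eq_one.1 hA
  rw [coef_nsmul, coef_completeTilde, coef_sum, Finset.Nat.sum_antidiagonal_eq_sum_range_succ_mk]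
  have hinv : Grassmann.inversions {j} (∅ : Finset ℕ) = 0 := by simp [Grassmann.inversions]
  have hjj : ({j} : Finset ℕ).erase j = ∅ := by simp
  simp only [coef_add, coef_nsmul, coef_powerSum_mul (Nat.succ_pos _), coef_powerSumTilde_mul,
    coef_completeTildePred, coef_complete, Finset.sum_singleton, hjj, hinv, pow_zero, one_mul,
    and_true, Nat.succ_eq_add_one]
  by_cases h : a.degree = d
  · rw [if_pos h, Finset.sum_add_distrib, Finset.sum_comm (t := a.support)]
    have key1 : ∑ r ∈ Finset.range d.succ, (((r + 1 : ℕ) : R) * if r ≤ a j then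
        (if (a - Finsupp.single j r).degree = d - r then 1 else 0) else 0) =
          ∑ r ∈ Finset.range (a j + 1), ((r + 1 : ℕ) : R) := by
      rw [← sum_range_ite_succ_le _ (Nat.succ_le_succ ((le_degree a j).trans h.le))]
      refine Finset.sum_congr rfl fun r hr => ?_
      by_cases hri : r ≤ a j
      · rw [if_pos hri, if_pos (Nat.succ_le_succ hri), if_pos, mul_one]
        rw [degree_sub_single hri, h]
      · rw [if_neg hri, if_neg (by omega), mul_zero]
    have key2 : ∀ i ∈ a.support, (∑ r ∈ Finset.range d.succ, if r + 1 ≤ a i then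
        (if (a - Finsupp.single i (r + 1)).degree + 1 = d - r then
          (((a - Finsupp.single i (r + 1)) j : ℕ) + 1 : R) else 0) else 0) =
          a i * (a j + 1 : R) -
            if i = j then ∑ r ∈ Finset.range (a j), ((r + 1 : ℕ) : R) else 0 := by
      intro i _
      trans ∑ r ∈ Finset.range (a i), (((a - Finsupp.single i (r + 1)) j : ℕ) + 1 : R)
      · rw [← sum_range_ite_succ_le _ (((le_degree a i).trans h.le).trans (Nat.le_succ d))]
        refine Finset.sum_congr rfl fun r hr => ?_
        by_cases hri : r + 1 ≤ a i
        · rw [if_pos hri, if_pos hri, if_pos]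
          rw [degree_sub_single hri]
          have := le_degree a i
          omega
        · rw [if_neg hri, if_neg hri]
      · by_cases hij : i = j
        · subst hij
          rw [if_pos rfl, eq_sub_iff_add_eq, ← Finset.sum_add_distrib]
          rw [Finset.sum_congr rfl (g := fun _ => (a i + 1 : R)), Finset.sum_const,
            Finset.card_range, nsmul_eq_mul]
          intro r hr
          rw [Finset.mem_range] at hr
          rw [Finsupp.tsub_apply, Finsupp.single_eq_same, Nat.cast_sub hr]
          ring
        · rw [if_neg hij, sub_zero, Finset.sum_congr rfl (g := fun _ => (a j + 1 : R)),
            Finset.sum_const, Finset.card_range, nsmul_eq_mul]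
          intro r _
          rw [Finsupp.tsub_apply, Finsupp.single_eq_of_ne (Ne.symm hij), tsub_zero]
    -- If j is outside the support then a_j = 0 and the correction is an empty sum.
    have hj : (∑ i ∈ a.support, if i = j then ∑ r ∈ Finset.range (a j), ((r + 1 : ℕ) : R) else 0) =
        ∑ r ∈ Finset.range (a j), ((r + 1 : ℕ) : R) := by
      rw [Finset.sum_ite_eq']
      split_ifs with h1
      · rfl
      · rw [Finsupp.notMem_support_iff.1 h1, Finset.sum_range_zero]
    have hd : ∑ i ∈ a.support, (a i : R) = d := by
      rw [← Nat.cast_sum, ← Finsupp.degree_apply, h]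
    rw [← Nat.succ_eq_add_one d, Finset.sum_congr rfl key2, key1, Finset.sum_sub_distrib, hj,
      ← Finset.sum_mul, hd, Finset.sum_range_succ]
    push_cast
    ring
  · rw [if_neg h, mul_zero]
    refine (Finset.sum_eq_zero fun r hr => ?_).symm
    rw [Finset.mem_range] at hr
    have h1 : (if r ≤ a j then
        (if (a - Finsupp.single j r).degree = d - r then (1 : R) else 0) else 0) = 0 := by
      by_cases hri : r ≤ a j
      · rw [if_pos hri, if_neg]
        rw [degree_sub_single hri]
        have := le_degree a j
        omega
      · rw [if_neg hri]
    rw [h1, mul_zero, zero_add]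
    refine Finset.sum_eq_zero fun i _ => ?_
    by_cases hri : r + 1 ≤ a i
    · rw [if_pos hri, if_neg]
      rw [degree_sub_single hri]
      have := le_degree a i
      omega
    · rw [if_neg hri]

end PowerSum

/-! ### The exponential sum over superpartitions -/

namespace SuperPartition

/-- `∏ k ^ n(k) * n(k)!` for the multiplicities `n(k)` of a multiset. -/
def zMultiset (m : Multiset ℕ) : ℕ := ∏ k ∈ m.toFinset, k ^ m.count k * (m.count k).factorial

theorem z_eq (Λ : SuperPartition) : Λ.z = zMultiset (Λ.sym : Multiset ℕ) := by
  simp [z, zMultiset]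

theorem zMultiset_eq_of_subset {m : Multiset ℕ} {s : Finset ℕ} (h : m.toFinset ⊆ s) :
    zMultiset m = ∏ k ∈ s, k ^ m.count k * (m.count k).factorial := by
  refine Finset.prod_subset h fun k _ hk => ?_
  rw [Multiset.mem_toFinset] at hk
  rw [Multiset.count_eq_zero_of_notMem hk]
  rfl

/-- This ratio turns z_Λ⁻¹ into z⁻¹ of the superpartition with one symmetric part removed. -/
theorem zMultiset_cons (k : ℕ) (m : Multiset ℕ) :
    zMultiset (k ::ₘ m) = k * (m.count k + 1) * zMultiset m := by
  rw [zMultiset_eq_of_subset (s := insert k m.toFinset) (by rw [Multiset.toFinset_cons]),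
    zMultiset_eq_of_subset (Finset.subset_insert k m.toFinset),
    ← Finset.mul_prod_erase _ _ (Finset.mem_insert_self k _),
    ← Finset.mul_prod_erase _ _ (Finset.mem_insert_self k m.toFinset), Multiset.count_cons_self,
    Finset.prod_congr rfl fun j hj => by
      rw [Multiset.count_cons_of_ne (Finset.ne_of_mem_erase hj)], Nat.factorial_succ, pow_succ]
  ring

theorem z_pos (Λ : SuperPartition) : 0 < Λ.z :=
  Finset.prod_pos fun k hk =>
    Nat.mul_pos (Nat.pow_pos (Λ.sym_pos k (List.mem_toFinset.1 hk))) (Nat.factorial_pos _)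

/-- The sum of the bosonic and the fermionic degree. -/
def totalDegree (Λ : SuperPartition) : ℕ := Λ.degree + Λ.sector

theorem totalDegree_eq (Λ : SuperPartition) : Λ.totalDegree =
    (Λ.anti : Multiset ℕ).sum + (Λ.sym : Multiset ℕ).sum +
      Multiset.card (Λ.anti : Multiset ℕ) := by
  rw [totalDegree, degree, parts, List.sum_append]
  rfl

theorem coe_anti_ofMultiset {m₁ m₂ : Multiset ℕ} (h₁ : m₁.Nodup) (h₂ : ∀ k ∈ m₂, 0 < k) :
    ((ofMultiset m₁ m₂ h₁ h₂).anti : Multiset ℕ) = m₁ := Multiset.sort_eq _ _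

theorem coe_sym_ofMultiset {m₁ m₂ : Multiset ℕ} (h₁ : m₁.Nodup) (h₂ : ∀ k ∈ m₂, 0 < k) :
    ((ofMultiset m₁ m₂ h₁ h₂).sym : Multiset ℕ) = m₂ := Multiset.sort_eq _ _

theorem coe_anti_nodup (Λ : SuperPartition) : (Λ.anti : Multiset ℕ).Nodup :=
  Multiset.coe_nodup.2 Λ.anti_nodup

theorem coe_sym_pos (Λ : SuperPartition) : ∀ k ∈ (Λ.sym : Multiset ℕ), 0 < k := Λ.sym_pos

/-- Adjoin the part `r + 1` to the symmetric component. -/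
noncomputable def consSym (r : ℕ) (Λ : SuperPartition) : SuperPartition :=
  ofMultiset Λ.anti ((r + 1) ::ₘ (Λ.sym : Multiset ℕ)) Λ.coe_anti_nodup fun k hk => by
    rcases Multiset.mem_cons.1 hk with rfl | h
    · exact Nat.succ_pos r
    · exact Λ.coe_sym_pos k h

/-- Remove a part `r + 1` from the symmetric component. -/
noncomputable def eraseSym (r : ℕ) (Λ : SuperPartition) : SuperPartition :=
  ofMultiset Λ.anti ((Λ.sym : Multiset ℕ).erase (r + 1)) Λ.coe_anti_nodup fun k hk =>
    Λ.coe_sym_pos k (Multiset.mem_of_mem_erase hk)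

/-- Adjoin the part `r` to the antisymmetric component. -/
noncomputable def consAnti (r : ℕ) (Λ : SuperPartition) : SuperPartition :=
  ofMultiset (Multiset.ndinsert r (Λ.anti : Multiset ℕ)) Λ.sym (Λ.coe_anti_nodup.ndinsert r)
    Λ.coe_sym_pos

/-- Remove the part `r` from the antisymmetric component. -/
noncomputable def eraseAnti (r : ℕ) (Λ : SuperPartition) : SuperPartition :=
  ofMultiset ((Λ.anti : Multiset ℕ).erase r) Λ.sym (Λ.coe_anti_nodup.erase r) Λ.coe_sym_pos

theorem finite_setOf_totalDegree_eq (d : ℕ) : {Λ : SuperPartition | Λ.totalDegree = d}.Finite :=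
  (finite_setOf_degree_add_sector_le d).subset fun _ h => Nat.le_of_eq h

/-- The superpartitions of given total degree. -/
noncomputable def ofTotalDegree (d : ℕ) : Finset SuperPartition :=
  (finite_setOf_totalDegree_eq d).toFinset

theorem mem_ofTotalDegree {d : ℕ} {Λ : SuperPartition} :
    Λ ∈ ofTotalDegree d ↔ Λ.totalDegree = d :=
  (finite_setOf_totalDegree_eq d).mem_toFinset

/-- A symmetric part k counts k, an antisymmetric part r counts r + 1 because of its θ. This splits
the factor d + 1 in the recursion over the parts that can be removed. -/
theorem totalDegree_eq_sum {d : ℕ} {Λ : SuperPartition} (h : Λ.totalDegree = d + 1) :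
    d + 1 = ∑ r ∈ Finset.range (d + 1), ((r + 1) * (Λ.sym : Multiset ℕ).count (r + 1) +
      (r + 1) * if r ∈ Λ.anti then 1 else 0) := by
  have hd : Λ.anti.sum + Λ.sym.sum + Λ.anti.length = d + 1 := by
    rw [← h, totalDegree_eq]
    rfl
  have h1 : Λ.sym.sum = ∑ r ∈ Finset.range (d + 1), (r + 1) * Λ.sym.count (r + 1) := by
    rw [Finset.sum_list_count_of_subset Λ.sym ((Finset.range (d + 1)).map (addRightEmbedding 1))]
    · rw [Finset.sum_map]
      refine Finset.sum_congr rfl fun r _ => ?_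
      rw [smul_eq_mul, mul_comm]
      rfl
    · intro k hk
      rw [List.mem_toFinset] at hk
      have := Λ.sym_pos k hk
      have h2 := List.single_le_sum (fun _ _ => Nat.zero_le _) k hk
      rw [Finset.mem_map]
      refine ⟨k - 1, Finset.mem_range.2 (by omega), ?_⟩
      change k - 1 + 1 = k
      omega
  have h2 : Λ.anti.sum + Λ.anti.length =
      ∑ r ∈ Finset.range (d + 1), (r + 1) * if r ∈ Λ.anti then 1 else 0 := by
    have h3 : Λ.anti.sum + Λ.anti.length = (Λ.anti.map fun r => r + 1).sum := by
      rw [List.sum_map_add]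
      simp
    rw [h3, ← List.sum_toFinset _ Λ.anti_nodup]
    simp only [mul_ite, mul_one, mul_zero]
    rw [← Finset.sum_filter]
    congr 1
    ext r
    rw [List.mem_toFinset, Finset.mem_filter, Finset.mem_range]
    refine ⟨fun hr => ⟨?_, hr⟩, fun hr => hr.2⟩
    have h4 := List.single_le_sum (fun _ _ => Nat.zero_le _) r hr
    have h5 := List.length_pos_of_mem hr
    omega
  rw [Finset.sum_add_distrib, ← h2]
  have h3 : ∑ r ∈ Finset.range (d + 1), (r + 1) * (Λ.sym : Multiset ℕ).count (r + 1) =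
    Λ.sym.sum := by
    rw [h1]
    simp only [Multiset.coe_count]
  omega

section Exponential

variable {𝕜 Z : Type*} [Field 𝕜] [CommRing Z] [Algebra 𝕜 Z]

/-- The product over the parts, with a factor `O r` for each part `r` of the antisymmetric
component and a factor `P k` for each part `k` of the symmetric one. -/
def partProd (O P : ℕ → Z) (Λ : SuperPartition) : Z :=
  ((Λ.anti : Multiset ℕ).map O).prod * ((Λ.sym : Multiset ℕ).map P).prod

variable (𝕜) in
/-- The sum of `z_Λ⁻¹` times the product over the parts, over the `Λ` of total degree `d`. -/
noncomputable def expCoeff (O P : ℕ → Z) (d : ℕ) : Z :=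
  ∑ Λ ∈ ofTotalDegree d, (Λ.z : 𝕜)⁻¹ • partProd O P Λ

/-- Remove one part r + 1: its multiplicity times r + 1 is exactly the ratio of the two values of z.
-/
theorem sum_count_smul [CharZero 𝕜] (O P : ℕ → Z) {d r : ℕ} (hr : r ≤ d) :
    ∑ Λ ∈ ofTotalDegree (d + 1), (((r + 1) * (Λ.sym : Multiset ℕ).count (r + 1) : ℕ) : 𝕜) •
      (Λ.z : 𝕜)⁻¹ • partProd O P Λ = P (r + 1) * expCoeff 𝕜 O P (d - r) := by
  rw [expCoeff, Finset.mul_sum,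
    ← Finset.sum_filter_of_ne (p := fun Λ : SuperPartition => r + 1 ∈ (Λ.sym : Multiset ℕ))]
  · refine Finset.sum_nbij' (eraseSym r) (consSym r) ?_ ?_ ?_ ?_ ?_
    · intro Λ hΛ
      rw [Finset.mem_filter, mem_ofTotalDegree, totalDegree_eq] at hΛ
      rw [mem_ofTotalDegree, totalDegree_eq, eraseSym, coe_anti_ofMultiset, coe_sym_ofMultiset]
      have := Multiset.sum_cons (r + 1) ((Λ.sym : Multiset ℕ).erase (r + 1))
      rw [Multiset.cons_erase hΛ.2] at this
      omega
    · intro Λ hΛ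
      rw [mem_ofTotalDegree, totalDegree_eq] at hΛ
      rw [Finset.mem_filter, mem_ofTotalDegree, totalDegree_eq, consSym, coe_anti_ofMultiset,
        coe_sym_ofMultiset, Multiset.sum_cons]
      exact ⟨by omega, Multiset.mem_cons_self _ _⟩
    · intro Λ hΛ
      rw [Finset.mem_filter] at hΛ
      refine eq_of_coe_eq ?_ ?_
      · rw [consSym, coe_anti_ofMultiset, eraseSym, coe_anti_ofMultiset]
      · rw [consSym, coe_sym_ofMultiset, eraseSym, coe_sym_ofMultiset, Multiset.cons_erase hΛ.2]
    · intro Λ _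
      refine eq_of_coe_eq ?_ ?_
      · rw [eraseSym, coe_anti_ofMultiset, consSym, coe_anti_ofMultiset]
      · rw [eraseSym, coe_sym_ofMultiset, consSym, coe_sym_ofMultiset, Multiset.erase_cons_head]
    · intro Λ hΛ
      rw [Finset.mem_filter] at hΛ
      have e : (Λ.sym : Multiset ℕ) = (r + 1) ::ₘ ((eraseSym r Λ).sym : Multiset ℕ) := by
        rw [eraseSym, coe_sym_ofMultiset, Multiset.cons_erase hΛ.2]
      have e' : (Λ.anti : Multiset ℕ) = ((eraseSym r Λ).anti : Multiset ℕ) := by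
        rw [eraseSym, coe_anti_ofMultiset]
      have hz : ((eraseSym r Λ).z : 𝕜) ≠ 0 := Nat.cast_ne_zero.2 (z_pos _).ne'
      rw [partProd, partProd, z_eq, e, e', Multiset.map_cons, Multiset.prod_cons, zMultiset_cons,
        Multiset.count_cons_self, ← z_eq, smul_smul, mul_smul_comm]
      congr 1
      · have h1 : ((r : 𝕜) + 1) ≠ 0 := Nat.cast_add_one_ne_zero r
        have h2 : ((Multiset.count (r + 1) ((eraseSym r Λ).sym : Multiset ℕ) : 𝕜) + 1) ≠ 0 :=
          Nat.cast_add_one_ne_zero _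
        push_cast
        field_simp
      · ring
  · intro Λ _ h
    by_contra h1
    rw [Multiset.count_eq_zero_of_notMem h1] at h
    simp at h

/-- Removing r from the antisymmetric component leaves z unchanged. On the right, superpartitions
already containing r contribute nothing since O r squares to 0. -/
theorem sum_mem_anti_smul (O P : ℕ → Z) (hO : ∀ r, O r * O r = 0) {d r : ℕ}
    (hr : r ≤ d) :
    ∑ Λ ∈ ofTotalDegree (d + 1), (((r + 1) * if r ∈ Λ.anti then 1 else 0 : ℕ) : 𝕜) •
      (Λ.z : 𝕜)⁻¹ • partProd O P Λ = (r + 1) • O r * expCoeff 𝕜 O P (d - r) := by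
  rw [expCoeff, Finset.mul_sum,
    ← Finset.sum_filter_of_ne (p := fun Λ : SuperPartition => r ∈ Λ.anti)]
  · symm
    rw [← Finset.sum_filter_of_ne (p := fun Λ : SuperPartition => r ∉ Λ.anti)]
    · refine Finset.sum_nbij' (consAnti r) (eraseAnti r) ?_ ?_ ?_ ?_ ?_
      · intro Λ hΛ
        rw [Finset.mem_filter, mem_ofTotalDegree, totalDegree_eq, ← Multiset.mem_coe] at hΛ
        rw [Finset.mem_filter, mem_ofTotalDegree, totalDegree_eq, consAnti, ← Multiset.mem_coe,
          coe_anti_ofMultiset, coe_sym_ofMultiset, Multiset.ndinsert_of_notMem hΛ.2,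
          Multiset.sum_cons, Multiset.card_cons]
        exact ⟨by omega, Multiset.mem_cons_self _ _⟩
      · intro Λ hΛ
        rw [Finset.mem_filter, mem_ofTotalDegree, totalDegree_eq, ← Multiset.mem_coe] at hΛ
        rw [Finset.mem_filter, mem_ofTotalDegree, totalDegree_eq, eraseAnti, ← Multiset.mem_coe,
          coe_anti_ofMultiset, coe_sym_ofMultiset]
        have h1 := Multiset.sum_cons r ((Λ.anti : Multiset ℕ).erase r)
        have h2 := Multiset.card_cons r ((Λ.anti : Multiset ℕ).erase r)
        rw [Multiset.cons_erase hΛ.2] at h1 h2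
        exact ⟨by omega, fun h => (Λ.coe_anti_nodup.mem_erase_iff.1 h).1 rfl⟩
      · intro Λ hΛ
        rw [Finset.mem_filter, ← Multiset.mem_coe] at hΛ
        refine eq_of_coe_eq ?_ ?_
        · rw [eraseAnti, coe_anti_ofMultiset, consAnti, coe_anti_ofMultiset,
            Multiset.ndinsert_of_notMem hΛ.2, Multiset.erase_cons_head]
        · rw [eraseAnti, coe_sym_ofMultiset, consAnti, coe_sym_ofMultiset]
      · intro Λ hΛ
        rw [Finset.mem_filter, ← Multiset.mem_coe] at hΛ
        refine eq_of_coe_eq ?_ ?_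
        · rw [consAnti, coe_anti_ofMultiset, eraseAnti, coe_anti_ofMultiset,
            Multiset.ndinsert_of_notMem, Multiset.cons_erase hΛ.2]
          exact fun h => (Λ.coe_anti_nodup.mem_erase_iff.1 h).1 rfl
        · rw [consAnti, coe_sym_ofMultiset, eraseAnti, coe_sym_ofMultiset]
      · intro Λ hΛ
        rw [Finset.mem_filter, ← Multiset.mem_coe] at hΛ
        have e : ((consAnti r Λ).anti : Multiset ℕ) = r ::ₘ (Λ.anti : Multiset ℕ) := by
          rw [consAnti, coe_anti_ofMultiset, Multiset.ndinsert_of_notMem hΛ.2]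
        have e' : ((consAnti r Λ).sym : Multiset ℕ) = (Λ.sym : Multiset ℕ) := by
          rw [consAnti, coe_sym_ofMultiset]
        have h1 : r ∈ (consAnti r Λ).anti := by
          rw [← Multiset.mem_coe, e]
          exact Multiset.mem_cons_self _ _
        rw [partProd, partProd, z_eq, z_eq, e, e', Multiset.map_cons, Multiset.prod_cons,
          if_pos h1, mul_one, mul_smul_comm, smul_comm, Nat.cast_smul_eq_nsmul, smul_mul_assoc,
          mul_assoc]
    · intro Λ _ h h1
      apply h
      obtain ⟨m, hm⟩ := Multiset.exists_cons_of_mem (Multiset.mem_coe.2 h1)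
      rw [partProd, hm, Multiset.map_cons, Multiset.prod_cons, mul_smul_comm, mul_assoc,
        smul_mul_assoc, ← mul_assoc, hO, zero_mul, smul_zero, smul_zero]
  · intro Λ _ h
    by_contra h1
    rw [if_neg h1] at h
    simp at h

/-- Coefficientwise form of E' = G E for E = exp(∑ P_k X^k / k + ∑ O_r X^(r+1)). -/
theorem expCoeff_succ [CharZero 𝕜] (O P : ℕ → Z) (hO : ∀ r, O r * O r = 0) (d : ℕ) :
    (d + 1) • expCoeff 𝕜 O P (d + 1) = ∑ p ∈ Finset.HasAntidiagonal.antidiagonal d,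
      (P (p.1 + 1) + (p.1 + 1) • O p.1) * expCoeff 𝕜 O P p.2 := by
  rw [Finset.Nat.sum_antidiagonal_eq_sum_range_succ_mk, expCoeff, Finset.smul_sum]
  trans ∑ Λ ∈ ofTotalDegree (d + 1), ∑ r ∈ Finset.range (d + 1),
    ((((r + 1) * (Λ.sym : Multiset ℕ).count (r + 1) : ℕ) : 𝕜) • (Λ.z : 𝕜)⁻¹ • partProd O P Λ +
      (((r + 1) * if r ∈ Λ.anti then 1 else 0 : ℕ) : 𝕜) • (Λ.z : 𝕜)⁻¹ • partProd O P Λ)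
  · refine Finset.sum_congr rfl fun Λ hΛ => ?_
    simp only [← add_smul, ← Nat.cast_add]
    rw [← Finset.sum_smul, ← Nat.cast_sum, ← totalDegree_eq_sum (mem_ofTotalDegree.1 hΛ),
      Nat.cast_smul_eq_nsmul]
  · rw [Finset.sum_comm]
    refine Finset.sum_congr rfl fun r hr => ?_
    have hr' := Nat.le_of_lt_succ (Finset.mem_range.1 hr)
    rw [Finset.sum_add_distrib, sum_count_smul O P hr', sum_mem_anti_smul O P hO hr', add_mul]

theorem expCoeff_zero (O P : ℕ → Z) : expCoeff 𝕜 O P 0 = 1 := by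
  have h : ofTotalDegree 0 = {⟨[], [], List.Pairwise.nil, List.Pairwise.nil, by simp⟩} := by
    ext Λ
    rw [mem_ofTotalDegree, Finset.mem_singleton]
    constructor
    · intro h
      rw [totalDegree, Nat.add_eq_zero_iff] at h
      have h1 : Λ.anti = [] := List.length_eq_zero_iff.1 h.2
      refine SuperPartition.ext h1 (List.eq_nil_iff_forall_not_mem.2 fun k hk => ?_)
      have h2 := List.single_le_sum (l := Λ.parts) (fun _ _ => Nat.zero_le _) k
        (List.mem_append_right _ hk)
      have h3 : Λ.parts.sum = 0 := h.1
      have := Λ.sym_pos k hk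
      omega
    · rintro rfl
      rfl
  rw [expCoeff, h, Finset.sum_singleton]
  simp [partProd, z]

end Exponential

end SuperPartition

/-! ### Logarithmic derivatives of power series -/

section LogDeriv

variable {Z : Type*} [CommRing Z]

/-- The logarithmic derivative of the power series `F`, with constant term `1`, is `∑ G r X ^ r`. -/
def HasLogDeriv (F : PowerSeries Z) (G : ℕ → Z) : Prop :=
  PowerSeries.coeff 0 F = 1 ∧ PowerSeries.derivative Z F = PowerSeries.mk G * F

theorem hasLogDeriv_iff {F : PowerSeries Z} {G : ℕ → Z} : HasLogDeriv F G ↔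
    PowerSeries.coeff 0 F = 1 ∧ ∀ d, (d + 1) • PowerSeries.coeff (d + 1) F =
      ∑ p ∈ Finset.HasAntidiagonal.antidiagonal d, G p.1 * PowerSeries.coeff p.2 F := by
  unfold HasLogDeriv
  rw [PowerSeries.ext_iff]
  refine and_congr Iff.rfl (forall_congr' fun d => ?_)
  simp only [PowerSeries.coeff_derivative, PowerSeries.coeff_mul, PowerSeries.coeff_mk]
  rw [nsmul_eq_mul, mul_comm, Nat.cast_add, Nat.cast_one]

theorem HasLogDeriv.mul {F F' : PowerSeries Z} {G G' : ℕ → Z} (h : HasLogDeriv F G)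
    (h' : HasLogDeriv F' G') : HasLogDeriv (F * F') fun r => G r + G' r := by
  refine ⟨?_, ?_⟩
  · rw [PowerSeries.coeff_mul, Finset.HasAntidiagonal.antidiagonal_zero, Finset.sum_singleton, h.1, h'.1, one_mul]
  · have e : PowerSeries.mk (fun r => G r + G' r) = PowerSeries.mk G + PowerSeries.mk G' := by
      ext r
      simp
    rw [Derivation.leibniz, h.2, h'.2, e, smul_eq_mul, smul_eq_mul]
    ring

theorem hasLogDeriv_one : HasLogDeriv (1 : PowerSeries Z) fun _ => 0 := by
  rw [hasLogDeriv_iff]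
  refine ⟨by simp, fun d => ?_⟩
  simp [PowerSeries.coeff_one]

theorem hasLogDeriv_prod {ι : Type*} (s : Finset ι) {F : ι → PowerSeries Z} {G : ι → ℕ → Z}
    (h : ∀ i ∈ s, HasLogDeriv (F i) (G i)) :
    HasLogDeriv (∏ i ∈ s, F i) fun r => ∑ i ∈ s, G i r := by
  classical
  induction s using Finset.induction_on with
  | empty => simpa using hasLogDeriv_one
  | insert i s hi ih =>
    simp only [Finset.prod_insert hi, Finset.sum_insert hi]
    exact (h i (Finset.mem_insert_self i s)).mul
      (ih fun j hj => h j (Finset.mem_insert_of_mem hj))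

theorem HasLogDeriv.map {Y : Type*} [CommRing Y] {F : PowerSeries Z} {G : ℕ → Z}
    (h : HasLogDeriv F G) (φ : Z →+* Y) : HasLogDeriv (PowerSeries.map φ F) fun r => φ (G r) := by
  rw [hasLogDeriv_iff] at h ⊢
  refine ⟨by rw [PowerSeries.coeff_map, h.1, map_one], fun d => ?_⟩
  simp only [PowerSeries.coeff_map]
  rw [← map_nsmul, h.2, map_sum]
  simp only [map_mul]

/-- The recursion expresses d + 1 times the next coefficient by earlier ones, and d + 1 is
invertible in characteristic 0. -/
theorem HasLogDeriv.eq {𝕜 : Type*} [Field 𝕜] [CharZero 𝕜] [Algebra 𝕜 Z] {F F' : PowerSeries Z}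
    {G : ℕ → Z} (h : HasLogDeriv F G) (h' : HasLogDeriv F' G) : F = F' := by
  rw [hasLogDeriv_iff] at h h'
  ext d
  induction d using Nat.strong_induction_on with
  | _ d ih =>
    rcases d with _ | d
    · rw [h.1, h'.1]
    · have h1 : (d + 1) • PowerSeries.coeff (d + 1) F = (d + 1) • PowerSeries.coeff (d + 1) F' := by
        rw [h.2, h'.2]
        refine Finset.sum_congr rfl fun p hp => ?_
        rw [Finset.HasAntidiagonal.mem_antidiagonal] at hp
        rw [ih p.2 (by omega)]
      rw [← Nat.cast_smul_eq_nsmul 𝕜, ← Nat.cast_smul_eq_nsmul 𝕜] at h1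
      have h2 : ((d + 1 : ℕ) : 𝕜) ≠ 0 := Nat.cast_ne_zero.2 d.succ_ne_zero
      have h3 := congrArg (fun y => ((d + 1 : ℕ) : 𝕜)⁻¹ • y) h1
      simpa only [smul_smul, inv_mul_cancel₀ h2, one_smul] using h3

theorem hasLogDeriv_geometric (u : Z) :
    HasLogDeriv (PowerSeries.mk fun d => u ^ d) fun r => u ^ (r + 1) := by
  rw [hasLogDeriv_iff]
  refine ⟨by simp, fun d => ?_⟩
  -- All d + 1 terms of the convolution equal u^(d+1).
  rw [Finset.sum_congr rfl fun p hp => ?_, Finset.sum_const, Finset.Nat.card_antidiagonal]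
  rw [Finset.HasAntidiagonal.mem_antidiagonal] at hp
  simp only [PowerSeries.coeff_mk]
  rw [← pow_add, ← hp]
  congr 1
  omega

theorem add_pow_succ_of_mul_self_eq_zero (a : Z) {t : Z} (ht : t * t = 0) (r : ℕ) :
    (a + t) ^ (r + 1) = a ^ (r + 1) + (r + 1) • (a ^ r * t) := by
  induction r with
  | zero => simp
  | succ r ih =>
    rw [pow_succ, ih]
    have : (a ^ (r + 1) + (r + 1) • (a ^ r * t)) * (a + t) =
      a ^ (r + 1 + 1) + (r + 1 + 1) • (a ^ (r + 1) * t) + (r + 1) • (a ^ r * (t * t)) := by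
      simp only [nsmul_eq_mul]
      push_cast
      ring
    rw [this, ht]
    simp

/-- A generating function of complete functions, with values `h d` in the commuting variables and
`S d` linear in the anticommuting ones, from Newton's identities. -/
theorem hasLogDeriv_of_newton (X : Z) (h S P T : ℕ → Z) (h0 : h 0 = 1) (S0 : S 0 = 0)
    (hTS : ∀ r k, T r * S k = 0)
    (hh : ∀ d, (d + 1) • h (d + 1) = ∑ p ∈ Finset.HasAntidiagonal.antidiagonal d,
      P (p.1 + 1) * h p.2)
    (hS : ∀ d, (d + 1) • S (d + 1) = ∑ p ∈ Finset.HasAntidiagonal.antidiagonal d,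
      ((p.1 + 1) • (T p.1 * h p.2) + P (p.1 + 1) * S p.2)) :
    HasLogDeriv (PowerSeries.mk fun d => X ^ (d - 1) * S d + X ^ d * h d) fun r =>
      X ^ (r + 1) * P (r + 1) + (r + 1) • (X ^ r * T r) := by
  rw [hasLogDeriv_iff]
  refine ⟨by simp [h0, S0], fun d => ?_⟩
  simp only [PowerSeries.coeff_mk]
  have e : (d + 1) • (X ^ (d + 1 - 1) * S (d + 1) + X ^ (d + 1) * h (d + 1)) =
      X ^ d * ((d + 1) • S (d + 1)) + X ^ (d + 1) * ((d + 1) • h (d + 1)) := by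
    rw [Nat.add_sub_cancel]
    simp only [nsmul_eq_mul]
    ring
  rw [e, hS, hh, Finset.mul_sum, Finset.mul_sum, ← Finset.sum_add_distrib]
  refine Finset.sum_congr rfl fun p hp => ?_
  rw [Finset.HasAntidiagonal.mem_antidiagonal] at hp
  obtain ⟨r, k⟩ := p
  simp only at hp ⊢
  subst hp
  -- At k = 0 the truncated exponent k - 1 is harmless, since S 0 = 0.
  have e1 : X ^ (r + 1) * (X ^ (k - 1) * S k) = X ^ (r + k) * S k := by
    rcases k with _ | k
    · rw [S0, mul_zero, mul_zero, mul_zero]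
    · rw [Nat.add_sub_cancel]
      ring
  have e2 : (X ^ (r + 1) * P (r + 1) + (r + 1) • (X ^ r * T r)) *
      (X ^ (k - 1) * S k + X ^ k * h k) = P (r + 1) * (X ^ (r + 1) * (X ^ (k - 1) * S k)) +
        X ^ (r + 1) * P (r + 1) * (X ^ k * h k) + ((r + 1) • (X ^ r * T r)) * (X ^ k * h k) +
        (r + 1) • (X ^ r * X ^ (k - 1)) * (T r * S k) := by
    simp only [nsmul_eq_mul]
    ring
  -- The cross term T r * S k carries the same θ twice and vanishes.
  rw [e2, e1, hTS]
  simp only [nsmul_eq_mul]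
  ring

end LogDeriv

/-! ### Truncated power sums -/

section Truncation

variable {σ τ : Type*} [LinearOrder σ] [LinearOrder τ] {R : Type*} [CommRing R]

theorem trunc_embed (e : σ ↪o τ) (V : Set τ) (f : SuperSeries σ R) :
    trunc R V (embed e f) = embed e (trunc R (e ⁻¹' V) f) := by
  have key : ∀ (b : σ →₀ ℕ) (B : Finset σ), Involves V (Finsupp.embDomain e.toEmbedding b)
      (B.map e.toEmbedding) ↔ Involves (e ⁻¹' V) b B := by
    intro b B
    unfold Involves
    rw [Finsupp.support_embDomain]
    simp
  refine trunc_eq_of_forall (fun a A h => ?_) fun a A h => ?_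
  · by_cases h1 : ∃ b B, a = Finsupp.embDomain e.toEmbedding b ∧ A = Finset.map e.toEmbedding B
    · obtain ⟨b, B, rfl, rfl⟩ := h1
      rw [coef_embed_map, coef_embed_map, coef_trunc ((key b B).1 h)]
    · have h2 : ∀ g : SuperSeries σ R, coef a A (embed e g) = 0 := by
        intro g
        by_contra h3
        obtain ⟨b, B, hb, hB, -⟩ := exists_of_coef_embed_ne_zero h3
        exact h1 ⟨b, B, hb, hB⟩
      rw [h2, h2]
  · obtain ⟨b, B, rfl, rfl, h1⟩ := exists_of_coef_embed_ne_zero h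
    rw [key]
    by_contra h2
    exact h1 (coef_trunc_eq_zero h2 f)

theorem trunc_univ (f : SuperSeries σ R) : trunc R Set.univ f = f :=
  superSeries_ext fun _ _ => coef_trunc ⟨fun _ _ => trivial, fun _ _ => trivial⟩ f

theorem trunc_powerSum (n : ℕ) {r : ℕ} (hr : 0 < r) :
    trunc R (Set.Iio n) (powerSum R r) = ∑ i ∈ Finset.range n, bosonic R i ^ r := by
  refine trunc_eq_of_forall (fun a A h => coef_powerSum_eq_sum hr (fun i hi => ?_) A)
    fun a A h => ?_
  · exact Finset.mem_range.2 (h.1 i hi)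
  · rw [coef_sum] at h
    obtain ⟨i, hi, h1⟩ := Finset.exists_ne_zero_of_sum_ne_zero h
    rw [coef_bosonic_pow] at h1
    obtain ⟨rfl, rfl⟩ : a = Finsupp.single i r ∧ A = ∅ := by
      by_contra h2
      exact h1 (if_neg h2)
    refine ⟨fun j hj => ?_, by simp⟩
    have := Finsupp.support_single_subset hj
    rw [Finset.mem_singleton] at this
    rw [this]
    exact Finset.mem_range.1 hi

theorem trunc_powerSumTilde (n r : ℕ) : trunc R (Set.Iio n) (powerSumTilde R r) =
    ∑ i ∈ Finset.range n, fermionic R i * bosonic R i ^ r := by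
  refine trunc_eq_of_forall (fun a A h => coef_powerSumTilde_eq_sum r a fun i hi => ?_)
    fun a A h => ?_
  · exact Finset.mem_range.2 (h.2 i hi)
  · rw [coef_sum] at h
    obtain ⟨i, hi, h1⟩ := Finset.exists_ne_zero_of_sum_ne_zero h
    rw [coef_fermionic_mul_bosonic_pow] at h1
    obtain ⟨rfl, rfl⟩ : a = Finsupp.single i r ∧ A = {i} := by
      by_contra h2
      exact h1 (if_neg h2)
    refine ⟨fun j hj => ?_, fun j hj => ?_⟩
    · have := Finsupp.support_single_subset hj
      rw [Finset.mem_singleton] at this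
      rw [this]
      exact Finset.mem_range.1 hi
    · rw [Finset.mem_singleton.1 hj]
      exact Finset.mem_range.1 hi

end Truncation

/-! ### Generating series of the complete functions -/

section Generating

variable (R : Type*) [CommRing R]

/-- The even series in the double alphabet. -/
abbrev EvenSeries : Type _ := evenSubalgebra (ℕ ⊕ₗ ℕ) R

variable {R}

variable (R) in
/-- The inclusion of the even series. -/
noncomputable def evenVal : EvenSeries R →+* SuperSeries (ℕ ⊕ₗ ℕ) R where
  toFun f := f
  map_one' := rfl
  map_mul' _ _ := rfl
  map_zero' := rfl
  map_add' _ _ := rfl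

theorem evenVal_injective : Function.Injective (evenVal R) := Subtype.val_injective

/-- The copy of `f` in the left alphabet. -/
noncomputable def evenLeft (f : SuperSeries ℕ R) (hf : HasSector 0 f) : EvenSeries R :=
  ⟨embed left f, (hf.embed left).hasParity⟩

/-- The copy of `f` in the right alphabet. -/
noncomputable def evenRight (f : SuperSeries ℕ R) (hf : HasSector 0 f) : EvenSeries R :=
  ⟨embed right f, (hf.embed right).hasParity⟩

theorem evenVal_evenLeft (f : SuperSeries ℕ R) (hf : HasSector 0 f) :
    evenVal R (evenLeft f hf) = embedHom R left f := rfl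

theorem evenVal_evenRight (f : SuperSeries ℕ R) (hf : HasSector 0 f) :
    evenVal R (evenRight f hf) = embedHom R right f := rfl

/-- The product of the copies of `f` in the left and of `g` in the right alphabet. -/
noncomputable def evenPair (f g : SuperSeries ℕ R) (hf : HasSector 1 f) (hg : HasSector 1 g) :
    EvenSeries R :=
  ⟨embed left f * embed right g, ((hf.embed left).mul (hg.embed right)).hasParity⟩

theorem evenVal_evenPair (f g : SuperSeries ℕ R) (hf : HasSector 1 f) (hg : HasSector 1 g) :
    evenVal R (evenPair f g hf hg) = embedHom R left f * embedHom R right g := rfl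

/-- An odd series anticommutes with itself, and 2 is invertible. -/
theorem mul_self_eq_zero_of_odd {𝕜 σ : Type*} [LinearOrder σ] [Field 𝕜] [CharZero 𝕜]
    {f : SuperSeries σ 𝕜} (hf : HasParity 1 f) : f * f = 0 := by
  refine superSeries_ext fun a A => ?_
  have h := congrArg (coef a A) (mul_anticomm_of_odd hf hf)
  rw [coef_neg] at h
  rw [coef_zero]
  exact self_eq_neg.1 h

/-- Bring the two copies of f together at the cost of a sign. -/
theorem evenPair_mul_evenPair_of_left {f g g' : SuperSeries ℕ R} (hf : HasSector 1 f)
    (hg : HasSector 1 g) (hg' : HasSector 1 g') (h : f * f = 0) :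
    evenPair f g hf hg * evenPair f g' hf hg' = 0 := by
  refine Subtype.ext ?_
  change embed left f * embed right g * (embed left f * embed right g') = 0
  have h1 : embed right g * embed left f = -(embed left f * embed right g) :=
    mul_anticomm_of_odd (hg.embed right).hasParity (hf.embed left).hasParity
  rw [mul_assoc, ← mul_assoc (embed right g), h1, neg_mul, mul_assoc, mul_neg, ← mul_assoc,
    ← embed_mul, h, embed_zero, zero_mul, neg_zero]

theorem evenPair_mul_evenPair_of_right {f f' g : SuperSeries ℕ R} (hf : HasSector 1 f)
    (hf' : HasSector 1 f') (hg : HasSector 1 g) (h : g * g = 0) :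
    evenPair f g hf hg * evenPair f' g hf' hg = 0 := by
  refine Subtype.ext ?_
  change embed left f * embed right g * (embed left f' * embed right g) = 0
  have h1 : embed right g * embed left f' = -(embed left f' * embed right g) :=
    mul_anticomm_of_odd (hg.embed right).hasParity (hf'.embed left).hasParity
  rw [mul_assoc, ← mul_assoc (embed right g), h1, neg_mul, mul_assoc, ← embed_mul, h, embed_zero,
    mul_zero, neg_zero, mul_zero]

variable (R) in
/-- The product of the bosonic power sums in the two alphabets. -/
noncomputable def powerSumPair (r : ℕ) : EvenSeries R :=
  evenLeft (powerSum R r) (hasSector_powerSum r) * evenRight (powerSum R r) (hasSector_powerSum r)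

variable (R) in
/-- The product of the fermionic power sums in the two alphabets. -/
noncomputable def powerSumTildePair (r : ℕ) : EvenSeries R :=
  evenPair (powerSumTilde R r) (powerSumTilde R r) (hasSector_powerSumTilde r)
    (hasSector_powerSumTilde r)

variable (R) in
/-- The generating series `∑ x_i ^ d h_d + x_i ^ (d - 1) θ_i h̃_(d - 1)` of complete functions in the
right alphabet. -/
noncomputable def completeSeries (i : ℕ) : PowerSeries (EvenSeries R) :=
  PowerSeries.mk fun d =>
    evenLeft (bosonic R i) (hasSector_bosonic i) ^ (d - 1) *
      evenPair (fermionic R i) (completeTildePred R d) (hasSector_fermionic i)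
        (hasSector_completeTildePred d) +
    evenLeft (bosonic R i) (hasSector_bosonic i) ^ d *
      evenRight (complete R d) (hasSector_complete d)

/-- Newton's identities for h and h̃, the second multiplied on the left by θ_i so that every term is
even. -/
theorem hasLogDeriv_completeSeries (i : ℕ) : HasLogDeriv (completeSeries R i) fun r =>
    evenLeft (bosonic R i) (hasSector_bosonic i) ^ (r + 1) *
      evenRight (powerSum R (r + 1)) (hasSector_powerSum (r + 1)) +
    (r + 1) • (evenLeft (bosonic R i) (hasSector_bosonic i) ^ r *
      evenPair (fermionic R i) (powerSumTilde R r) (hasSector_fermionic i)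
        (hasSector_powerSumTilde r)) := by
  refine hasLogDeriv_of_newton _ (fun d => evenRight (complete R d) (hasSector_complete d))
    (fun d => evenPair (fermionic R i) (completeTildePred R d) (hasSector_fermionic i)
      (hasSector_completeTildePred d))
    (fun r => evenRight (powerSum R r) (hasSector_powerSum r))
    (fun r => evenPair (fermionic R i) (powerSumTilde R r) (hasSector_fermionic i)
        (hasSector_powerSumTilde r)) ?_ ?_ ?_ ?_ ?_
  · refine evenVal_injective ?_
    rw [evenVal_evenRight, complete_zero, map_one, map_one]
  · refine evenVal_injective ?_
    rw [evenVal_evenPair, completeTildePred, map_zero, mul_zero, map_zero]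
  · exact fun r k => evenPair_mul_evenPair_of_left _ _ _ (fermionic_mul_self i)
  · intro d
    refine evenVal_injective ?_
    simp only [map_nsmul, map_sum, map_mul, evenVal_evenRight]
    rw [← map_nsmul, newton_complete, map_sum]
    simp only [map_mul]
  · intro d
    refine evenVal_injective ?_
    simp only [map_nsmul, map_sum, map_add, map_mul, evenVal_evenRight, evenVal_evenPair]
    rw [completeTildePred, ← mul_smul_comm, ← map_nsmul, newton_completeTilde, map_sum,
      Finset.mul_sum]
    refine Finset.sum_congr rfl fun p _ => ?_
    rw [map_add, map_mul, map_nsmul, map_mul, mul_add, mul_smul_comm, mul_assoc]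
    congr 1
    have h : embedHom R right (powerSum R (p.1 + 1)) * embedHom R left (fermionic R i) =
        embedHom R left (fermionic R i) * embedHom R right (powerSum R (p.1 + 1)) :=
      mul_comm_of_even (((hasSector_powerSum (R := R) (p.1 + 1)).embed right).hasParity)
        ((hasSector_fermionic (R := R) i).embed left).hasParity
    rw [← mul_assoc, ← mul_assoc, h]

end Generating

/-! ### Three forms of the kernel series -/

section Kernel

variable {R : Type*} [CommRing R]

theorem hasSector_bosonic_pow {σ : Type*} [LinearOrder σ] (i : σ) (n : ℕ) :
    HasSector 0 (bosonic R i ^ n) := by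
  intro a A h
  rw [coef_bosonic_pow] at h
  have : A = ∅ := by
    by_contra h1
    simp [h1] at h
  simp [this]

theorem bosonic_pow_mul_fermionic {σ : Type*} [LinearOrder σ] (i j : σ) (n : ℕ) :
    bosonic R i ^ n * fermionic R j = fermionic R j * bosonic R i ^ n :=
  mul_comm_of_even (hasSector_bosonic_pow i n).hasParity (hasSector_fermionic j).hasParity

theorem embedHom_pow_mul_fermionic {σ τ : Type*} [LinearOrder σ] [LinearOrder τ] (e : σ ↪o τ)
    (i : σ) (n : ℕ) : embedHom R e (bosonic R i) ^ n * embedHom R e (fermionic R i) =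
      embedHom R e (fermionic R i) * embedHom R e (bosonic R i) ^ n := by
  rw [← map_pow, ← map_mul, bosonic_pow_mul_fermionic, map_mul]

theorem evenVal_evenTrunc (V : Set (ℕ ⊕ₗ ℕ)) (f : EvenSeries R) :
    evenVal R (evenTrunc R V f) = trunc R V (evenVal R f) := rfl

/-- The first `n` indices of the left alphabet, and all those of the right one. -/
def leftBox (n : ℕ) : Set (ℕ ⊕ₗ ℕ) := {k | ∀ i, k = left i → i < n}

/-- The first `n` indices of both alphabets. -/
def box (n : ℕ) : Set (ℕ ⊕ₗ ℕ) := {k | (∀ i, k = left i → i < n) ∧ ∀ j, k = right j → j < n}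

theorem left_mem_box {n i : ℕ} : left i ∈ box n ↔ i < n := by
  refine ⟨fun h => h.1 i rfl, fun h => ⟨fun j hj => ?_, fun j hj => (left_ne_right i j hj).elim⟩⟩
  rwa [← left.injective hj]

theorem right_mem_box {n j : ℕ} : right j ∈ box n ↔ j < n := by
  refine ⟨fun h => h.2 j rfl, fun h => ⟨fun i hi => (left_ne_right i j hi.symm).elim, fun i hi => ?_⟩⟩
  rwa [← right.injective hi]

theorem left_mem_leftBox {n i : ℕ} : left i ∈ leftBox n ↔ i < n := by
  refine ⟨fun h => h i rfl, fun h j hj => ?_⟩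
  rwa [← left.injective hj]

theorem right_mem_leftBox (n j : ℕ) : right j ∈ leftBox n :=
  fun i hi => (left_ne_right i j hi.symm).elim

theorem trunc_leftBox_left (n : ℕ) (f : SuperSeries ℕ R) :
    trunc R (leftBox n) (embedHom R left f) = embedHom R left (trunc R (Set.Iio n) f) := by
  have : left ⁻¹' leftBox n = Set.Iio n := Set.ext fun i => left_mem_leftBox
  rw [embedHom_apply, trunc_embed, this]
  rfl

theorem trunc_leftBox_right (n : ℕ) (f : SuperSeries ℕ R) :
    trunc R (leftBox n) (embedHom R right f) = embedHom R right f := by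
  have : right ⁻¹' leftBox n = Set.univ := Set.eq_univ_of_forall fun j => right_mem_leftBox n j
  rw [embedHom_apply, trunc_embed, this, trunc_univ]

theorem trunc_box_left (n : ℕ) (f : SuperSeries ℕ R) :
    trunc R (box n) (embedHom R left f) = embedHom R left (trunc R (Set.Iio n) f) := by
  have : left ⁻¹' box n = Set.Iio n := Set.ext fun i => left_mem_box
  rw [embedHom_apply, trunc_embed, this]
  rfl

theorem trunc_box_right (n : ℕ) (f : SuperSeries ℕ R) :
    trunc R (box n) (embedHom R right f) = embedHom R right (trunc R (Set.Iio n) f) := by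
  have : right ⁻¹' box n = Set.Iio n := Set.ext fun i => right_mem_box
  rw [embedHom_apply, trunc_embed, this]
  rfl

variable (R) in
/-- The series `x_i y_j + θ_i φ_j`. -/
noncomputable def pairing (q : ℕ × ℕ) : EvenSeries R :=
  evenLeft (bosonic R q.1) (hasSector_bosonic q.1) *
    evenRight (bosonic R q.2) (hasSector_bosonic q.2) +
  evenPair (fermionic R q.1) (fermionic R q.2) (hasSector_fermionic q.1) (hasSector_fermionic q.2)

variable (R) in
/-- The geometric series of `x_i y_j + θ_i φ_j`. -/
noncomputable def pairingSeries (q : ℕ × ℕ) : PowerSeries (EvenSeries R) :=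
  PowerSeries.mk fun d => pairing R q ^ d

/-- A geometric series in u has logarithmic derivative ∑ u^(r+1) X^r; the binomial expansion of u =
xy + θφ stops after the term linear in θφ. -/
theorem hasLogDeriv_pairingSeries (q : ℕ × ℕ) : HasLogDeriv (pairingSeries R q) fun r =>
    evenLeft (bosonic R q.1) (hasSector_bosonic q.1) ^ (r + 1) *
      evenRight (bosonic R q.2) (hasSector_bosonic q.2) ^ (r + 1) +
    (r + 1) • (evenLeft (bosonic R q.1) (hasSector_bosonic q.1) ^ r *
      evenRight (bosonic R q.2) (hasSector_bosonic q.2) ^ r *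
      evenPair (fermionic R q.1) (fermionic R q.2) (hasSector_fermionic q.1)
        (hasSector_fermionic q.2)) := by
  have h := hasLogDeriv_geometric (pairing R q)
  unfold pairing at h
  simp only [add_pow_succ_of_mul_self_eq_zero _ (evenPair_mul_evenPair_of_left _ _ _
    (fermionic_mul_self (R := R) q.1)), mul_pow] at h
  exact h

section Field

variable (𝕜 : Type*) [Field 𝕜] [CharZero 𝕜]

/-- The generating series `∑ z_Λ⁻¹ p_Λ(x, θ) p_Λ(y, φ)`, up to signs. -/
noncomputable def kernelSeries : PowerSeries (EvenSeries 𝕜) :=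
  PowerSeries.mk (SuperPartition.expCoeff 𝕜 (powerSumTildePair 𝕜) (powerSumPair 𝕜))

theorem powerSumTildePair_mul_self (r : ℕ) :
    powerSumTildePair 𝕜 r * powerSumTildePair 𝕜 r = 0 :=
  evenPair_mul_evenPair_of_left _ _ _ (mul_self_eq_zero_of_odd (hasSector_powerSumTilde r).hasParity)

theorem hasLogDeriv_kernelSeries : HasLogDeriv (kernelSeries 𝕜) fun r =>
    powerSumPair 𝕜 (r + 1) + (r + 1) • powerSumTildePair 𝕜 r := by
  rw [hasLogDeriv_iff]
  simp only [kernelSeries, PowerSeries.coeff_mk]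
  exact ⟨SuperPartition.expCoeff_zero _ _,
    SuperPartition.expCoeff_succ _ _ (powerSumTildePair_mul_self 𝕜)⟩

/-- Equal logarithmic derivatives: after truncation the left power sums are finite sums over i < n,
one summand for each factor. -/
theorem map_evenTrunc_leftBox_kernelSeries (n : ℕ) :
    PowerSeries.map (evenTrunc 𝕜 (leftBox n)) (kernelSeries 𝕜) =
      ∏ i ∈ Finset.range n, completeSeries 𝕜 i := by
  refine ((hasLogDeriv_kernelSeries 𝕜).map (evenTrunc 𝕜 (leftBox n))).eq (𝕜 := 𝕜) ?_
  convert hasLogDeriv_prod (Finset.range n) fun i _ => hasLogDeriv_completeSeries (R := 𝕜) i using 1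
  funext r
  refine evenVal_injective ?_
  simp only [powerSumPair, powerSumTildePair, map_add, map_mul, map_nsmul, map_sum, map_pow,
    evenVal_evenTrunc, evenVal_evenLeft, evenVal_evenRight, evenVal_evenPair, trunc_leftBox_left,
    trunc_leftBox_right, trunc_powerSum n (Nat.succ_pos _), trunc_powerSumTilde]
  rw [Finset.sum_mul, Finset.sum_mul, Finset.smul_sum, ← Finset.sum_add_distrib]
  refine Finset.sum_congr rfl fun i _ => ?_
  rw [← mul_assoc, embedHom_pow_mul_fermionic]

/-- Here both power sums become finite, and their products are sums over the pairs (i, j). -/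
theorem map_evenTrunc_box_kernelSeries (n : ℕ) :
    PowerSeries.map (evenTrunc 𝕜 (box n)) (kernelSeries 𝕜) =
      ∏ q ∈ Finset.range n ×ˢ Finset.range n, pairingSeries 𝕜 q := by
  refine ((hasLogDeriv_kernelSeries 𝕜).map (evenTrunc 𝕜 (box n))).eq (𝕜 := 𝕜) ?_
  convert hasLogDeriv_prod (Finset.range n ×ˢ Finset.range n)
    fun q _ => hasLogDeriv_pairingSeries (R := 𝕜) q using 1
  funext r
  refine evenVal_injective ?_
  simp only [powerSumPair, powerSumTildePair, map_add, map_mul, map_nsmul, map_sum, map_pow,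
    evenVal_evenTrunc, evenVal_evenLeft, evenVal_evenRight, evenVal_evenPair, trunc_box_left,
    trunc_box_right, trunc_powerSum n (Nat.succ_pos _), trunc_powerSumTilde]
  rw [Finset.sum_mul_sum, Finset.sum_mul_sum, ← Finset.sum_product', ← Finset.sum_product',
    Finset.smul_sum, ← Finset.sum_add_distrib]
  refine Finset.sum_congr rfl fun q _ => ?_
  congr 2
  -- Moving θ_i past a power of y_j costs no sign.
  have h : embedHom 𝕜 right (bosonic 𝕜 q.2) ^ r * embedHom 𝕜 left (fermionic 𝕜 q.1) =
      embedHom 𝕜 left (fermionic 𝕜 q.1) * embedHom 𝕜 right (bosonic 𝕜 q.2) ^ r := by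
    rw [← map_pow]
    exact mul_comm_of_even ((hasSector_bosonic_pow q.2 r).embed right).hasParity
      ((hasSector_fermionic q.1).embed left).hasParity
  rw [← embedHom_pow_mul_fermionic, ← embedHom_pow_mul_fermionic]
  simp only [mul_assoc]
  rw [← mul_assoc (embedHom 𝕜 right (bosonic 𝕜 q.2) ^ r) (embedHom 𝕜 left _), h, mul_assoc]

end Field

end Kernel

/-! ### Formal infinite products -/

section FormalProd

variable {σ R ι : Type*} [LinearOrder σ] [CommRing R]

theorem HasFormalProd.unique {f : ι → SuperSeries σ R} {F F' : SuperSeries σ R}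
    (h : HasFormalProd f F) (h' : HasFormalProd f F') : F = F' := by
  classical
  refine superSeries_ext fun a A => ?_
  obtain ⟨S, hS⟩ := h a A
  obtain ⟨S', hS'⟩ := h' a A
  rw [← hS (S ∪ S').toList (Finset.nodup_toList _) fun i hi =>
      Finset.mem_toList.2 (Finset.mem_union_left _ hi),
    hS' (S ∪ S').toList (Finset.nodup_toList _) fun i hi =>
      Finset.mem_toList.2 (Finset.mem_union_right _ hi)]

theorem HasFormalProd.formalProd_eq {f : ι → SuperSeries σ R} {F : SuperSeries σ R}
    (h : HasFormalProd f F) : formalProd f = F := by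
  have h' : ∃ F, HasFormalProd f F := ⟨F, h⟩
  have e : formalProd f = h'.choose := dif_pos h'
  rw [e]
  exact h'.choose_spec.unique h

/-- The series whose homogeneous component of weight `d` is that of the coefficient of `X ^ d`. -/
noncomputable def ofGraded (w : σ → ℕ) (F : PowerSeries (SuperSeries σ R)) : SuperSeries σ R :=
  fun a A => coef a A (PowerSeries.coeff (weight w a A) F)

/-- Without homogeneity of each coefficient, `ofGraded` would discard the terms of the wrong weight.
-/
theorem grading_ofGraded {w : σ → ℕ} {F : PowerSeries (SuperSeries σ R)}
    (h : ∀ d a A, coef a A (PowerSeries.coeff d F) ≠ 0 → weight w a A = d) :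
    grading R w (ofGraded w F) = F := by
  ext d : 1
  rw [coeff_grading]
  refine superSeries_ext fun a A => ?_
  rw [coef_component]
  split_ifs with h1
  · rw [← h1]
    rfl
  · by_contra h2
    exact h1 (h d a A (Ne.symm h2))

end FormalProd

/-! ### The infinite product defining the kernel -/

section Kernel

variable {R : Type*} [CommRing R]

/-- The weight `1` for the indices of the left alphabet and `0` for those of the right one. -/
def leftWeight (k : ℕ ⊕ₗ ℕ) : ℕ := Sum.elim (fun _ => 1) (fun _ => 0) (ofLex k)

theorem leftWeight_left (i : ℕ) : leftWeight (left i) = 1 := rfl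

theorem leftWeight_right (j : ℕ) : leftWeight (right j) = 0 := rfl

theorem weight_leftWeight (b c : ℕ →₀ ℕ) (B C : Finset ℕ) :
    weight leftWeight (biExp b c) (biSet B C) = b.degree + B.card := by
  unfold weight biExp biSet
  rw [Finsupp.sum_add_index' (fun i => zero_mul _) (fun i m n => add_mul _ _ _),
    Finsupp.sum_embDomain, Finsupp.sum_embDomain, Finset.sum_disjUnion, Finset.sum_map,
    Finset.sum_map]
  simp only [RelEmbedding.coe_toEmbedding, leftWeight_left, leftWeight_right, Finsupp.sum, mul_one, mul_zero,
    Finset.sum_const_zero, add_zero, Finset.sum_const, smul_eq_mul]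
  rfl

theorem evenVal_pairing (q : ℕ × ℕ) : evenVal R (pairing R q) =
    bosonic R (left q.1) * bosonic R (right q.2) +
      fermionic R (left q.1) * fermionic R (right q.2) := by
  rw [pairing, map_add, map_mul, evenVal_evenLeft, evenVal_evenRight, evenVal_evenPair,
    embedHom_apply, embedHom_apply, embedHom_apply, embedHom_apply, embed_bosonic, embed_bosonic,
    embed_fermionic, embed_fermionic]

theorem grading_of_weight_eq {σ : Type*} [LinearOrder σ] {w : σ → ℕ} {n : ℕ} {f : SuperSeries σ R}
    (h : ∀ a A, coef a A f ≠ 0 → weight w a A = n) :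
    grading R w f = PowerSeries.C f * PowerSeries.X ^ n := by
  ext d : 1
  rw [coeff_grading, PowerSeries.coeff_C_mul, PowerSeries.coeff_X_pow]
  refine superSeries_ext fun a A => ?_
  rw [coef_component]
  split_ifs with h1 h2 h2
  · rw [mul_one]
  · rw [mul_zero, coef_zero]
    by_contra h3
    exact h2 (h1.symm.trans (h a A h3))
  · rw [mul_one]
    by_contra h3
    exact h1 ((h a A (Ne.symm h3)).trans h2.symm)
  · rw [mul_zero, coef_zero]

theorem weight_of_coef_bosonic_ne_zero {σ : Type*} [LinearOrder σ] {w : σ → ℕ} {i : σ}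
    {a : σ →₀ ℕ} {A : Finset σ} (h : coef a A (bosonic R i) ≠ 0) : weight w a A = w i := by
  rw [coef_bosonic] at h
  obtain ⟨rfl, rfl⟩ : a = Finsupp.single i 1 ∧ A = ∅ := by
    by_contra h2
    exact h (if_neg h2)
  simp [weight]

theorem weight_of_coef_fermionic_ne_zero {σ : Type*} [LinearOrder σ] {w : σ → ℕ} {i : σ}
    {a : σ →₀ ℕ} {A : Finset σ} (h : coef a A (fermionic R i) ≠ 0) : weight w a A = w i := by
  rw [coef_fermionic] at h
  obtain ⟨rfl, rfl⟩ : a = 0 ∧ A = {i} := by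
    by_contra h2
    exact h (if_neg h2)
  simp [weight]

/-- Both x_i y_j and θ_i φ_j have weight 1, so the geometric series of the pairing is graded by its
exponent. -/
theorem grading_evenVal_pairing (q : ℕ × ℕ) : grading R leftWeight (evenVal R (pairing R q)) =
    PowerSeries.map (evenVal R) (PowerSeries.C (pairing R q) * PowerSeries.X) := by
  have h1 := grading_of_weight_eq (R := R) (w := leftWeight) (n := 1) fun a A h =>
    weight_of_coef_bosonic_ne_zero (i := left q.1) h
  have h2 := grading_of_weight_eq (R := R) (w := leftWeight) (n := 0) fun a A h =>
    weight_of_coef_bosonic_ne_zero (i := right q.2) h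
  have h3 := grading_of_weight_eq (R := R) (w := leftWeight) (n := 1) fun a A h =>
    weight_of_coef_fermionic_ne_zero (i := left q.1) h
  have h4 := grading_of_weight_eq (R := R) (w := leftWeight) (n := 0) fun a A h =>
    weight_of_coef_fermionic_ne_zero (i := right q.2) h
  rw [pow_one] at h1 h3
  rw [pow_zero, mul_one] at h2 h4
  have e1 : PowerSeries.map (evenVal R) (PowerSeries.C (pairing R q) * PowerSeries.X) =
      PowerSeries.C (evenVal R (pairing R q)) * PowerSeries.X := by
    rw [map_mul, PowerSeries.map_C, PowerSeries.map_X]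
  have e2 : ∀ f g : SuperSeries (ℕ ⊕ₗ ℕ) R, (PowerSeries.C f * PowerSeries.X) * PowerSeries.C g =
      PowerSeries.C (f * g) * PowerSeries.X := by
    intro f g
    rw [mul_assoc, ← (PowerSeries.commute_X (PowerSeries.C g)).eq, ← mul_assoc, map_mul]
  rw [e1, evenVal_pairing, map_add, map_mul (grading R leftWeight),
    map_mul (grading R leftWeight), h1, h2, h3, h4, e2, e2, ← add_mul, ← map_add]

theorem one_sub_mul_pairingSeries (q : ℕ × ℕ) :
    (1 - PowerSeries.C (pairing R q) * PowerSeries.X) * pairingSeries R q = 1 := by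
  ext d : 1
  rw [sub_mul, one_mul, map_sub, mul_assoc, PowerSeries.coeff_C_mul, PowerSeries.coeff_one]
  rcases d with _ | d
  · simp [pairingSeries]
  · rw [PowerSeries.coeff_succ_X_mul, if_neg d.succ_ne_zero, pairingSeries, PowerSeries.coeff_mk,
      PowerSeries.coeff_mk, pow_succ', sub_self]

theorem kernelDenominator_eq (q : ℕ × ℕ) :
    kernelDenominator R q.1 q.2 = evenVal R (1 - pairing R q) := by
  rw [map_sub, map_one, evenVal_pairing, kernelDenominator, sub_sub]

theorem grading_kernelDenominator (q : ℕ × ℕ) :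
    grading R leftWeight (kernelDenominator R q.1 q.2) =
      PowerSeries.map (evenVal R) (1 - PowerSeries.C (pairing R q) * PowerSeries.X) := by
  rw [kernelDenominator_eq, map_sub, map_sub, map_one, map_one, grading_evenVal_pairing, map_sub,
    map_one]

theorem weight_of_coef_pairing_pow_ne_zero {q : ℕ × ℕ} {d : ℕ} {a : (ℕ ⊕ₗ ℕ) →₀ ℕ}
    {A : Finset (ℕ ⊕ₗ ℕ)} (h : coef a A (evenVal R (pairing R q ^ d)) ≠ 0) :
    weight leftWeight a A = d := by
  by_contra h1
  rw [← coef_coeff_grading leftWeight, map_pow, map_pow, grading_evenVal_pairing, ← map_pow,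
    PowerSeries.coeff_map, mul_pow, ← map_pow, PowerSeries.coeff_C_mul, PowerSeries.coeff_X_pow,
    if_neg h1, mul_zero, map_zero] at h
  exact h rfl

/-- The inverse of `1 - x_i y_j - θ_i φ_j`. -/
noncomputable def kernelUnit (R : Type*) [CommRing R] (q : ℕ × ℕ) : (SuperSeries (ℕ ⊕ₗ ℕ) R)ˣ where
  val := kernelDenominator R q.1 q.2
  inv := ofGraded leftWeight (PowerSeries.map (evenVal R) (pairingSeries R q))
  val_inv := by
    refine grading_injective leftWeight ?_
    rw [map_mul, grading_kernelDenominator, grading_ofGraded, ← map_mul,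
      one_sub_mul_pairingSeries, map_one, map_one]
    intro d a A h
    rw [PowerSeries.coeff_map, pairingSeries, PowerSeries.coeff_mk] at h
    exact weight_of_coef_pairing_pow_ne_zero h
  inv_val := by
    refine grading_injective leftWeight ?_
    rw [map_mul, grading_kernelDenominator, grading_ofGraded, ← map_mul, mul_comm,
      one_sub_mul_pairingSeries, map_one, map_one]
    intro d a A h
    rw [PowerSeries.coeff_map, pairingSeries, PowerSeries.coeff_mk] at h
    exact weight_of_coef_pairing_pow_ne_zero h

theorem isUnit_kernelDenominator (i j : ℕ) : IsUnit (kernelDenominator R i j) :=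
  ⟨kernelUnit R (i, j), rfl⟩

theorem grading_kernelFactor (q : ℕ × ℕ) : grading R leftWeight (kernelFactor R q) =
    PowerSeries.map (evenVal R) (pairingSeries R q) := by
  have h : kernelFactor R q =
      ofGraded leftWeight (PowerSeries.map (evenVal R) (pairingSeries R q)) :=
    Ring.inverse_unit (kernelUnit R q)
  rw [h, grading_ofGraded]
  intro d a A h
  rw [PowerSeries.coeff_map, pairingSeries, PowerSeries.coeff_mk] at h
  exact weight_of_coef_pairing_pow_ne_zero h

/-- The graded factors are even and commute, so neither the order of the list nor any sign matters.
-/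
theorem coef_list_prod_kernelFactor {l : List (ℕ × ℕ)} (hl : l.Nodup) (a : (ℕ ⊕ₗ ℕ) →₀ ℕ)
    (A : Finset (ℕ ⊕ₗ ℕ)) : coef a A (l.map (kernelFactor R)).prod =
      coef a A (evenVal R (PowerSeries.coeff (weight leftWeight a A)
        (∏ q ∈ l.toFinset, pairingSeries R q))) := by
  have h : grading R leftWeight (l.map (kernelFactor R)).prod =
      PowerSeries.map (evenVal R) (∏ q ∈ l.toFinset, pairingSeries R q) := by
    rw [map_list_prod, List.map_map, List.prod_toFinset _ hl, map_list_prod, List.map_map]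
    congr 1
    exact List.map_congr_left fun q _ => grading_kernelFactor q
  rw [← coef_coeff_grading leftWeight, h, PowerSeries.coeff_map]

theorem evenTrunc_pairing_eq_zero {n : ℕ} {q : ℕ × ℕ}
    (hq : q ∉ Finset.range n ×ˢ Finset.range n) : evenTrunc R (box n) (pairing R q) = 0 := by
  refine evenVal_injective ?_
  rw [evenVal_evenTrunc, evenVal_pairing, map_add, map_mul, map_mul, map_zero]
  by_cases h1 : q.1 < n
  · have h2 : right q.2 ∉ box n := by
      rw [right_mem_box]
      intro h2
      exact hq (Finset.mem_product.2 ⟨Finset.mem_range.2 h1, Finset.mem_range.2 h2⟩)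
    rw [trunc_bosonic_of_notMem h2, trunc_fermionic_of_notMem h2, mul_zero, mul_zero, add_zero]
  · have h2 : left q.1 ∉ box n := by rwa [left_mem_box]
    rw [trunc_bosonic_of_notMem h2, trunc_fermionic_of_notMem h2, zero_mul, zero_mul, add_zero]

theorem map_evenTrunc_pairingSeries_eq_one {n : ℕ} {q : ℕ × ℕ}
    (hq : q ∉ Finset.range n ×ˢ Finset.range n) :
    PowerSeries.map (evenTrunc R (box n)) (pairingSeries R q) = 1 := by
  ext d : 1
  rw [PowerSeries.coeff_map, pairingSeries, PowerSeries.coeff_mk, map_pow,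
    evenTrunc_pairing_eq_zero hq, PowerSeries.coeff_one, zero_pow_eq]

theorem exists_involves_box (a : (ℕ ⊕ₗ ℕ) →₀ ℕ) (A : Finset (ℕ ⊕ₗ ℕ)) :
    ∃ n, Involves (box n) a A := by
  have hmem : ∀ k : ℕ ⊕ₗ ℕ, ∃ n, ∀ m, n ≤ m → k ∈ box m := by
    intro k
    rcases left_or_right k with ⟨i, rfl⟩ | ⟨i, rfl⟩
    · exact ⟨i + 1, fun m hm => left_mem_box.2 hm⟩
    · exact ⟨i + 1, fun m hm => right_mem_box.2 hm⟩
  choose N hN using hmem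
  exact ⟨a.support.sup N + A.sup N, fun k hk => hN k _ ((Finset.le_sup hk).trans le_self_add),
    fun k hk => hN k _ ((Finset.le_sup hk).trans le_add_self)⟩

variable (𝕜 : Type*) [Field 𝕜] [CharZero 𝕜]

/-- A monomial involves only indices below some n. Setting the other variables to 0 does not change
its coefficient, turns the factors outside the n × n square into 1, and identifies the remaining
product with the truncated kernel series. -/
theorem hasFormalProd_kernelFactor : HasFormalProd (kernelFactor 𝕜)
    (ofGraded leftWeight (PowerSeries.map (evenVal 𝕜) (kernelSeries 𝕜))) := by
  intro a A
  obtain ⟨n, hn⟩ := exists_involves_box a A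
  refine ⟨Finset.range n ×ˢ Finset.range n, fun l hl hS => ?_⟩
  have key : ∀ F : PowerSeries (EvenSeries 𝕜),
      coef a A (evenVal 𝕜 (PowerSeries.coeff (weight leftWeight a A) F)) =
        coef a A (evenVal 𝕜 (PowerSeries.coeff (weight leftWeight a A)
          (PowerSeries.map (evenTrunc 𝕜 (box n)) F))) := by
    intro F
    rw [PowerSeries.coeff_map, evenVal_evenTrunc, coef_trunc hn]
  rw [coef_list_prod_kernelFactor hl, key, map_prod,
    ← Finset.prod_subset (s₁ := Finset.range n ×ˢ Finset.range n)
      (fun q hq => List.mem_toFinset.2 (hS q hq))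
      (fun q _ hq => map_evenTrunc_pairingSeries_eq_one hq), ← map_prod, ← key,
    ← map_evenTrunc_box_kernelSeries, ← key, ← PowerSeries.coeff_map]
  rfl

theorem kernel_eq :
    kernel 𝕜 = ofGraded leftWeight (PowerSeries.map (evenVal 𝕜) (kernelSeries 𝕜)) :=
  (hasFormalProd_kernelFactor 𝕜).formalProd_eq

theorem hasFormalProd_kernel : HasFormalProd (kernelFactor 𝕜) (kernel 𝕜) := by
  rw [kernel_eq]
  exact hasFormalProd_kernelFactor 𝕜

/-- Only the left alphabet is truncated, so that the complete functions of (y, φ) stay intact. -/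
theorem coef_kernel {n : ℕ} {b : ℕ →₀ ℕ} {B : Finset ℕ} (hb : ∀ i ∈ b.support, i < n)
    (hB : ∀ i ∈ B, i < n) (c : ℕ →₀ ℕ) (C : Finset ℕ) :
    coef (biExp b c) (biSet B C) (kernel 𝕜) =
      coef (biExp b c) (biSet B C) (evenVal 𝕜 (PowerSeries.coeff (b.degree + B.card)
        (∏ i ∈ Finset.range n, completeSeries 𝕜 i))) := by
  have hn : Involves (leftBox n) (biExp b c) (biSet B C) := by
    refine ⟨fun k hk => ?_, fun k hk => ?_⟩
    · rcases left_or_right k with ⟨i, rfl⟩ | ⟨i, rfl⟩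
      · rw [Finsupp.mem_support_iff, biExp_left, ← Finsupp.mem_support_iff] at hk
        exact left_mem_leftBox.2 (hb i hk)
      · exact right_mem_leftBox n i
    · rcases left_or_right k with ⟨i, rfl⟩ | ⟨i, rfl⟩
      · exact left_mem_leftBox.2 (hB i (left_mem_biSet.1 hk))
      · exact right_mem_leftBox n i
  rw [← map_evenTrunc_leftBox_kernelSeries, PowerSeries.coeff_map, evenVal_evenTrunc,
    coef_trunc hn, kernel_eq, ← PowerSeries.coeff_map, ← weight_leftWeight b c B C]
  rfl

end Kernel

/-! ### Expanding the product of the complete generating series -/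

section Expansion

variable {R : Type*} [CommRing R]

theorem prod_map_fermionic_mul_bosonic_pow {l : List ℕ} (hl : l.Nodup) (e : ℕ → ℕ) :
    (l.map fun i => fermionic R i * bosonic R i ^ e i).prod =
      MvPowerSeries.monomial (∑ i ∈ l.toFinset, Finsupp.single i (e i))
        (Grassmann.thetaProd R l) := by
  rw [List.sum_toFinset _ hl]
  clear hl
  induction l with
  | nil => rfl
  | cons i l ih =>
    rw [List.map_cons, List.prod_cons, ih, fermionic_mul_bosonic_pow,
      MvPowerSeries.monomial_mul_monomial, Grassmann.thetaProd_cons, List.map_cons, List.sum_cons]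

theorem prod_map_bosonic_pow {l : List ℕ} (hl : l.Nodup) (e : ℕ → ℕ) :
    (l.map fun i => bosonic R i ^ e i).prod =
      MvPowerSeries.monomial (∑ i ∈ l.toFinset, Finsupp.single i (e i)) 1 := by
  rw [List.sum_toFinset _ hl]
  clear hl
  induction l with
  | nil => rfl
  | cons i l ih =>
    rw [List.map_cons, List.prod_cons, ih, bosonic_pow, MvPowerSeries.monomial_mul_monomial,
      one_mul, List.map_cons, List.sum_cons]

variable (R) in
/-- The product of the `x_i ^ e_i θ_i h̃_(e_i)` for `i ∈ t` and the `x_i ^ e_i h_(e_i)` for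
`i ∈ u`. -/
noncomputable def completeTerm (e : ℕ → ℕ) (t u : Finset ℕ) : EvenSeries R :=
  (∏ i ∈ t, evenLeft (bosonic R i) (hasSector_bosonic i) ^ e i *
    evenPair (fermionic R i) (completeTilde R (e i)) (hasSector_fermionic i)
      (hasSector_completeTilde (e i))) *
  ∏ i ∈ u, evenLeft (bosonic R i) (hasSector_bosonic i) ^ e i *
    evenRight (complete R (e i)) (hasSector_complete (e i))

/-- The sign comes from separating θ_i x_i^(e_i) from h̃_(e_i) for i in l₁. The factors from l₂ are
even and move freely. -/
theorem evenVal_completeTerm {l₁ l₂ : List ℕ} (h₁ : l₁.Nodup) (h₂ : l₂.Nodup) (e : ℕ → ℕ) :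
    evenVal R (completeTerm R e l₁.toFinset l₂.toFinset) = (-1) ^ l₁.length.choose 2 *
      (embed left (MvPowerSeries.monomial
          (∑ i ∈ l₁.toFinset, Finsupp.single i (e i) + ∑ i ∈ l₂.toFinset, Finsupp.single i (e i))
          (Grassmann.thetaProd R l₁)) *
        embed right ((l₁.map fun i => completeTilde R (e i)).prod *
          (l₂.map fun i => complete R (e i)).prod)) := by
  have e1 : evenVal R (∏ i ∈ l₁.toFinset, evenLeft (bosonic R i) (hasSector_bosonic i) ^ e i *
      evenPair (fermionic R i) (completeTilde R (e i)) (hasSector_fermionic i)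
        (hasSector_completeTilde (e i))) = (-1) ^ l₁.length.choose 2 *
      (embedHom R left (l₁.map fun i => fermionic R i * bosonic R i ^ e i).prod *
        embedHom R right (l₁.map fun i => completeTilde R (e i)).prod) := by
    rw [List.prod_toFinset _ h₁, map_list_prod, List.map_map, map_list_prod, List.map_map,
      map_list_prod, List.map_map, ← List.prod_map_mul_of_anticomm]
    · congr 1
      refine List.map_congr_left fun i _ => ?_
      simp only [Function.comp_apply, map_mul, map_pow, evenVal_evenLeft, evenVal_evenPair]
      rw [← mul_assoc, embedHom_pow_mul_fermionic]
    · intro i _ j _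
      refine mul_anticomm_of_odd ((hasSector_completeTilde (e i)).embed right).hasParity ?_
      exact (((hasSector_fermionic j).mul (hasSector_bosonic_pow j (e j))).embed left).hasParity
  have e2 : evenVal R (∏ i ∈ l₂.toFinset, evenLeft (bosonic R i) (hasSector_bosonic i) ^ e i *
      evenRight (complete R (e i)) (hasSector_complete (e i))) =
      embedHom R left (l₂.map fun i => bosonic R i ^ e i).prod *
        embedHom R right (l₂.map fun i => complete R (e i)).prod := by
    rw [Finset.prod_mul_distrib, map_mul, List.prod_toFinset _ h₂, List.prod_toFinset _ h₂]
    simp only [map_list_prod, List.map_map]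
    congr 2
    refine List.map_congr_left fun i _ => ?_
    simp only [Function.comp_apply, map_pow, evenVal_evenLeft]
  have hc : embedHom R right (l₁.map fun i => completeTilde R (e i)).prod *
      embedHom R left (MvPowerSeries.monomial (∑ i ∈ l₂.toFinset, Finsupp.single i (e i)) 1) =
      embedHom R left (MvPowerSeries.monomial (∑ i ∈ l₂.toFinset, Finsupp.single i (e i)) 1) *
        embedHom R right (l₁.map fun i => completeTilde R (e i)).prod := by
    symm
    refine mul_comm_of_even (p := 1 * (l₁.map fun i => completeTilde R (e i)).length) ?_ ?_
    · rw [← prod_map_bosonic_pow h₂]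
      have h := hasSector_list_prod (l₂.map fun i => bosonic R i ^ e i) 0 (by
        intro f hf
        obtain ⟨i, -, rfl⟩ := List.mem_map.1 hf
        exact hasSector_bosonic_pow i (e i))
      rw [zero_mul] at h
      exact (h.embed left).hasParity
    · refine HasSector.hasParity (HasSector.embed (hasSector_list_prod _ 1 ?_) right)
      intro f hf
      obtain ⟨i, -, rfl⟩ := List.mem_map.1 hf
      exact hasSector_completeTilde (e i)
  rw [completeTerm, map_mul, e1, e2, prod_map_fermionic_mul_bosonic_pow h₁,
    prod_map_bosonic_pow h₂, mul_assoc, mul_assoc, ← mul_assoc (embedHom R right _), hc,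
    mul_assoc, ← mul_assoc (embedHom R left _), ← map_mul, ← map_mul,
    MvPowerSeries.monomial_mul_monomial, mul_one]
  rfl

theorem coef_completeTerm {l₁ l₂ : List ℕ} (h₁ : l₁.Nodup) (h₂ : l₂.Nodup) (e : ℕ → ℕ)
    (b c : ℕ →₀ ℕ) (B C : Finset ℕ) : coef (biExp b c) (biSet B C)
      (evenVal R (completeTerm R e l₁.toFinset l₂.toFinset)) =
      (-1) ^ l₁.length.choose 2 *
      ((if b = ∑ i ∈ l₁.toFinset, Finsupp.single i (e i) + ∑ i ∈ l₂.toFinset, Finsupp.single i (e i)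
        then Grassmann.thetaProd R l₁ B else 0) *
        coef c C ((l₁.map fun i => completeTilde R (e i)).prod *
          (l₂.map fun i => complete R (e i)).prod)) := by
  rw [evenVal_completeTerm h₁ h₂, coef_neg_one_pow_mul, coef_embed_left_mul_embed_right,
    coef_monomial]

theorem of_coef_completeTerm_ne_zero {e : ℕ → ℕ} {t u : Finset ℕ} (htu : Disjoint t u)
    {b c : ℕ →₀ ℕ} {B C : Finset ℕ}
    (h : coef (biExp b c) (biSet B C) (evenVal R (completeTerm R e t u)) ≠ 0) :
    B = t ∧ (∀ i ∈ t, b i = e i) ∧ ∀ i ∈ u, b i = e i := by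
  have ht : t.toList.toFinset = t := Finset.toList_toFinset t
  have hu : u.toList.toFinset = u := Finset.toList_toFinset u
  have h1 := coef_completeTerm (R := R) t.nodup_toList u.nodup_toList e b c B C
  rw [ht, hu] at h1
  rw [h1] at h
  have h2 := left_ne_zero_of_mul (right_ne_zero_of_mul h)
  split_ifs at h2 with h3
  · have h4 := (Grassmann.thetaProd_apply_ne_zero h2).2
    rw [ht] at h4
    rw [← Finset.sum_union htu] at h3
    have h5 : ∀ i ∈ t ∪ u, b i = e i := by
      intro i hi
      rw [h3, Finsupp.finsetSum_apply, Finset.sum_eq_single i]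
      · rw [Finsupp.single_eq_same]
      · exact fun j _ hj => Finsupp.single_eq_of_ne hj.symm
      · exact fun h6 => (h6 hi).elim
    exact ⟨h4, fun i hi => h5 i (Finset.mem_union_left _ hi),
      fun i hi => h5 i (Finset.mem_union_right _ hi)⟩
  · exact (h2 rfl).elim

/-- Choose from each factor a weight l_i and either its fermionic or its bosonic term. The monomial
θ_B x^b forces the fermionic term exactly for i in B, with l_i = b_i + 1 there and l_i = b_i
elsewhere. -/
theorem coef_coeff_prod_completeSeries {n : ℕ} {b : ℕ →₀ ℕ} {B : Finset ℕ}
    (hb : ∀ i ∈ b.support, i < n) (hB : ∀ i ∈ B, i < n) (c : ℕ →₀ ℕ) (C : Finset ℕ) :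
    coef (biExp b c) (biSet B C) (evenVal R (PowerSeries.coeff (b.degree + B.card)
      (∏ i ∈ Finset.range n, completeSeries R i))) =
    coef (biExp b c) (biSet B C) (evenVal R (completeTerm R b B (Finset.range n \ B))) := by
  classical
  have hBs : B ⊆ Finset.range n := fun i hi => Finset.mem_range.2 (hB i hi)
  let F : (ℕ →₀ ℕ) → Finset ℕ → EvenSeries R := fun l t =>
    (∏ i ∈ t, evenLeft (bosonic R i) (hasSector_bosonic i) ^ (l i - 1) *
      evenPair (fermionic R i) (completeTildePred R (l i)) (hasSector_fermionic i)
        (hasSector_completeTildePred (l i))) *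
    ∏ i ∈ Finset.range n \ t, evenLeft (bosonic R i) (hasSector_bosonic i) ^ l i *
      evenRight (complete R (l i)) (hasSector_complete (l i))
  have hF : ∀ l : ℕ →₀ ℕ, ∏ i ∈ Finset.range n, PowerSeries.coeff (l i) (completeSeries R i) =
      ∑ t ∈ (Finset.range n).powerset, F l t := by
    intro l
    simp only [completeSeries, PowerSeries.coeff_mk]
    rw [Finset.prod_add]
  have hFe : ∀ (l : ℕ →₀ ℕ) (e : ℕ → ℕ) (t : Finset ℕ),
      (∀ i, l i = e i + if i ∈ t then 1 else 0) → F l t = completeTerm R e t (Finset.range n \ t) := by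
    intro l e t hl
    simp only [F, completeTerm]
    congr 1
    · refine Finset.prod_congr rfl fun i hi => ?_
      have : l i = e i + 1 := by rw [hl, if_pos hi]
      simp only [this, Nat.add_sub_cancel]
      rfl
    · refine Finset.prod_congr rfl fun i hi => ?_
      have : l i = e i := by rw [hl, if_neg (Finset.mem_sdiff.1 hi).2, add_zero]
      simp only [this]
  have hκ : ∀ i, (b + ∑ j ∈ B, Finsupp.single j 1 : ℕ →₀ ℕ) i = b i + if i ∈ B then 1 else 0 := by
    intro i
    rw [Finsupp.add_apply, Finsupp.finsetSum_apply]
    simp only [Finsupp.single_apply]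
    rw [Finset.sum_ite_eq']
  have key : ∀ (l : ℕ →₀ ℕ) (t : Finset ℕ), l.support ⊆ Finset.range n → t ⊆ Finset.range n →
      coef (biExp b c) (biSet B C) (evenVal R (F l t)) ≠ 0 →
      t = B ∧ l = b + ∑ j ∈ B, Finsupp.single j 1 := by
    intro l t hl ht h
    -- A fermionic term of weight 0 would contain h̃_(-1) = 0.
    have hpos : ∀ i ∈ t, 0 < l i := by
      intro i hi
      by_contra h0
      apply h
      have h1 : F l t = 0 := by
        simp only [F]
        rw [Finset.prod_eq_zero hi, zero_mul]
        have h2 : l i = 0 := by omega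
        refine evenVal_injective ?_
        simp only [h2]
        rw [map_mul, evenVal_evenPair, completeTildePred, map_zero, mul_zero, mul_zero, map_zero]
      rw [h1, map_zero, coef_zero]
    have he : ∀ i, l i = (l i - if i ∈ t then 1 else 0) + if i ∈ t then 1 else 0 := by
      intro i
      split_ifs with hi
      · have := hpos i hi
        omega
      · rfl
    rw [hFe l (fun i => l i - if i ∈ t then 1 else 0) t he] at h
    obtain ⟨rfl, h1, h2⟩ := of_coef_completeTerm_ne_zero Finset.disjoint_sdiff h
    refine ⟨rfl, ?_⟩
    ext i
    rw [hκ]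
    by_cases hi : i ∈ Finset.range n
    · have h3 : b i = l i - if i ∈ B then 1 else 0 := by
        by_cases hi' : i ∈ B
        · exact h1 i hi'
        · exact h2 i (Finset.mem_sdiff.2 ⟨hi, hi'⟩)
      rw [h3]
      exact he i
    · have h3 : l i = 0 := Finsupp.notMem_support_iff.1 fun h3 => hi (hl h3)
      have h4 : b i = 0 :=
        Finsupp.notMem_support_iff.1 fun h4 => hi (Finset.mem_range.2 (hb i h4))
      rw [h3, h4, if_neg fun h5 => hi (hBs h5)]
  rw [PowerSeries.coeff_prod, map_sum, coef_sum,
    Finset.sum_eq_single (b + ∑ j ∈ B, Finsupp.single j 1)]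
  · rw [hF, map_sum, coef_sum, Finset.sum_eq_single B, hFe _ b B hκ]
    · intro t ht hne
      by_contra h
      rw [Finset.mem_powerset] at ht
      refine hne (key _ t (fun i hi => ?_) ht h).1
      rw [Finsupp.mem_support_iff, hκ] at hi
      by_cases hiB : i ∈ B
      · exact hBs hiB
      · rw [if_neg hiB, add_zero, ← Finsupp.mem_support_iff] at hi
        exact Finset.mem_range.2 (hb i hi)
    · exact fun h => (h (Finset.mem_powerset.2 hBs)).elim
  · intro l hl hne
    rw [hF, map_sum, coef_sum]
    refine Finset.sum_eq_zero fun t ht => ?_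
    by_contra h
    exact hne (key l t (Finset.mem_finsuppAntidiag.1 hl).2 (Finset.mem_powerset.1 ht) h).2
  · intro h
    refine (h (Finset.mem_finsuppAntidiag.2 ⟨?_, fun i hi => ?_⟩)).elim
    · simp only [hκ]
      rw [Finset.sum_add_distrib, Finset.sum_ite_mem, Finset.inter_eq_right.2 hBs]
      congr 1
      · exact (Finset.sum_subset (fun i hi => Finset.mem_range.2 (hb i hi))
          fun i _ hi => Finsupp.notMem_support_iff.1 hi).symm
      · simp
    · rw [Finsupp.mem_support_iff, hκ] at hi
      by_cases hiB : i ∈ B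
      · exact hBs hiB
      · rw [if_neg hiB, add_zero, ← Finsupp.mem_support_iff] at hi
        exact Finset.mem_range.2 (hb i hi)

end Expansion

/-! ### Expansion of the kernel in monomial and complete functions -/

section Expansion

variable {R : Type*} [CommRing R]

theorem coef_rev_superMonomial_mul_superComplete (Λ : SuperPartition) (b c : ℕ →₀ ℕ)
    (B C : Finset ℕ) : coef (biExp b c) (biSet B C)
      (rev (embed left (superMonomial R Λ)) * embed right (superComplete R Λ)) =
      (-1) ^ Λ.sector.choose 2 * (coef b B (superMonomial R Λ) * coef c C (superComplete R Λ)) := by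
  rw [((hasSector_superMonomial Λ).embed left).rev_eq, smul_mul_assoc, coef_smul,
    coef_embed_left_mul_embed_right]

theorem formallySummable_superMonomial_mul_superComplete :
    FormallySummable (fun Λ : SuperPartition =>
      rev (embed left (superMonomial R Λ)) * embed right (superComplete R Λ)) := by
  intro a A
  obtain ⟨b, c, rfl⟩ := exists_eq_biExp a
  obtain ⟨B, C, rfl⟩ := exists_eq_biSet A
  -- At most one Λ contributes to a monomial, namely the type of its left part.
  refine Set.Subsingleton.finite fun Λ hΛ Ω hΩ => ?_
  have key : ∀ Λ : SuperPartition, coef (biExp b c) (biSet B C)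
      (rev (embed left (superMonomial R Λ)) * embed right (superComplete R Λ)) ≠ 0 →
      Λ.IsType b B := by
    intro Λ h
    rw [coef_rev_superMonomial_mul_superComplete] at h
    exact isType_of_coef_superMonomial_ne_zero (left_ne_zero_of_mul (right_ne_zero_of_mul h))
  exact (key Λ hΛ).unique (key Ω hΩ)

variable (𝕜 : Type*) [Field 𝕜] [CharZero 𝕜]

/-- Two indices of B with the same exponent n produce h̃_n twice, and h̃_n is odd. -/
theorem completeTerm_eq_zero {b : ℕ →₀ ℕ} {B : Finset ℕ} (h : ¬ Set.InjOn b B) (u : Finset ℕ) :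
    completeTerm 𝕜 b B u = 0 := by
  obtain ⟨i, hi, j, hj, hij, hne⟩ : ∃ i ∈ B, ∃ j ∈ B, b i = b j ∧ i ≠ j := by
    by_contra h1
    refine h fun i hi j hj hij => ?_
    by_contra hne
    exact h1 ⟨i, hi, j, hj, hij, hne⟩
  have h0 : evenPair (fermionic 𝕜 i) (completeTilde 𝕜 (b i)) (hasSector_fermionic i)
        (hasSector_completeTilde (b i)) *
      evenPair (fermionic 𝕜 j) (completeTilde 𝕜 (b j)) (hasSector_fermionic j)
        (hasSector_completeTilde (b j)) = 0 := by
    simp only [← hij]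
    exact evenPair_mul_evenPair_of_right _ _ _
      (mul_self_eq_zero_of_odd (hasSector_completeTilde (b i)).hasParity)
  rw [completeTerm, ← Finset.mul_prod_erase B _ hi,
    ← Finset.mul_prod_erase (B.erase i) _ (Finset.mem_erase.2 ⟨hne.symm, hj⟩), ← mul_assoc,
    mul_mul_mul_comm, h0, mul_zero, zero_mul, zero_mul]

/-- Indices with exponent 0 outside B contribute the factor h_0 = 1, so the result does not depend
on the cutoff. -/
theorem coef_kernel_eq_completeTerm (b c : ℕ →₀ ℕ) (B C : Finset ℕ) :
    coef (biExp b c) (biSet B C) (kernel 𝕜) =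
      coef (biExp b c) (biSet B C) (evenVal 𝕜 (completeTerm 𝕜 b B (b.support \ B))) := by
  have hb : ∀ i ∈ b.support, i < (b.support ∪ B).sup id + 1 := fun i hi =>
    Nat.lt_succ_of_le (Finset.le_sup (f := id) (Finset.mem_union_left B hi))
  have hB : ∀ i ∈ B, i < (b.support ∪ B).sup id + 1 := fun i hi =>
    Nat.lt_succ_of_le (Finset.le_sup (f := id) (Finset.mem_union_right b.support hi))
  rw [coef_kernel 𝕜 hb hB, coef_coeff_prod_completeSeries hb hB]
  congr 2
  unfold completeTerm
  congr 1
  symm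
  refine Finset.prod_subset
    (Finset.sdiff_subset_sdiff (fun i hi => Finset.mem_range.2 (hb i hi)) subset_rfl) ?_
  intro i hi hi'
  have h0 : b i = 0 := by
    by_contra h0
    exact hi' (Finset.mem_sdiff.2 ⟨Finsupp.mem_support_iff.2 h0, (Finset.mem_sdiff.1 hi).2⟩)
  refine evenVal_injective ?_
  simp only [h0]
  rw [pow_zero, one_mul, evenVal_evenRight, complete_zero, map_one, map_one]

theorem coef_kernel_of_isType {Λ : SuperPartition} {b : ℕ →₀ ℕ} {B : Finset ℕ} (h : Λ.IsType b B)
    (c : ℕ →₀ ℕ) (C : Finset ℕ) : coef (biExp b c) (biSet B C) (kernel 𝕜) =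
      (-1) ^ Λ.sector.choose 2 * (coef b B (superMonomial 𝕜 Λ) * coef c C (superComplete 𝕜 Λ)) := by
  obtain ⟨l₁, l₂, h1, rfl, h3, h4, h5⟩ := h.exists_lists
  rw [coef_kernel_eq_completeTerm, ← h3, coef_completeTerm (List.nodup_append'.1 h1).1
    (List.nodup_append'.1 h1).2.1, if_pos, coef_superMonomial_of_isType h h4, superComplete, ← h4,
    ← h5, List.map_map, List.map_map, SuperPartition.sector, ← h4, List.length_map]
  · rfl
  · have h6 : Disjoint l₁.toFinset l₂.toFinset := by
      rw [h3]
      exact Finset.disjoint_sdiff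
    rw [← Finset.sum_union h6, h3, Finset.union_sdiff_self_eq_union]
    conv_lhs => rw [← Finsupp.sum_single b]
    exact Finset.sum_subset Finset.subset_union_right fun i _ hi => by
      rw [Finsupp.notMem_support_iff.1 hi, Finsupp.single_zero]

theorem kernel_eq_formalSum : kernel 𝕜 = formalSum (fun Λ : SuperPartition =>
    rev (embed left (superMonomial 𝕜 Λ)) * embed right (superComplete 𝕜 Λ)) := by
  refine superSeries_ext fun a A => ?_
  obtain ⟨b, c, rfl⟩ := exists_eq_biExp a
  obtain ⟨B, C, rfl⟩ := exists_eq_biSet A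
  change _ = ∑ᶠ Λ : SuperPartition, coef (biExp b c) (biSet B C)
    (rev (embed left (superMonomial 𝕜 Λ)) * embed right (superComplete 𝕜 Λ))
  simp only [coef_rev_superMonomial_mul_superComplete]
  by_cases hinj : Set.InjOn b B
  · obtain ⟨Λ, hΛ⟩ := SuperPartition.exists_isType hinj
    rw [coef_kernel_of_isType 𝕜 hΛ, finsum_eq_single _ Λ]
    intro Ω hne
    rw [coef_superMonomial_eq_zero fun h => hne (h.unique hΛ), zero_mul, mul_zero]
  · rw [coef_kernel_eq_completeTerm, completeTerm_eq_zero 𝕜 hinj, map_zero, coef_zero]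
    symm
    refine finsum_eq_zero_of_forall_eq_zero fun Λ => ?_
    rw [coef_superMonomial_eq_zero fun h => hinj h.injOn, zero_mul, mul_zero]

/-! ### The complete functions in terms of the power sums -/

/-- The same separation of left from right odd factors as in `evenVal_completeTerm`, hence the same
sign. -/
theorem evenVal_partProd (Γ : SuperPartition) :
    evenVal 𝕜 (Γ.partProd (powerSumTildePair 𝕜) (powerSumPair 𝕜)) =
      (-1) ^ Γ.sector.choose 2 *
        (embed left (superPowerSum 𝕜 Γ) * embed right (superPowerSum 𝕜 Γ)) := by
  have e1 : evenVal 𝕜 (Γ.anti.map (powerSumTildePair 𝕜)).prod = (-1) ^ Γ.anti.length.choose 2 *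
      (embedHom 𝕜 left (Γ.anti.map (powerSumTilde 𝕜)).prod *
        embedHom 𝕜 right (Γ.anti.map (powerSumTilde 𝕜)).prod) := by
    rw [map_list_prod, List.map_map, map_list_prod, List.map_map, map_list_prod, List.map_map,
      ← List.prod_map_mul_of_anticomm]
    · rfl
    · exact fun i _ j _ => mul_anticomm_of_odd ((hasSector_powerSumTilde i).embed right).hasParity
        ((hasSector_powerSumTilde j).embed left).hasParity
  have e2 : evenVal 𝕜 (Γ.sym.map (powerSumPair 𝕜)).prod =
      embedHom 𝕜 left (Γ.sym.map (powerSum 𝕜)).prod *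
        embedHom 𝕜 right (Γ.sym.map (powerSum 𝕜)).prod := by
    have : (Γ.sym.map (powerSumPair 𝕜)).prod =
        (Γ.sym.map fun r => evenLeft (powerSum 𝕜 r) (hasSector_powerSum r)).prod *
          (Γ.sym.map fun r => evenRight (powerSum 𝕜 r) (hasSector_powerSum r)).prod :=
      List.prod_map_mul
    rw [this, map_mul]
    simp only [map_list_prod, List.map_map]
    rfl
  have hc : embedHom 𝕜 right (Γ.anti.map (powerSumTilde 𝕜)).prod *
      embedHom 𝕜 left (Γ.sym.map (powerSum 𝕜)).prod =
      embedHom 𝕜 left (Γ.sym.map (powerSum 𝕜)).prod *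
        embedHom 𝕜 right (Γ.anti.map (powerSumTilde 𝕜)).prod := by
    symm
    refine mul_comm_of_even (p := 1 * (Γ.anti.map (powerSumTilde 𝕜)).length) ?_ ?_
    · have h := hasSector_list_prod (Γ.sym.map (powerSum 𝕜)) 0 (by
        intro f hf
        obtain ⟨i, -, rfl⟩ := List.mem_map.1 hf
        exact hasSector_powerSum i)
      rw [zero_mul] at h
      exact (h.embed left).hasParity
    · refine HasSector.hasParity (HasSector.embed (hasSector_list_prod _ 1 ?_) right)
      intro f hf
      obtain ⟨i, -, rfl⟩ := List.mem_map.1 hf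
      exact hasSector_powerSumTilde i
  rw [SuperPartition.partProd, Multiset.map_coe, Multiset.map_coe, Multiset.prod_coe,
    Multiset.prod_coe, map_mul, e1, e2, mul_assoc, mul_assoc, ← mul_assoc (embedHom 𝕜 right _), hc,
    mul_assoc, ← mul_assoc (embedHom 𝕜 left _), ← map_mul, ← map_mul]
  rfl

theorem evenVal_smul (r : 𝕜) (f : EvenSeries 𝕜) : evenVal 𝕜 (r • f) = r • evenVal 𝕜 f := rfl

theorem coef_kernel_eq_sum (b c : ℕ →₀ ℕ) (B C : Finset ℕ) :
    coef (biExp b c) (biSet B C) (kernel 𝕜) =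
      ∑ Γ ∈ SuperPartition.ofTotalDegree (b.degree + B.card), (Γ.z : 𝕜)⁻¹ *
        ((-1) ^ Γ.sector.choose 2 *
          (coef b B (superPowerSum 𝕜 Γ) * coef c C (superPowerSum 𝕜 Γ))) := by
  rw [kernel_eq]
  change coef (biExp b c) (biSet B C) (PowerSeries.coeff (weight leftWeight _ _) _) = _
  rw [weight_leftWeight, PowerSeries.coeff_map, kernelSeries, PowerSeries.coeff_mk,
    SuperPartition.expCoeff, map_sum, coef_sum]
  refine Finset.sum_congr rfl fun Γ _ => ?_
  rw [evenVal_smul, coef_smul, evenVal_partProd, coef_neg_one_pow_mul,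
    coef_embed_left_mul_embed_right]

/-- Equate the two computations of a kernel coefficient. Only Γ of the same sector as Λ contribute,
so the two reversal signs cancel. -/
theorem smul_superComplete_eq_sum {Λ : SuperPartition} {b : ℕ →₀ ℕ} {B : Finset ℕ}
    (h : Λ.IsType b B) : coef b B (superMonomial 𝕜 Λ) • superComplete 𝕜 Λ =
      ∑ Γ ∈ SuperPartition.ofTotalDegree Λ.totalDegree,
        ((Γ.z : 𝕜)⁻¹ * coef b B (superPowerSum 𝕜 Γ)) • superPowerSum 𝕜 Γ := by
  refine superSeries_ext fun c C => ?_
  have h1 := (coef_kernel_of_isType 𝕜 h c C).symm.trans (coef_kernel_eq_sum 𝕜 b c B C)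
  rw [h.sum_eq, h.card_eq] at h1
  have h2 : ∀ n : ℕ, ((-1) ^ n * (-1) ^ n : 𝕜) = 1 := fun n => by
    rw [← mul_pow]
    simp
  rw [coef_smul, coef_sum, ← one_mul (_ * _), ← h2 (Λ.sector.choose 2), mul_assoc, h1,
    Finset.mul_sum]
  refine Finset.sum_congr rfl fun Γ _ => ?_
  rw [coef_smul]
  by_cases h3 : coef b B (superPowerSum 𝕜 Γ) = 0
  · rw [h3]
    ring
  · have h4 : Γ.sector = Λ.sector :=
      ((hasSector_superPowerSum Γ) b B h3).symm.trans h.card_eq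
    rw [h4]
    linear_combination ((Γ.z : 𝕜)⁻¹ * (coef b B (superPowerSum 𝕜 Γ) *
      coef c C (superPowerSum 𝕜 Γ))) * h2 (Λ.sector.choose 2)

end Expansion

theorem map_swap_eq_self {σ : Type*} [DecidableEq σ] {A : Finset σ} {i j : σ} (hi : i ∈ A)
    (hj : j ∈ A) : A.map (Equiv.swap i j).toEmbedding = A := by
  refine Finset.eq_of_subset_of_card_le (fun k hk => ?_) (by rw [Finset.card_map])
  obtain ⟨m, hm, rfl⟩ := Finset.mem_map.1 hk
  rw [Equiv.coe_toEmbedding, Equiv.swap_apply_def]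
  split_ifs
  · exact hj
  · exact hi
  · exact hm

/-- Order A with i and j first. The swap exchanges these two factors and fixes the others, while the
sign of passing to the sorted order is the same before and after. -/
theorem Grassmann.permSign_swap {σ R : Type*} [LinearOrder σ] [CommRing R] {A : Finset σ} {i j : σ}
    (hi : i ∈ A) (hj : j ∈ A) (hij : i ≠ j) : permSign R (Equiv.swap i j) A = -1 := by
  have hA := map_swap_eq_self hi hj
  have hl : (i :: j :: ((A.erase i).erase j).toList).Perm (A.sort (· ≤ ·)) := by
    have h1 : (i :: j :: ((A.erase i).erase j).toList).Nodup := by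
      rw [List.nodup_cons, List.nodup_cons]
      simp [hij, Finset.nodup_toList]
    rw [List.perm_ext_iff_of_nodup h1 (Finset.sort_nodup _ _)]
    intro k
    simp only [List.mem_cons, Finset.mem_toList, Finset.mem_erase, Finset.mem_sort]
    by_cases hki : k = i
    · simp [hki, hi]
    · by_cases hkj : k = j
      · simp [hkj, hj]
      · simp [hki, hkj]
  have hmap : (((A.erase i).erase j).toList).map (Equiv.swap i j) =
      ((A.erase i).erase j).toList := by
    conv_rhs => rw [← List.map_id ((A.erase i).erase j).toList]
    refine List.map_congr_left fun k hk => ?_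
    rw [Finset.mem_toList, Finset.mem_erase, Finset.mem_erase] at hk
    exact Equiv.swap_apply_of_ne_of_ne hk.2.1 hk.1
  obtain ⟨k, hk⟩ := thetaProd_perm (R := R) hl
  have h1 := congrFun (hk (Equiv.swap i j)) A
  have h2 := congrFun (hk id) A
  rw [List.map_id, List.map_id, smul_apply, thetaProd_sort_apply, mul_one] at h2
  rw [List.map_cons, List.map_cons, hmap, Equiv.swap_apply_left, Equiv.swap_apply_right,
    thetaProd_cons, thetaProd_cons, ← mul_assoc, theta_mul_theta, neg_mul, mul_assoc,
    ← thetaProd_cons, ← thetaProd_cons] at h1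
  have h3 : (-(thetaProd R (i :: j :: ((A.erase i).erase j).toList))) A =
      -(thetaProd R (i :: j :: ((A.erase i).erase j).toList) A) := rfl
  rw [h3, h2, smul_apply] at h1
  have h4 : ((-1) ^ k * (-1) ^ k : R) = 1 := by
    rw [← mul_pow]
    simp
  unfold permSign
  rw [hA]
  linear_combination (-(-1) ^ k) * h1 + (-1 - thetaProd R (List.map (Equiv.swap i j)
    (A.sort fun x1 x2 => x1 ≤ x2)) A) * h4

/-! ### Monomial functions span the symmetric functions -/

section Expansion

variable {R : Type*} [CommRing R]

theorem SuperPartition.exponent_eq_mapDomain (Λ : SuperPartition) (s : Equiv.Perm ℕ) :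
    Λ.exponent s = (Λ.exponent 1).mapDomain s := by
  unfold exponent
  rw [Finsupp.mapDomain_finsetSum]
  refine Finset.sum_congr rfl fun i _ => ?_
  rw [Finsupp.mapDomain_single]
  rfl

theorem SuperPartition.map_exponent_one (Λ : SuperPartition) :
    (List.range Λ.sector).map (Λ.exponent 1) = Λ.anti := by
  refine List.ext_getElem (by simp [sector]) fun i h1 h2 => ?_
  rw [List.getElem_map, List.getElem_range]
  have h3 := Λ.exponent_apply 1 i
  rw [Equiv.Perm.one_apply] at h3
  rw [h3, parts, List.getD_eq_getElem _ _ (by rw [List.length_append]; omega),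
    List.getElem_append_left h2]

theorem SuperPartition.exponent_one_isType (Λ : SuperPartition) :
    Λ.IsType (Λ.exponent 1) (Finset.range Λ.sector) := by
  have h := Λ.exponent_isType 1
  have e : ((List.range Λ.sector).map (1 : Equiv.Perm ℕ)).toFinset = Finset.range Λ.sector := by
    ext
    simp
  rwa [e] at h

variable (R) in
/-- The coefficient of `θ_1 ⋯ θ_m x_1 ^ Λ_1 ⋯ x_ℓ ^ Λ_ℓ`. -/
noncomputable def canonicalCoef (Λ : SuperPartition) : SuperSeries ℕ R →ₗ[R] R :=
  coefLinear R (Λ.exponent 1) (Finset.range Λ.sector)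

theorem canonicalCoef_apply (Λ : SuperPartition) (f : SuperSeries ℕ R) :
    canonicalCoef R Λ f = coef (Λ.exponent 1) (Finset.range Λ.sector) f := rfl

theorem canonicalCoef_superMonomial_self (Λ : SuperPartition) :
    canonicalCoef R Λ (superMonomial R Λ) = 1 := by
  have e : (List.range Λ.sector).toFinset = Finset.range Λ.sector := by
    ext
    simp
  have h := Λ.exponent_one_isType
  rw [← e] at h
  rw [canonicalCoef_apply, ← e, coef_superMonomial_of_isType h Λ.map_exponent_one,
    Grassmann.thetaProd_sorted_apply List.pairwise_lt_range]

theorem canonicalCoef_superMonomial (Λ Ω : SuperPartition) :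
    canonicalCoef R Λ (superMonomial R Ω) = if Λ = Ω then 1 else 0 := by
  split_ifs with h
  · rw [← h, canonicalCoef_superMonomial_self]
  · exact coef_superMonomial_eq_zero fun h1 => h (Λ.exponent_one_isType.unique h1)

/-- A finitary permutation carries the canonical monomial of type Λ to the given one, and introduces
the same sign for f as for m_Λ. -/
theorem IsSymmetric.coef_eq {f : SuperSeries ℕ R} (hf : IsSymmetric f) {Λ : SuperPartition}
    {a : ℕ →₀ ℕ} {A : Finset ℕ} (h : Λ.IsType a A) :
    coef a A f = canonicalCoef R Λ f * coef a A (superMonomial R Λ) := by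
  obtain ⟨l₁, l₂, h1, rfl, h3, h4, h5⟩ := h.exists_lists
  obtain ⟨s, hs, hsl⟩ := exists_finitaryPerm_extending (l₁ ++ l₂) h1
  obtain ⟨h6, h7⟩ := SuperPartition.exponent_eq_of_map_eq hsl h4 h5 fun i hi => by
    by_cases hi' : i ∈ l₁
    · exact Or.inl hi'
    · refine Or.inr (List.mem_toFinset.1 ?_)
      rw [h3]
      exact Finset.mem_sdiff.2 ⟨hi, fun h => hi' (List.mem_toFinset.1 h)⟩
  have hA : l₁.toFinset = (Finset.range Λ.sector).map s.toEmbedding := by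
    rw [← h7, Grassmann.toFinset_map_perm]
    congr 1
    ext
    simp
  have key : ∀ g : SuperSeries ℕ R, IsSymmetric g → coef a l₁.toFinset g =
      canonicalCoef R Λ g * Grassmann.permSign R s (Finset.range Λ.sector) := by
    intro g hg
    rw [← hg.permute_eq hs, ← h6, hA, SuperPartition.exponent_eq_mapDomain, coef_permute,
      hg.permute_eq hs, canonicalCoef_apply]
  rw [key f hf, key _ (superMonomial_mem Λ), canonicalCoef_superMonomial_self, one_mul]

theorem IsSymmetric.finite_canonicalCoef_ne_zero {f : SuperSeries ℕ R} (hf : IsSymmetric f) :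
    {Λ | canonicalCoef R Λ f ≠ 0}.Finite := by
  obtain ⟨d, hd⟩ := hf.1
  refine (finite_setOf_degree_add_sector_le (d + d)).subset fun Λ hΛ => ?_
  have h := hd _ _ hΛ
  rw [Λ.exponent_one_isType.sum_eq, Λ.exponent_one_isType.card_eq] at h
  exact Nat.add_le_add h.1 h.2

variable {𝕜 : Type*} [Field 𝕜] [CharZero 𝕜]

/-- Transposing two indices of A with equal exponents fixes the monomial but changes its sign, so
the coefficient equals its own negative. -/
theorem IsSymmetric.coef_eq_zero {f : SuperSeries ℕ 𝕜} (hf : IsSymmetric f) {a : ℕ →₀ ℕ}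
    {A : Finset ℕ} (h : ¬ Set.InjOn a A) : coef a A f = 0 := by
  obtain ⟨i, hi, j, hj, hij, hne⟩ : ∃ i ∈ A, ∃ j ∈ A, a i = a j ∧ i ≠ j := by
    by_contra h1
    refine h fun i hi j hj hij => ?_
    by_contra hne
    exact h1 ⟨i, hi, j, hj, hij, hne⟩
  have hA := map_swap_eq_self hi hj
  have ha : a.mapDomain (Equiv.swap i j) = a := by
    ext k
    obtain ⟨m, rfl⟩ := (Equiv.swap i j).surjective k
    rw [Finsupp.mapDomain_apply (Equiv.swap i j).injective, Equiv.swap_apply_def]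
    split_ifs with h1 h2
    · rw [h1, hij]
    · rw [h2, hij]
    · rfl
  have h1 := coef_permute (Equiv.swap i j) f a A
  rw [hf.permute_eq (swap_mem_finitaryPerm i j), ha, hA, Grassmann.permSign_swap hi hj hne,
    mul_neg_one] at h1
  exact self_eq_neg.1 h1

theorem IsSymmetric.eq_sum {f : SuperSeries ℕ 𝕜} (hf : IsSymmetric f) {T : Finset SuperPartition}
    (hT : ∀ Λ, canonicalCoef 𝕜 Λ f ≠ 0 → Λ ∈ T) :
    f = ∑ Λ ∈ T, canonicalCoef 𝕜 Λ f • superMonomial 𝕜 Λ := by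
  refine superSeries_ext fun a A => ?_
  rw [coef_sum]
  simp only [coef_smul]
  by_cases hinj : Set.InjOn a A
  · obtain ⟨Λ, hΛ⟩ := SuperPartition.exists_isType hinj
    rw [hf.coef_eq hΛ, Finset.sum_eq_single Λ]
    · intro Ω _ hne
      rw [coef_superMonomial_eq_zero fun h => hne (h.unique hΛ), mul_zero]
    · intro h
      have h0 : canonicalCoef 𝕜 Λ f = 0 := by
        by_contra h1
        exact h (hT Λ h1)
      rw [h0, zero_mul]
  · rw [hf.coef_eq_zero hinj]
    symm
    refine Finset.sum_eq_zero fun Λ _ => ?_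
    rw [coef_superMonomial_eq_zero fun h => hinj h.injOn, mul_zero]

end Expansion

/-! ### Triangularity of the power sums -/

section Triangularity

variable {R : Type*} [CommRing R]

/-- Each factor contributes one variable. There are as many variables as factors only if no two
factors use the same one, and then the exponents are the parts. -/
theorem of_coef_prod_powerSum_ne_zero {S : List ℕ} (hS : ∀ k ∈ S, 0 < k) {a : ℕ →₀ ℕ}
    {A : Finset ℕ} (h : coef a A (S.map (powerSum R)).prod ≠ 0) :
    A = ∅ ∧ a.degree = S.sum ∧ a.support.card ≤ S.length ∧
      (a.support.card = S.length → a.support.val.map a = (S : Multiset ℕ)) := by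
  classical
  induction S generalizing a A with
  | nil =>
    rw [List.map_nil, List.prod_nil, coef_one] at h
    obtain ⟨rfl, rfl⟩ : a = 0 ∧ A = ∅ := by
      by_contra h1
      exact h (if_neg h1)
    simp
  | cons n S ih =>
    rw [List.map_cons, List.prod_cons] at h
    obtain ⟨b, c, B, C, rfl, rfl, -, h1, h2⟩ := exists_of_coef_mul_ne_zero h
    obtain ⟨i, rfl, rfl⟩ := exists_of_coef_powerSum_ne_zero h1
    obtain ⟨rfl, h3, h4, h5⟩ := ih (fun k hk => hS k (List.mem_cons_of_mem n hk)) h2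
    have hsub : (Finsupp.single i n + c).support ⊆ insert i c.support := by
      refine Finsupp.support_add.trans (Finset.union_subset ?_ (Finset.subset_insert _ _))
      exact Finsupp.support_single_subset.trans
        (Finset.singleton_subset_iff.2 (Finset.mem_insert_self _ _))
    have hcard := Finset.card_le_card hsub
    have hins := Finset.card_insert_le i c.support
    rw [List.length_cons, List.sum_cons, map_add, Finsupp.degree_single, h3]
    refine ⟨rfl, rfl, by omega, fun h6 => ?_⟩
    have hi : i ∉ c.support := fun hi => by
      rw [Finset.insert_eq_of_mem hi] at hcard
      omega
    have hn : 0 < n := hS n List.mem_cons_self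
    have hsupp : (Finsupp.single i n + c).support = insert i c.support :=
      Finset.eq_of_subset_of_card_le hsub (by omega)
    rw [hsupp, Finset.insert_val_of_notMem hi, Multiset.map_cons, ← Multiset.cons_coe,
      ← h5 (by omega), Finsupp.add_apply, Finsupp.single_eq_same, Finsupp.notMem_support_iff.1 hi,
      add_zero]
    congr 1
    refine Multiset.map_congr rfl fun k hk => ?_
    rw [Finsupp.add_apply, Finsupp.single_eq_of_ne, zero_add]
    rintro rfl
    exact hi hk

/-- Variables are counted by `a.support ∪ A` rather than the support, since θ_i x_i^0 involves i
with exponent 0. -/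
theorem of_coef_prod_powerSumTilde_mul_ne_zero {L S : List ℕ} (hS : ∀ k ∈ S, 0 < k) {a : ℕ →₀ ℕ}
    {A : Finset ℕ}
    (h : coef a A ((L.map (powerSumTilde R)).prod * (S.map (powerSum R)).prod) ≠ 0) :
    a.degree = L.sum + S.sum ∧ (a.support ∪ A).card ≤ L.length + S.length ∧
      ((a.support ∪ A).card = L.length + S.length → A.val.map a = (L : Multiset ℕ) ∧
        (a.support \ A).val.map a = (S : Multiset ℕ)) := by
  classical
  induction L generalizing a A with
  | nil =>
    rw [List.map_nil, List.prod_nil, one_mul] at h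
    obtain ⟨rfl, h1, h2, h3⟩ := of_coef_prod_powerSum_ne_zero hS h
    rw [Finset.union_empty, Finset.sdiff_empty]
    simpa [h1] using ⟨h2, h3⟩
  | cons n L ih =>
    rw [List.map_cons, List.prod_cons, mul_assoc] at h
    obtain ⟨b, c, B, C, rfl, rfl, hd, h1, h2⟩ := exists_of_coef_mul_ne_zero h
    obtain ⟨i, rfl, rfl⟩ := exists_of_coef_powerSumTilde_ne_zero h1
    obtain ⟨h3, h4, h5⟩ := ih h2
    have hiC : i ∉ C := Finset.disjoint_singleton_left.1 hd
    have hne : ∀ k, k ≠ i → (Finsupp.single i n + c) k = c k := by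
      intro k hk
      rw [Finsupp.add_apply, Finsupp.single_eq_of_ne hk, zero_add]
    have hsub : (Finsupp.single i n + c).support ∪ ({i} ∪ C) ⊆ insert i (c.support ∪ C) := by
      intro k hk
      by_cases hki : k = i
      · rw [hki]
        exact Finset.mem_insert_self _ _
      · refine Finset.mem_insert_of_mem ?_
        rw [Finset.mem_union, Finset.mem_union, Finset.mem_singleton, Finsupp.mem_support_iff,
          hne k hki] at hk
        rw [Finset.mem_union, Finsupp.mem_support_iff]
        tauto
    have hcard := Finset.card_le_card hsub
    have hins := Finset.card_insert_le i (c.support ∪ C)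
    rw [List.length_cons, List.sum_cons, map_add, Finsupp.degree_single, h3]
    refine ⟨by omega, by omega, fun h6 => ?_⟩
    have hi : i ∉ c.support ∪ C := fun hi => by
      rw [Finset.insert_eq_of_mem hi] at hcard
      omega
    have hic : c i = 0 :=
      Finsupp.notMem_support_iff.1 fun h => hi (Finset.mem_union_left _ h)
    obtain ⟨h7, h8⟩ := h5 (by omega)
    have hsdiff : (Finsupp.single i n + c).support \ ({i} ∪ C) = c.support \ C := by
      ext k
      simp only [Finset.mem_sdiff, Finset.mem_union, Finset.mem_singleton, Finsupp.mem_support_iff]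
      by_cases hki : k = i
      · simp [hki, hic]
      · rw [hne k hki]
        simp [hki]
    constructor
    · rw [← Finset.insert_eq, Finset.insert_val_of_notMem hiC, Multiset.map_cons,
        ← Multiset.cons_coe, ← h7, Finsupp.add_apply, Finsupp.single_eq_same, hic, add_zero]
      congr 1
      refine Multiset.map_congr rfl fun k hk => hne k ?_
      rintro rfl
      exact hiC hk
    · rw [hsdiff, ← h8]
      refine Multiset.map_congr rfl fun k hk => hne k ?_
      rintro rfl
      exact hi (Finset.mem_union_left _ (Finset.mem_sdiff.1 hk).1)

theorem support_sub_single_of_lt {a : ℕ →₀ ℕ} {i n : ℕ} (h : n < a i) :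
    (a - Finsupp.single i n).support = a.support := by
  ext k
  rw [Finsupp.mem_support_iff, Finsupp.mem_support_iff, Finsupp.tsub_apply, Finsupp.single_apply]
  split_ifs with hk
  · subst hk
    omega
  · rfl

theorem sub_single_apply_of_ne (a : ℕ →₀ ℕ) {i n k : ℕ} (h : k ≠ i) :
    (a - Finsupp.single i n) k = a k := by
  rw [Finsupp.tsub_apply, Finsupp.single_eq_of_ne h, Nat.sub_zero]

theorem support_sub_single_of_eq [DecidableEq ℕ] {a : ℕ →₀ ℕ} {i n : ℕ} (h : a i = n) :
    (a - Finsupp.single i n).support = a.support.erase i := by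
  ext k
  rw [Finset.mem_erase, Finsupp.mem_support_iff, Finsupp.mem_support_iff]
  by_cases hk : k = i
  · subst hk
    rw [Finsupp.tsub_apply, Finsupp.single_eq_same, h]
    simp
  · rw [sub_single_apply_of_ne a hk]
    simp [hk]

/-- A sum of nonnegative contributions, at least one of them positive. An index with a_i > n
contributes 0: removing x_i^n leaves more variables than remaining factors. -/
theorem coef_prod_powerSum_eq_natCast {S : List ℕ} (hS : ∀ k ∈ S, 0 < k) {a : ℕ →₀ ℕ}
    (h : a.support.val.map a = (S : Multiset ℕ)) :
    ∃ N : ℕ, 0 < N ∧ coef a ∅ (S.map (powerSum R)).prod = N := by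
  induction S generalizing a with
  | nil =>
    rw [Multiset.coe_nil, Multiset.map_eq_zero, Finset.val_eq_zero, Finsupp.support_eq_empty] at h
    refine ⟨1, one_pos, ?_⟩
    rw [h, List.map_nil, List.prod_nil, coef_one, if_pos ⟨rfl, rfl⟩, Nat.cast_one]
  | cons n S ih =>
    have hS' : ∀ k ∈ S, 0 < k := fun k hk => hS k (List.mem_cons_of_mem n hk)
    have hcard : a.support.card = S.length + 1 := by
      have := congrArg Multiset.card h
      rwa [Multiset.card_map, Finset.card_val, Multiset.coe_card, List.length_cons] at this
    have key : ∀ i, ∃ N : ℕ, i ∈ a.support → (a i = n → 0 < N) ∧ (if n ≤ a i then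
        coef (a - Finsupp.single i n) ∅ (S.map (powerSum R)).prod else 0) = (N : R) := by
      intro i
      rcases lt_trichotomy (a i) n with hlt | heq | hgt
      · refine ⟨0, fun _ => ⟨fun h1 => (hlt.ne h1).elim, ?_⟩⟩
        rw [if_neg hlt.not_ge, Nat.cast_zero]
      · by_cases hi : i ∈ a.support
        · obtain ⟨N, hN, h1⟩ := ih hS' (a := a - Finsupp.single i n) (by
            rw [support_sub_single_of_eq heq, Finset.erase_val]
            rw [← Multiset.cons_erase (Finset.mem_def.1 hi), Multiset.map_cons, heq,
              ← Multiset.cons_coe] at h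
            rw [← (Multiset.cons_inj_right n).1 h]
            refine Multiset.map_congr rfl fun k hk => sub_single_apply_of_ne a ?_
            exact (a.support.nodup.mem_erase_iff.1 hk).1)
          exact ⟨N, fun _ => ⟨fun _ => hN, by rw [if_pos heq.ge, h1]⟩⟩
        · exact ⟨0, fun h1 => (hi h1).elim⟩
      · refine ⟨0, fun _ => ⟨fun h1 => (hgt.ne' h1).elim, ?_⟩⟩
        rw [if_pos hgt.le, Nat.cast_zero]
        by_contra h1
        have h2 := (of_coef_prod_powerSum_ne_zero hS' h1).2.2.1
        rw [support_sub_single_of_lt hgt] at h2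
        omega
    choose N hN using key
    refine ⟨∑ i ∈ a.support, N i, ?_, ?_⟩
    · have hn : n ∈ a.support.val.map a := by
        rw [h]
        exact List.mem_cons_self
      obtain ⟨i, hi, hin⟩ := Multiset.mem_map.1 hn
      exact ((hN i hi).1 hin).trans_le (Finset.single_le_sum (fun _ _ => Nat.zero_le _) hi)
    · rw [List.map_cons, List.prod_cons, coef_powerSum_mul (hS n List.mem_cons_self), Nat.cast_sum]
      exact Finset.sum_congr rfl fun i hi => (hN i hi).2

/-- Antisymmetric parts are distinct, so exactly one i in A has exponent n and only one term of p̃_n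
survives. There is no cancellation, and the coefficient is a signed positive integer. -/
theorem coef_prod_powerSumTilde_mul_ne_zero [CharZero R] {L S : List ℕ} (hL : L.Nodup)
    (hS : ∀ k ∈ S, 0 < k) {a : ℕ →₀ ℕ} {A : Finset ℕ} (h₁ : A.val.map a = (L : Multiset ℕ))
    (h₂ : (a.support \ A).val.map a = (S : Multiset ℕ)) :
    coef a A ((L.map (powerSumTilde R)).prod * (S.map (powerSum R)).prod) ≠ 0 := by
  induction L generalizing a A with
  | nil =>
    rw [Multiset.coe_nil, Multiset.map_eq_zero, Finset.val_eq_zero] at h₁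
    subst h₁
    rw [Finset.sdiff_empty] at h₂
    obtain ⟨N, hN, h⟩ := coef_prod_powerSum_eq_natCast (R := R) hS h₂
    rw [List.map_nil, List.prod_nil, one_mul, h]
    exact Nat.cast_ne_zero.2 hN.ne'
  | cons n L ih =>
    have hinj : ∀ i ∈ A, ∀ j ∈ A, a i = a j → i = j := by
      refine Multiset.inj_on_of_nodup_map (s := A.val) ?_
      rw [h₁]
      exact Multiset.coe_nodup.2 hL
    have hcard : (a.support ∪ A).card = L.length + 1 + S.length := by
      have h3 := congrArg Multiset.card h₁
      have h4 := congrArg Multiset.card h₂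
      rw [Multiset.card_map, Finset.card_val, Multiset.coe_card] at h3 h4
      rw [List.length_cons] at h3
      rw [← Finset.sdiff_union_self_eq_union, Finset.card_union_of_disjoint Finset.sdiff_disjoint]
      omega
    obtain ⟨i, hi, hin⟩ : ∃ i ∈ A, a i = n := by
      have hn : n ∈ A.val.map a := by
        rw [h₁]
        exact List.mem_cons_self
      exact Multiset.mem_map.1 hn
    rw [List.map_cons, List.prod_cons, mul_assoc, coef_powerSumTilde_mul, Finset.sum_eq_single i]
    · rw [if_pos hin.ge]
      have h3 := ih (List.nodup_cons.1 hL).2 (a := a - Finsupp.single i n) (A := A.erase i) ?_ ?_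
      · rcases neg_one_pow_eq_or R (Grassmann.inversions {i} (A.erase i)) with h4 | h4
        · rwa [h4, one_mul]
        · rwa [h4, neg_one_mul, neg_ne_zero]
      · rw [Finset.erase_val]
        rw [← Multiset.cons_erase (Finset.mem_def.1 hi), Multiset.map_cons, hin,
          ← Multiset.cons_coe] at h₁
        rw [← (Multiset.cons_inj_right n).1 h₁]
        refine Multiset.map_congr rfl fun k hk => sub_single_apply_of_ne a ?_
        exact (A.nodup.mem_erase_iff.1 hk).1
      · have h4 : (a - Finsupp.single i n).support \ A.erase i = a.support \ A := by
          rw [support_sub_single_of_eq hin]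
          ext k
          simp only [Finset.mem_sdiff, Finset.mem_erase]
          by_cases hk : k = i
          · simp [hk, hi]
          · simp [hk]
        rw [h4, ← h₂]
        refine Multiset.map_congr rfl fun k hk => sub_single_apply_of_ne a ?_
        rintro rfl
        exact (Finset.mem_sdiff.1 hk).2 hi
    · intro j hj hne
      split_ifs with hle
      · have hgt : n < a j := lt_of_le_of_ne hle fun h => hne (hinj j hj i hi (h.symm.trans hin.symm))
        by_contra h3
        have h4 := (of_coef_prod_powerSumTilde_mul_ne_zero hS (right_ne_zero_of_mul h3)).2.1
        have h5 : (a - Finsupp.single j n).support ∪ A.erase j = a.support ∪ A := by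
          rw [support_sub_single_of_lt hgt]
          ext k
          simp only [Finset.mem_union, Finset.mem_erase]
          by_cases hk : k = j
          · have : j ∈ a.support := Finsupp.mem_support_iff.2 (by omega)
            simp [hk, this]
          · simp [hk]
        rw [h5] at h4
        omega
      · rfl
    · exact fun h => (h hi).elim

theorem SuperPartition.IsType.card_union {Λ : SuperPartition} {a : ℕ →₀ ℕ} {A : Finset ℕ}
    (h : Λ.IsType a A) : (a.support ∪ A).card = Λ.parts.length := by
  have h3 := congrArg Multiset.card h.1
  have h4 := congrArg Multiset.card h.2
  rw [Multiset.card_map, Finset.card_val, Multiset.coe_card] at h3 h4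
  rw [← Finset.sdiff_union_self_eq_union, Finset.card_union_of_disjoint Finset.sdiff_disjoint,
    parts, List.length_append]
  omega

/-- Merging parts of Ω can only decrease their number: p_Ω involves m_Ω and monomial functions with
fewer parts. -/
theorem of_canonicalCoef_superPowerSum_ne_zero {Λ Ω : SuperPartition}
    (h : canonicalCoef R Λ (superPowerSum R Ω) ≠ 0) : Ω.totalDegree = Λ.totalDegree ∧
      Λ.parts.length ≤ Ω.parts.length ∧ (Λ.parts.length = Ω.parts.length → Λ = Ω) := by
  have hΛ := Λ.exponent_one_isType
  obtain ⟨h1, h2, h3⟩ := of_coef_prod_powerSumTilde_mul_ne_zero Ω.sym_pos h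
  rw [hΛ.card_union, ← List.length_append] at h2 h3
  refine ⟨?_, h2, fun h4 => hΛ.unique (h3 h4)⟩
  have h5 := hasSector_superPowerSum Ω _ _ h
  rw [hΛ.sum_eq, ← List.sum_append] at h1
  rw [hΛ.card_eq] at h5
  rw [SuperPartition.totalDegree, SuperPartition.totalDegree, h1, ← h5]
  rfl

theorem canonicalCoef_superPowerSum_self_ne_zero [CharZero R] (Λ : SuperPartition) :
    canonicalCoef R Λ (superPowerSum R Λ) ≠ 0 :=
  coef_prod_powerSumTilde_mul_ne_zero Λ.anti_nodup Λ.sym_pos Λ.exponent_one_isType.1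
    Λ.exponent_one_isType.2

end Triangularity

/-! ### The power sum basis -/

section Form

variable (𝕜 : Type*) [Field 𝕜] [CharZero 𝕜]

theorem linearIndependent_superPowerSum : LinearIndependent 𝕜 (superPowerSum 𝕜) := by
  classical
  rw [linearIndependent_iff']
  intro s g hg
  by_contra! hne
  -- In a relation, take Λ with the largest number of parts: no other power sum in the relation
  -- contains m_Λ.
  obtain ⟨Λ, hΛ, hmax⟩ := Finset.exists_max_image (s.filter fun Λ => g Λ ≠ 0)
    (fun Λ => Λ.parts.length) (by
      obtain ⟨Λ, h1, h2⟩ := hne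
      exact ⟨Λ, Finset.mem_filter.2 ⟨h1, h2⟩⟩)
  rw [Finset.mem_filter] at hΛ
  have h := congrArg (canonicalCoef 𝕜 Λ) hg
  simp only [map_sum, map_smul, map_zero, smul_eq_mul] at h
  rw [Finset.sum_eq_single Λ] at h
  · exact mul_ne_zero hΛ.2 (canonicalCoef_superPowerSum_self_ne_zero Λ) h
  · intro Ω hΩ hΩΛ
    by_contra h1
    obtain ⟨-, h2, h3⟩ := of_canonicalCoef_superPowerSum_ne_zero (right_ne_zero_of_mul h1)
    have h4 := hmax Ω (Finset.mem_filter.2 ⟨hΩ, left_ne_zero_of_mul h1⟩)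
    exact hΩΛ (h3 (le_antisymm h2 h4)).symm
  · exact fun h1 => (h1 hΛ.1).elim

/-- Induction on the number of parts: solve the triangular expansion of p_Λ for m_Λ. -/
theorem superMonomial_mem_span (Λ : SuperPartition) :
    superMonomial 𝕜 Λ ∈ Submodule.span 𝕜 (Set.range (superPowerSum 𝕜)) := by
  classical
  induction hn : Λ.parts.length using Nat.strong_induction_on generalizing Λ with
  | _ n ih =>
    have hsym : IsSymmetric (superPowerSum 𝕜 Λ) := superPowerSum_mem Λ
    -- Inserting Λ makes its term available for splitting off without first checking that its
    -- coefficient is nonzero.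
    have h := hsym.eq_sum (T := insert Λ hsym.finite_canonicalCoef_ne_zero.toFinset) fun Ω hΩ =>
      Finset.mem_insert_of_mem (hsym.finite_canonicalCoef_ne_zero.mem_toFinset.2 hΩ)
    rw [← Finset.add_sum_erase _ _ (Finset.mem_insert_self _ _), ← sub_eq_iff_eq_add] at h
    have hc := canonicalCoef_superPowerSum_self_ne_zero (R := 𝕜) Λ
    rw [← inv_smul_eq_iff₀ hc] at h
    rw [← h]
    refine Submodule.smul_mem _ _ (Submodule.sub_mem _ (Submodule.subset_span ⟨Λ, rfl⟩)
      (Submodule.sum_mem _ fun Ω hΩ => ?_))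
    by_cases h0 : canonicalCoef 𝕜 Ω (superPowerSum 𝕜 Λ) = 0
    · rw [h0, zero_smul]
      exact Submodule.zero_mem _
    · obtain ⟨-, h2, h3⟩ := of_canonicalCoef_superPowerSum_ne_zero h0
      refine Submodule.smul_mem _ _ (ih _ ?_ Ω rfl)
      rw [← hn]
      exact lt_of_le_of_ne h2 fun h4 => Finset.ne_of_mem_erase hΩ (h3 h4)

theorem mem_span_superPowerSum {f : SuperSeries ℕ 𝕜} (hf : f ∈ symmetricSuperfunctions 𝕜) :
    f ∈ Submodule.span 𝕜 (Set.range (superPowerSum 𝕜)) := by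
  have hsym : IsSymmetric f := hf
  rw [hsym.eq_sum fun Λ hΛ => hsym.finite_canonicalCoef_ne_zero.mem_toFinset.2 hΛ]
  exact Submodule.sum_mem _ fun Λ _ => Submodule.smul_mem _ _ (superMonomial_mem_span 𝕜 Λ)

/-- The power sums form a basis of the symmetric functions in superspace. -/
noncomputable def powerSumBasis : Module.Basis SuperPartition 𝕜 (symmetricSuperfunctions 𝕜) :=
  Module.Basis.mk (v := fun Λ => ⟨superPowerSum 𝕜 Λ, superPowerSum_mem Λ⟩)
    (LinearIndependent.of_comp (symmetricSuperfunctions 𝕜).subtype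
      (linearIndependent_superPowerSum 𝕜)) (by
    rintro ⟨f, hf⟩ -
    have h := mem_span_superPowerSum 𝕜 hf
    have e : Set.range (superPowerSum 𝕜) = (symmetricSuperfunctions 𝕜).subtype ''
        Set.range fun Λ => (⟨superPowerSum 𝕜 Λ, superPowerSum_mem Λ⟩ :
          symmetricSuperfunctions 𝕜) := by
      rw [← Set.range_comp]
      rfl
    rw [e, ← Submodule.map_span] at h
    obtain ⟨g, hg, hgf⟩ := h
    have hgf' : g = ⟨f, hf⟩ := Subtype.ext hgf
    rwa [hgf'] at hg)

theorem powerSumBasis_apply (Λ : SuperPartition) :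
    powerSumBasis 𝕜 Λ = ⟨superPowerSum 𝕜 Λ, superPowerSum_mem Λ⟩ :=
  Module.Basis.mk_apply _ _ _

end Form

/-! ### The scalar product and duality -/

section Form

variable (𝕜 : Type*) [Field 𝕜] [CharZero 𝕜]

theorem rev_superPowerSum (Λ : SuperPartition) :
    rev (superPowerSum 𝕜 Λ) = ((-1) ^ Λ.sector.choose 2 : 𝕜) • superPowerSum 𝕜 Λ :=
  (hasSector_superPowerSum Λ).rev_eq

theorem neg_one_pow_mul_self (n : ℕ) : ((-1) ^ n * (-1) ^ n : 𝕜) = 1 := by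
  rw [← mul_pow]
  simp

/-- At the canonical monomial the coefficient of m_Λ is 1, which isolates h_Λ. -/
theorem superComplete_eq_sum (Λ : SuperPartition) : superComplete 𝕜 Λ =
    ∑ Γ ∈ SuperPartition.ofTotalDegree Λ.totalDegree,
      ((Γ.z : 𝕜)⁻¹ * canonicalCoef 𝕜 Λ (superPowerSum 𝕜 Γ)) • superPowerSum 𝕜 Γ := by
  have h := smul_superComplete_eq_sum 𝕜 Λ.exponent_one_isType
  rwa [← canonicalCoef_apply, canonicalCoef_superMonomial_self, one_smul] at h

/-- The scalar product on the symmetric functions in superspace. -/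
noncomputable def scalarProduct :
    symmetricSuperfunctions 𝕜 →ₗ[𝕜] symmetricSuperfunctions 𝕜 →ₗ[𝕜] 𝕜 :=
  (powerSumBasis 𝕜).constr 𝕜 fun Λ => (powerSumBasis 𝕜).constr 𝕜 fun Ω =>
    if Λ = Ω then (-1) ^ Λ.sector.choose 2 * (Λ.z : 𝕜) else 0

theorem scalarProduct_powerSumBasis (Λ Ω : SuperPartition) :
    scalarProduct 𝕜 (powerSumBasis 𝕜 Λ) (powerSumBasis 𝕜 Ω) =
      if Λ = Ω then (-1) ^ Λ.sector.choose 2 * (Λ.z : 𝕜) else 0 := by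
  rw [scalarProduct, Module.Basis.constr_basis, Module.Basis.constr_basis]

theorem rev_powerSumBasis (Λ : SuperPartition)
    (h : rev (superPowerSum 𝕜 Λ) ∈ symmetricSuperfunctions 𝕜) :
    (⟨rev (superPowerSum 𝕜 Λ), h⟩ : symmetricSuperfunctions 𝕜) =
      ((-1) ^ Λ.sector.choose 2 : 𝕜) • powerSumBasis 𝕜 Λ := by
  rw [powerSumBasis_apply]
  exact Subtype.ext (rev_superPowerSum 𝕜 Λ)

theorem scalarProduct_rev_powerSum (Λ Ω : SuperPartition)
    (h : rev (superPowerSum 𝕜 Λ) ∈ symmetricSuperfunctions 𝕜) :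
    scalarProduct 𝕜 ⟨rev (superPowerSum 𝕜 Λ), h⟩ (powerSumBasis 𝕜 Ω) =
      if Λ = Ω then (Λ.z : 𝕜) else 0 := by
  rw [rev_powerSumBasis, map_smul, LinearMap.smul_apply, scalarProduct_powerSumBasis, smul_eq_mul,
    mul_ite, mul_zero, ← mul_assoc, neg_one_pow_mul_self, one_mul]

/-- Checked on the power sum basis: in the expansion of h_Λ the factor z_Ω⁻¹ cancels the norm of
p_Ω. Duality follows by evaluating the coefficient functional on m_Ω. -/
theorem scalarProduct_rev_superComplete (Λ : SuperPartition)
    (h : rev (superComplete 𝕜 Λ) ∈ symmetricSuperfunctions 𝕜) :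
    scalarProduct 𝕜 ⟨rev (superComplete 𝕜 Λ), h⟩ =
      (canonicalCoef 𝕜 Λ).comp (symmetricSuperfunctions 𝕜).subtype := by
  classical
  refine (powerSumBasis 𝕜).ext fun Ω => ?_
  have e : (⟨rev (superComplete 𝕜 Λ), h⟩ : symmetricSuperfunctions 𝕜) =
      ∑ Γ ∈ SuperPartition.ofTotalDegree Λ.totalDegree,
        ((Γ.z : 𝕜)⁻¹ * canonicalCoef 𝕜 Λ (superPowerSum 𝕜 Γ)) •
          (⟨rev (superPowerSum 𝕜 Γ), rev_mem (superPowerSum_mem Γ)⟩ :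
            symmetricSuperfunctions 𝕜) := by
    refine Subtype.ext ?_
    rw [AddSubmonoidClass.coe_finsetSum]
    change rev (superComplete 𝕜 Λ) = ∑ Γ ∈ _,
      ((Γ.z : 𝕜)⁻¹ * canonicalCoef 𝕜 Λ (superPowerSum 𝕜 Γ)) • rev (superPowerSum 𝕜 Γ)
    refine superSeries_ext fun a A => ?_
    rw [coef_rev, superComplete_eq_sum, coef_sum, coef_sum, Finset.mul_sum]
    refine Finset.sum_congr rfl fun Γ _ => ?_
    rw [coef_smul, coef_smul, coef_rev]
    ring
  rw [e, map_sum, LinearMap.sum_apply]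
  simp only [map_smul, LinearMap.smul_apply, scalarProduct_rev_powerSum, smul_eq_mul, mul_ite,
    mul_zero]
  rw [Finset.sum_ite_eq', LinearMap.comp_apply, powerSumBasis_apply, Submodule.subtype_apply]
  split_ifs with hΩ
  · have hz : (Ω.z : 𝕜) ≠ 0 := Nat.cast_ne_zero.2 Ω.z_pos.ne'
    field_simp
  -- For Ω of another total degree the coefficient functional vanishes on p_Ω as well.
  · by_contra h1
    exact hΩ (SuperPartition.mem_ofTotalDegree.2
      (of_canonicalCoef_superPowerSum_ne_zero (Ne.symm h1)).1)

/-- Reversal multiplies each p_Λ by a nonzero scalar, so the prescribed values determine the form on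
a basis. -/
theorem eq_scalarProduct (B : symmetricSuperfunctions 𝕜 →ₗ[𝕜] symmetricSuperfunctions 𝕜 →ₗ[𝕜] 𝕜)
    (hr : ∀ Λ, rev (superPowerSum 𝕜 Λ) ∈ symmetricSuperfunctions 𝕜)
    (h : ∀ Λ Ω, B ⟨rev (superPowerSum 𝕜 Λ), hr Λ⟩ (powerSumBasis 𝕜 Ω) =
      if Λ = Ω then (Λ.z : 𝕜) else 0) : B = scalarProduct 𝕜 := by
  refine (powerSumBasis 𝕜).ext fun Λ => (powerSumBasis 𝕜).ext fun Ω => ?_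
  have h1 := (h Λ Ω).trans (scalarProduct_rev_powerSum 𝕜 Λ Ω (hr Λ)).symm
  rw [rev_powerSumBasis, map_smul, map_smul, LinearMap.smul_apply, LinearMap.smul_apply] at h1
  exact smul_right_injective 𝕜 (pow_ne_zero _ (neg_ne_zero.2 one_ne_zero)) h1

end Form

end SuperSym
theorem mainTheorem7 (𝕜 : Type*) [Field 𝕜] [CharZero 𝕜] :
    -- the kernel is well defined
    (∀ i j : ℕ, IsUnit (kernelDenominator 𝕜 i j)) ∧
    HasFormalProd (kernelFactor 𝕜) (kernel 𝕜) ∧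
    -- the expansion of the kernel
    FormallySummable (fun Λ : SuperPartition =>
      rev (embed left (superMonomial 𝕜 Λ)) * embed right (superComplete 𝕜 Λ)) ∧
    kernel 𝕜 = formalSum (fun Λ : SuperPartition =>
      rev (embed left (superMonomial 𝕜 Λ)) * embed right (superComplete 𝕜 Λ)) ∧
    -- there is exactly one bilinear form as in the definition of the scalar product, and the
    -- complete functions and the monomial functions are dual for it
    ∃ (hp : ∀ Λ, superPowerSum 𝕜 Λ ∈ symmetricSuperfunctions 𝕜)
      (hh : ∀ Λ, superComplete 𝕜 Λ ∈ symmetricSuperfunctions 𝕜)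
      (hm : ∀ Λ, superMonomial 𝕜 Λ ∈ symmetricSuperfunctions 𝕜)
      (hr : ∀ f ∈ symmetricSuperfunctions 𝕜, rev f ∈ symmetricSuperfunctions 𝕜)
      (B : symmetricSuperfunctions 𝕜 →ₗ[𝕜] symmetricSuperfunctions 𝕜 →ₗ[𝕜] 𝕜),
      (∀ Λ Ω : SuperPartition,
        B ⟨rev (superPowerSum 𝕜 Λ), hr _ (hp Λ)⟩ ⟨superPowerSum 𝕜 Ω, hp Ω⟩ =
          if Λ = Ω then (Λ.z : 𝕜) else 0) ∧
      (∀ B' : symmetricSuperfunctions 𝕜 →ₗ[𝕜] symmetricSuperfunctions 𝕜 →ₗ[𝕜] 𝕜,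
        (∀ Λ Ω : SuperPartition,
          B' ⟨rev (superPowerSum 𝕜 Λ), hr _ (hp Λ)⟩ ⟨superPowerSum 𝕜 Ω, hp Ω⟩ =
            if Λ = Ω then (Λ.z : 𝕜) else 0) → B' = B) ∧
      ∀ Λ Ω : SuperPartition,
        B ⟨rev (superComplete 𝕜 Λ), hr _ (hh Λ)⟩ ⟨superMonomial 𝕜 Ω, hm Ω⟩ =
          if Λ = Ω then 1 else 0 := by
  refine ⟨isUnit_kernelDenominator, hasFormalProd_kernel 𝕜,
    formallySummable_superMonomial_mul_superComplete, kernel_eq_formalSum 𝕜, superPowerSum_mem,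
    superComplete_mem, superMonomial_mem, fun _ hf => rev_mem hf, scalarProduct 𝕜, ?_, ?_, ?_⟩
  · intro Λ Ω
    rw [← powerSumBasis_apply]
    exact scalarProduct_rev_powerSum 𝕜 Λ Ω _
  · intro B h
    refine eq_scalarProduct 𝕜 B (fun Λ => rev_mem (superPowerSum_mem Λ)) fun Λ Ω => ?_
    rw [powerSumBasis_apply]
    exact h Λ Ω
  · intro Λ Ω
    rw [scalarProduct_rev_superComplete]
    exact canonicalCoef_superMonomial Λ Ω
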